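/- **Setting.** Let $\mathbf V$ be an N‑anholonomic manifold: a smooth manifold of dimension $n+m$ with a local fibred structure (the vertical subbundle $v\mathbf V\subset T\mathbf V$ is locally the kernel of the differential of a submersion to $\mathbb R^n$) and a nonlinear connection $\mathbf N:T\mathbf V\to v\mathbf V$, i.e. a smooth bundle morphism that is the identity on $v\mathbf V$; so $T\mathbf V=h\mathbf V\oplus v\mathbf V$ with $h\mathbf V=\ker\mathbf N$. For a smooth vector bundle $E\to\mathbf V$, $\omega^2(\mathbf V,E)$ denotes the smooth $E$‑valued 2‑forms, written in N‑adapted form as the sum of their $hh$-, $hv$- and $vv$-components. Let $\mathbf G=(G,{}^\bullet G)$ and $\check{\mathbf G}=(\check G,{}^\bullet\check G)$ be pairs of finite‑dimensional Lie groups (regarded as the groups $G\times{}^\bullet G$, $\check G\times{}^\bullet\check G$), with central extensions of Lie groups $0\to\mathbb Z_k\to\check G\to G\to1$ and $0\to\mathbb Z_k\to{}^\bullet\check G\to{}^\bullet G\to1$, where $k\ge1$ and $\mathbb Z_k\subset U(1)$. Let $p:\mathbf B\to\mathbf V$ be a smooth principal $\mathbf G$‑bundle; $\check{\mathbf G}$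 acts on $\mathbf B$ through $\pi:\check{\mathbf G}\to\mathbf G$ by $\check g\cdot b=b\,\pi(\check g)^{-1}$. For an integer $q$, a $\Psi^q$‑module is a smooth complex vector bundle $\mathbf W=\mathbf W_h\oplus\mathbf W_v\to\mathbf B$ of finite rank with a smooth, fibrewise linear lift of the $\check{\mathbf G}$‑action preserving the splitting, such that $(\zeta_h,\zeta_v)\in\mathbb Z_k\times\mathbb Z_k=\ker\pi$ acts as $\zeta_h^{\,q}$ on $\mathbf W_h$ and as $\zeta_v^{\,q}$ on $\mathbf W_v$. $\mathrm{End}(\mathbf W)$ denotes the endomorphisms preserving the splitting, and $\mathcal E(\mathbf W)=\mathrm{End}(\mathbf W)/\mathbf G$, a smooth vector bundle over $\mathbf V=\mathbf B/\mathbf G$. A $\Psi^q$‑module d‑connection on $\mathbf W$ is a smooth linear connection $\overleftarrow{\mathbf D}$ preserving the splitting of $\mathbf W$ such that, on each summand: 1. it is equivariant for $(U(1)\times\check{\mathbf G})/\mathbb Z_k$, where $U(1)$ acts by $z\mapsto z^q$ and $\mathbb Z_k$ (one copy for each summand) is embedded antidiagonally; 2. locally over $\mathbf V$, after identifying $p^{-1}(U)$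 with $U\times\mathbf G$, it is the sum of the natural flat equivariant connection along the fibres (for which the local frames invariant under $\check{\mathbf G}$ are parallel) and of the pull‑back of a connection from the base $U$. **Theorem.** Let $\overleftarrow{\mathbf D}$ be a $\Psi^q$‑module d‑connection on a $\Psi^q$‑module $\mathbf W$. Its curvature $[\overleftarrow{\mathbf D}_X,\overleftarrow{\mathbf D}_Y]-\overleftarrow{\mathbf D}_{[X,Y]}$ descends to an element of $\omega^2(\mathbf V,\mathcal E(\mathbf W))$: there is a unique $\overleftarrow{\mathbf R}\in\omega^2(\mathbf V,\mathcal E(\mathbf W))$ such that at every $b\in\mathbf B$ and for all vector fields $X,Y$ on $\mathbf B$, the curvature at $b$ in the directions $X,Y$ is the representative in $\mathrm{End}(\mathbf W_b)$ of $\overleftarrow{\mathbf R}_{p(b)}(dp\,X,dp\,Y)$. Moreover, let $\mathbf W'$ be a $\Psi^{q'}$‑module with a $\Psi^{q'}$‑module d‑connection $\overleftarrow{\mathbf D}{}'$ and descended curvature $\overleftarrow{\mathbf R}{}'$. There is a unique tensor product connection on $\mathbf W\otimes\mathbf W'$ (given by $\varphi\otimes\psi\mapsto\overleftarrow{\mathbf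 D}\varphi\otimes\psi+\varphi\otimes\overleftarrow{\mathbf D}{}'\psi$ on each of the four summands $\mathbf W_a\otimes\mathbf W'_c$, $a,c\in\{h,v\}$). Its curvature descends to a unique $\mathbf R_B\in\omega^2(\mathbf V,\mathcal E(\mathbf W\otimes\mathbf W'))$, where endomorphisms of $\mathbf W\otimes\mathbf W'$ preserve the four summands; the map $[S]\otimes[T]\mapsto[S\otimes T]$ is an isomorphism of bundles $\mathcal E(\mathbf W)\otimes\mathcal E(\mathbf W')\cong\mathcal E(\mathbf W\otimes\mathbf W')$; and under this identification $$\mathbf R_B=\overleftarrow{\mathbf R}\otimes1+1\otimes\overleftarrow{\mathbf R}{}'.$$ -/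

import Mathlib

open scoped Manifold ContDiff TensorProduct
open Module (Basis End)

noncomputable section

/-! ### Smooth complex vector bundles over a manifold -/

section Bundles

universe u w

variable {E : Type*} [NormedAddCommGroup E] [NormedSpace ℝ E] {H : Type*} [TopologicalSpace H]

/-- The product of smooth complex functions is smooth. -/
theorem contMDiffOn_mul_complex {I : ModelWithCorners ℝ E H} {M : Type*} [TopologicalSpace M]
    [ChartedSpace H M] {f g : M → ℂ} {s : Set M} (hf : ContMDiffOn I 𝓘(ℝ, ℂ) ∞ f s)
    (hg : ContMDiffOn I 𝓘(ℝ, ℂ) ∞ g s) : ContMDiffOn I 𝓘(ℝ, ℂ) ∞ (fun x => f x * g x) s :=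
  ((contDiff_mul (𝕜 := ℝ) (𝔸 := ℂ)).contMDiff).comp_contMDiffOn (hf.prodMk_space hg)

/-- A smooth complex vector bundle of finite rank over a real manifold `M`: a family of complex
vector spaces with an atlas of local frames (`frame i` is the local frame over the open set
`base i`; its values outside `base i` are irrelevant) whose transition matrices are smooth. -/
structure SmoothBundle (I : ModelWithCorners ℝ E H) (M : Type*) [TopologicalSpace M]
    [ChartedSpace H M] where
  Fib : M → Type u
  [addCommGroup : ∀ x, AddCommGroup (Fib x)]
  [module : ∀ x, Module ℂ (Fib x)]
  Idx : Type
  [fintypeIdx : Fintype Idx]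
  [decEqIdx : DecidableEq Idx]
  Fr : Type w
  base : Fr → Set M
  isOpen_base : ∀ i, IsOpen (base i)
  exists_mem_base : ∀ x, ∃ i, x ∈ base i
  frame : Fr → ∀ x, Basis Idx ℂ (Fib x)
  smooth_change : ∀ (i j : Fr) (α β : Idx), ContMDiffOn I 𝓘(ℝ, ℂ) ∞
    (fun x => (frame j x).repr (frame i x α) β) (base i ∩ base j)

attribute [instance] SmoothBundle.addCommGroup SmoothBundle.module SmoothBundle.fintypeIdx
  SmoothBundle.decEqIdx

variable {I : ModelWithCorners ℝ E H} {M : Type*} [TopologicalSpace M] [ChartedSpace H M]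

/-- Smooth vector fields on `M`. -/
def VField (I : ModelWithCorners ℝ E H) (M : Type*) [TopologicalSpace M] [ChartedSpace H M]
    [IsManifold I 1 M] :=
  {X : ∀ x : M, TangentSpace I x //
    ContMDiff I I.tangent ∞ (fun x => (⟨x, X x⟩ : TangentBundle I M))}

namespace SmoothBundle

/-- A section is smooth when its coefficients in every local frame are smooth. -/
def IsSmoothSection (W : SmoothBundle I M) (σ : ∀ x, W.Fib x) : Prop :=
  ∀ (i : W.Fr) (α : W.Idx), ContMDiffOn I 𝓘(ℝ, ℂ) ∞
    (fun x => (W.frame i x).repr (σ x) α) (W.base i)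

/-- The space of smooth sections, i.e. of `0`-forms with values in `W`. -/
def Sections (W : SmoothBundle I M) : Type _ := {σ : ∀ x, W.Fib x // W.IsSmoothSection σ}

/-- The sum of two smooth sections. -/
def addSection (W : SmoothBundle I M) (φ ψ : W.Sections) : W.Sections :=
  ⟨fun x => φ.1 x + ψ.1 x, fun i α => by
    refine ((φ.2 i α).add (ψ.2 i α)).congr fun x _ => ?_
    simp⟩

/-- The product of a smooth complex function and a smooth section. -/
def smulSection (W : SmoothBundle I M) (f : M → ℂ) (hf : ContMDiff I 𝓘(ℝ, ℂ) ∞ f)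
    (φ : W.Sections) : W.Sections :=
  ⟨fun x => f x • φ.1 x, fun i α => by
    refine (contMDiffOn_mul_complex hf.contMDiffOn (φ.2 i α)).congr fun x _ => ?_
    simp⟩

/-- The tensor product of two smooth complex vector bundles. -/
def tensor (W W' : SmoothBundle I M) : SmoothBundle I M where
  Fib x := W.Fib x ⊗[ℂ] W'.Fib x
  Idx := W.Idx × W'.Idx
  Fr := W.Fr × W'.Fr
  base i := W.base i.1 ∩ W'.base i.2
  isOpen_base i := (W.isOpen_base i.1).inter (W'.isOpen_base i.2)
  exists_mem_base x := by
    obtain ⟨i, hi⟩ := W.exists_mem_base x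
    obtain ⟨j, hj⟩ := W'.exists_mem_base x
    exact ⟨(i, j), hi, hj⟩
  frame i x := (W.frame i.1 x).tensorProduct (W'.frame i.2 x)
  smooth_change i j α β := by
    have h1 := (W.smooth_change i.1 j.1 α.1 β.1).mono
      (fun x (hx : x ∈ (W.base i.1 ∩ W'.base i.2) ∩ (W.base j.1 ∩ W'.base j.2)) =>
        ⟨hx.1.1, hx.2.1⟩)
    have h2 := (W'.smooth_change i.2 j.2 α.2 β.2).mono
      (fun x (hx : x ∈ (W.base i.1 ∩ W'.base i.2) ∩ (W.base j.1 ∩ W'.base j.2)) =>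
        ⟨hx.1.2, hx.2.2⟩)
    refine (contMDiffOn_mul_complex h2 h1).congr fun x _ => ?_
    rw [Basis.tensorProduct_apply']
    exact Basis.tensorProduct_repr_tmul_apply _ _ _ _ _ _

/-- The tensor product of two smooth sections. -/
def tmulSection (W W' : SmoothBundle I M) (φ : W.Sections) (ψ : W'.Sections) :
    (W.tensor W').Sections :=
  ⟨fun x => φ.1 x ⊗ₜ[ℂ] ψ.1 x, fun i α => by
    refine (contMDiffOn_mul_complex ((ψ.2 i.2 α.2).mono Set.inter_subset_right)
      ((φ.2 i.1 α.1).mono Set.inter_subset_left)).congr fun x _ => ?_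
    exact Basis.tensorProduct_repr_tmul_apply _ _ _ _ _ _⟩

/-- A fibrewise linear isomorphism which, like its inverse, has smooth coefficients in all local
frames: an isomorphism of smooth complex vector bundles. -/
def IsBundleIso (W W' : SmoothBundle I M) (κ : ∀ x, W.Fib x ≃ₗ[ℂ] W'.Fib x) : Prop :=
  (∀ i j α β, ContMDiffOn I 𝓘(ℝ, ℂ) ∞
    (fun x => (W'.frame j x).repr (κ x (W.frame i x α)) β) (W.base i ∩ W'.base j)) ∧
  (∀ i j α β, ContMDiffOn I 𝓘(ℝ, ℂ) ∞
    (fun x => (W.frame i x).repr ((κ x).symm (W'.frame j x α)) β) (W.base i ∩ W'.base j))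

end SmoothBundle

variable [IsManifold I 1 M]

/-- A (smooth, linear) connection on a complex vector bundle, as an operator from `0`-forms to
`1`-forms with values in `W`: `D φ x X` is the covariant derivative of `φ` at `x` along `X`. The
Leibniz rule is over smooth complex functions and so contains complex linearity. -/
structure Connection (W : SmoothBundle I M) where
  toFun : W.Sections → ∀ x, TangentSpace I x →ₗ[ℝ] W.Fib x
  add : ∀ φ ψ x X, toFun (W.addSection φ ψ) x X = toFun φ x X + toFun ψ x X
  leibniz : ∀ (f : M → ℂ) (hf : ContMDiff I 𝓘(ℝ, ℂ) ∞ f) (φ : W.Sections) (x : M)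
    (X : TangentSpace I x),
    toFun (W.smulSection f hf φ) x X = mvfderiv I f x X • φ.1 x + f x • toFun φ x X
  smooth : ∀ (φ : W.Sections) (X : VField I M),
    W.IsSmoothSection (fun x => toFun φ x (X.1 x))

namespace Connection

variable {W W' : SmoothBundle I M}

/-- The covariant derivative `D_X φ`. -/
def cov (D : Connection W) (X : VField I M) (φ : W.Sections) : W.Sections :=
  ⟨fun x => D.toFun φ x (X.1 x), D.smooth φ X⟩

/-- The curvature `R(X, Y) φ = D_X D_Y φ - D_Y D_X φ - D_[X, Y] φ`. -/
def curvature (D : Connection W) (X Y : VField I M) (φ : W.Sections) (x : M) : W.Fib x :=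
  (D.cov X (D.cov Y φ)).1 x - (D.cov Y (D.cov X φ)).1 x
    - D.toFun φ x (VectorField.mlieBracket I X.1 Y.1 x)

/-- `Dt` is the tensor product connection of `D` and `D'`: on `φ ⊗ ψ` it is
`D φ ⊗ ψ + φ ⊗ D' ψ`. -/
def IsTensor (D : Connection W) (D' : Connection W') (Dt : Connection (W.tensor W')) : Prop :=
  ∀ (φ : W.Sections) (ψ : W'.Sections) (x : M) (X : TangentSpace I x),
    Dt.toFun (W.tmulSection W' φ ψ) x X
      = (D.toFun φ x X ⊗ₜ[ℂ] ψ.1 x + φ.1 x ⊗ₜ[ℂ] D'.toFun ψ x X : W.Fib x ⊗[ℂ] W'.Fib x)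

end Connection

/-- Smooth differential `2`-forms with values in a complex vector bundle. -/
structure TwoForm (W : SmoothBundle I M) where
  toFun : ∀ x, TangentSpace I x [⋀^Fin 2]→ₗ[ℝ] W.Fib x
  smooth : ∀ X Y : VField I M, W.IsSmoothSection (fun x => toFun x ![X.1 x, Y.1 x])

/-! ### Nonlinear connections and distinguished forms -/

/-- A nonlinear connection on a manifold with a local fibred structure (with `n`-dimensional local
base): the vertical subbundle `vert` is locally the kernel of the differential of a submersion to
`ℝⁿ`, and `N : TM → vert` is a smooth bundle morphism which is the identity on `vert`. The
horizontal subbundle is the kernel of `N`. -/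
structure NConnection (n : ℕ) (I : ModelWithCorners ℝ E H) (M : Type*) [TopologicalSpace M]
    [ChartedSpace H M] [IsManifold I 1 M] where
  vert : ∀ x : M, Submodule ℝ (TangentSpace I x)
  fibred : ∀ x : M, ∃ U : Set M, IsOpen U ∧ x ∈ U ∧ ∃ q : M → EuclideanSpace ℝ (Fin n),
    ContMDiffOn I 𝓘(ℝ, EuclideanSpace ℝ (Fin n)) ∞ q U ∧
    ∀ y ∈ U, Function.Surjective (mvfderiv I q y) ∧
      ∀ X : TangentSpace I y, X ∈ vert y ↔ mvfderiv I q y X = 0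
  N : ∀ x : M, TangentSpace I x →L[ℝ] TangentSpace I x
  N_mem : ∀ x X, N x X ∈ vert x
  N_of_mem : ∀ x, ∀ X ∈ vert x, N x X = X
  smooth : ContMDiff I.tangent I.tangent ∞
    (fun X : TangentBundle I M => (⟨X.1, N X.1 X.2⟩ : TangentBundle I M))

namespace NConnection

variable {n : ℕ}

/-- The vertical part of a tangent vector. -/
def v (𝒩 : NConnection n I M) (x : M) (X : TangentSpace I x) : TangentSpace I x := 𝒩.N x X

/-- The horizontal part of a tangent vector. -/
def h (𝒩 : NConnection n I M) (x : M) (X : TangentSpace I x) : TangentSpace I x := X - 𝒩.N x X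

end NConnection

/-- Distinguished `2`-forms with values in `W`, i.e. elements of `ω²(M, W)`: a `2`-form written
in N-adapted form as the sum of its `hh`-, `hv`- and `vv`-components. -/
structure DTwoForm {n : ℕ} (𝒩 : NConnection n I M) (W : SmoothBundle I M) where
  hh : TwoForm W
  hv : TwoForm W
  vv : TwoForm W
  hh_type : ∀ x X Y, hh.toFun x ![X, Y] = hh.toFun x ![𝒩.h x X, 𝒩.h x Y]
  hv_type : ∀ x X Y, hv.toFun x ![X, Y]
    = hv.toFun x ![𝒩.h x X, 𝒩.v x Y] + hv.toFun x ![𝒩.v x X, 𝒩.h x Y]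
  vv_type : ∀ x X Y, vv.toFun x ![X, Y] = vv.toFun x ![𝒩.v x X, 𝒩.v x Y]

/-- The value of a distinguished `2`-form on two tangent vectors. -/
def DTwoForm.val {n : ℕ} {𝒩 : NConnection n I M} {W : SmoothBundle I M} (R : DTwoForm 𝒩 W)
    (x : M) (X Y : TangentSpace I x) : W.Fib x :=
  R.hh.toFun x ![X, Y] + R.hv.toFun x ![X, Y] + R.vv.toFun x ![X, Y]

end Bundles

/-! ### Principal bundles and equivariant bundles -/

section Equivariant

universe u w

variable {EK HK EG HG EB HB EV HV : Type*}
  [NormedAddCommGroup EK] [NormedSpace ℝ EK] [TopologicalSpace HK]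
  [NormedAddCommGroup EG] [NormedSpace ℝ EG] [TopologicalSpace HG]
  [NormedAddCommGroup EB] [NormedSpace ℝ EB] [TopologicalSpace HB]
  [NormedAddCommGroup EV] [NormedSpace ℝ EV] [TopologicalSpace HV]

/-- A smooth (right) principal `G`-bundle `B → V`. Over each small open set `U` there are a section
`s` and a smooth map `γ` such that `b = s (proj b) · γ b`, i.e. a local trivialization. -/
structure PrincipalBundle (IG : ModelWithCorners ℝ EG HG) (IB : ModelWithCorners ℝ EB HB)
    (IV : ModelWithCorners ℝ EV HV) (G B V : Type*) [Group G]
    [TopologicalSpace G] [ChartedSpace HG G] [TopologicalSpace B] [ChartedSpace HB B]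
    [TopologicalSpace V] [ChartedSpace HV V] where
  proj : B → V
  act : B → G → B
  proj_smooth : ContMDiff IB IV ∞ proj
  act_smooth : ContMDiff (IB.prod IG) IB ∞ (fun z : B × G => act z.1 z.2)
  act_one : ∀ b, act b 1 = b
  act_mul : ∀ b g g', act (act b g) g' = act b (g * g')
  proj_act : ∀ b g, proj (act b g) = proj b
  free : ∀ b g, act b g = b → g = 1
  locally_trivial : ∀ x : V, ∃ U : Set V, IsOpen U ∧ x ∈ U ∧ ∃ (s : V → B) (γ : B → G),
    ContMDiffOn IV IB ∞ s U ∧ ContMDiffOn IB IG ∞ γ (proj ⁻¹' U) ∧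
    (∀ y ∈ U, proj (s y) = y) ∧ ∀ b, proj b ∈ U → act (s (proj b)) (γ b) = b

/-- A covering homomorphism of Lie groups `K → G`: a surjective homomorphism which is a local
diffeomorphism. -/
structure LieCover (IK : ModelWithCorners ℝ EK HK) (IG : ModelWithCorners ℝ EG HG)
    (K G : Type*) [Group K] [TopologicalSpace K] [ChartedSpace HK K]
    [Group G] [TopologicalSpace G] [ChartedSpace HG G] where
  hom : K →* G
  surjective : Function.Surjective hom
  isLocalDiffeomorph : IsLocalDiffeomorph IK IG ∞ hom

variable {IK : ModelWithCorners ℝ EK HK} {IG : ModelWithCorners ℝ EG HG}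
  {IB : ModelWithCorners ℝ EB HB} {IV : ModelWithCorners ℝ EV HV}
  {K G B V : Type*} [Group K] [TopologicalSpace K] [ChartedSpace HK K]
  [Group G] [TopologicalSpace G] [ChartedSpace HG G]
  [TopologicalSpace B] [ChartedSpace HB B] [TopologicalSpace V] [ChartedSpace HV V]

namespace PrincipalBundle

/-- The left action of `K` on `B` through `K → G`: `k · b = b π(k)⁻¹`. -/
def lact (P : PrincipalBundle IG IB IV G B V) (c : LieCover IK IG K G) (k : K) (b : B) : B :=
  P.act b (c.hom k)⁻¹

variable (P : PrincipalBundle IG IB IV G B V) (c : LieCover IK IG K G)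

theorem lact_one (b : B) : P.lact c 1 b = b := by simp [lact, P.act_one]

theorem lact_mul (k l : K) (b : B) : P.lact c (k * l) b = P.lact c k (P.lact c l b) := by
  simp [lact, P.act_mul]

theorem lact_inv_lact (k : K) (b : B) : P.lact c k⁻¹ (P.lact c k b) = b := by
  rw [← lact_mul, inv_mul_cancel, lact_one]

theorem proj_lact (k : K) (b : B) : P.proj (P.lact c k b) = P.proj b := P.proj_act _ _

theorem exists_proj_eq (x : V) : ∃ b, P.proj b = x := by
  obtain ⟨U, -, hx, s, -, -, -, h, -⟩ := P.locally_trivial x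
  exact ⟨s x, h x hx⟩

theorem exists_act_eq {b b' : B} (h : P.proj b = P.proj b') : ∃ g, b' = P.act b g := by
  obtain ⟨U, -, hx, s, γ, -, -, -, h'⟩ := P.locally_trivial (P.proj b)
  have e1 := h' b hx
  have e2 := h' b' (h ▸ hx)
  refine ⟨(γ b)⁻¹ * γ b', ?_⟩
  have e3 : P.act b (γ b)⁻¹ = s (P.proj b) := by
    nth_rewrite 1 [← e1]
    rw [P.act_mul, mul_inv_cancel, P.act_one]
  rw [← P.act_mul, e3, h, e2]

theorem exists_lact_eq {b b' : B} (h : P.proj b = P.proj b') : ∃ k, b' = P.lact c k b := by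
  obtain ⟨g, hg⟩ := P.exists_act_eq h
  obtain ⟨k, hk⟩ := c.surjective g⁻¹
  exact ⟨k, by rw [lact, hk, inv_inv, hg]⟩

/-- A section of `B → V` which is smooth on an open set `U`, extended arbitrarily (as a set
theoretic section) outside `U`. -/
structure LocalSection (P : PrincipalBundle IG IB IV G B V) where
  U : Set V
  isOpen : IsOpen U
  s : V → B
  proj_s : ∀ x, P.proj (s x) = x
  smooth : ContMDiffOn IV IB ∞ s U

theorem exists_localSection (x : V) : ∃ S : P.LocalSection, x ∈ S.U := by
  classical
  obtain ⟨U, hU, hx, s, -, hs, -, h, -⟩ := P.locally_trivial x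
  choose t ht using P.exists_proj_eq
  refine ⟨⟨U, hU, fun y => if y ∈ U then s y else t y, fun y => ?_, ?_⟩, hx⟩
  · by_cases hy : y ∈ U
    · simp [hy, h]
    · simp [hy, ht]
  · exact hs.congr fun y hy => by simp [hy]

end PrincipalBundle

/-- A smooth `K`-equivariant complex vector bundle over `B`, where `K` acts on `B` through
`K → G`. The lift of `k : K` to the bundle is the family of linear isomorphisms
`lift k b b' : W_b → W_{b'}` for `b' = k · b`. The isotropy group of any point of `B` is the kernel
of `K → G`; it is required to act by scalars. -/
structure EqBundle (P : PrincipalBundle IG IB IV G B V) (c : LieCover IK IG K G) extends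
    SmoothBundle.{u, w} IB B where
  lift : ∀ (k : K) (b b' : B), b' = P.lact c k b → (Fib b ≃ₗ[ℂ] Fib b')
  lift_one : ∀ b h w, lift 1 b b h w = w
  lift_mul : ∀ k l b b' b'' h h' h'' w,
    lift (k * l) b b'' h'' w = lift k b' b'' h' (lift l b b' h w)
  lift_smooth : ∀ (i j : Fr) (α β : Idx), ContMDiffOn (IK.prod IB) 𝓘(ℝ, ℂ) ∞
    (fun z : K × B => (frame j (P.lact c z.1 z.2)).repr
      (lift z.1 z.2 (P.lact c z.1 z.2) rfl (frame i z.2 α)) β)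
    {z | z.2 ∈ base i ∧ P.lact c z.1 z.2 ∈ base j}
  isotropy : ∀ k, c.hom k = 1 → ∃ z : ℂ, ∀ b h w, lift k b b h w = z • w

namespace EqBundle

variable {P : PrincipalBundle IG IB IV G B V} {c : LieCover IK IG K G}

/-- The tensor product of equivariant bundles, with the diagonal action. -/
def tensor (W W' : EqBundle P c) : EqBundle P c where
  toSmoothBundle := W.toSmoothBundle.tensor W'.toSmoothBundle
  lift k b b' h := TensorProduct.congr (W.lift k b b' h) (W'.lift k b b' h)
  lift_one b h w := by
    have : TensorProduct.congr (W.lift 1 b b h) (W'.lift 1 b b h) = LinearEquiv.refl ℂ _ := by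
      refine LinearEquiv.toLinearMap_injective (TensorProduct.ext' fun x y => ?_)
      simp [W.lift_one, W'.lift_one]
    exact congrArg (fun e => e w) this
  lift_mul k l b b' b'' h h' h'' w := by
    have : TensorProduct.congr (W.lift (k * l) b b'' h'') (W'.lift (k * l) b b'' h'')
        = (TensorProduct.congr (W.lift l b b' h) (W'.lift l b b' h)).trans
          (TensorProduct.congr (W.lift k b' b'' h') (W'.lift k b' b'' h')) := by
      refine LinearEquiv.toLinearMap_injective (TensorProduct.ext' fun x y => ?_)
      simp only [LinearEquiv.coe_coe, LinearEquiv.trans_apply, TensorProduct.congr_tmul]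
      rw [W.lift_mul k l b b' b'' h h' h'' x, W'.lift_mul k l b b' b'' h h' h'' y]
    exact congrArg (fun e => e w) this
  lift_smooth i j α β := by
    refine (contMDiffOn_mul_complex
      ((W'.lift_smooth i.2 j.2 α.2 β.2).mono fun z hz => ⟨hz.1.2, hz.2.2⟩)
      ((W.lift_smooth i.1 j.1 α.1 β.1).mono fun z hz => ⟨hz.1.1, hz.2.1⟩)).congr fun z _ => ?_
    have e : ∀ x : B, (W.toSmoothBundle.tensor W'.toSmoothBundle).frame i x α
        = (W.frame i.1 x α.1 ⊗ₜ[ℂ] W'.frame i.2 x α.2 : W.Fib x ⊗[ℂ] W'.Fib x) :=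
      fun x => Basis.tensorProduct_apply' _ _ _
    rw [e]
    exact Basis.tensorProduct_repr_tmul_apply _ _ _ _ _ _
  isotropy k hk := by
    obtain ⟨z, hz⟩ := W.isotropy k hk
    obtain ⟨z', hz'⟩ := W'.isotropy k hk
    refine ⟨z * z', fun b h w => ?_⟩
    have : (TensorProduct.congr (W.lift k b b h) (W'.lift k b b h)).toLinearMap
        = (z * z') • LinearMap.id := by
      refine TensorProduct.ext' fun x y => ?_
      simp [hz, hz', TensorProduct.smul_tmul', TensorProduct.tmul_smul, smul_smul, mul_comm]
    exact congrArg (fun e => e w) this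

variable (W : EqBundle P c)

/-- The orbit relation of the action of `K` on the endomorphisms of the fibres of `W` over the
points of the fibre of `B → V` over `x`. The kernel of `K → G` acts trivially on endomorphisms, so
these are the orbits of an action of `G`. -/
def orbitSetoid (x : V) : Setoid (Σ b : {b : B // P.proj b = x}, End ℂ (W.Fib b.1)) where
  r y z := ∃ (k : K) (h : z.1.1 = P.lact c k y.1.1), z.2 = (W.lift k y.1.1 z.1.1 h).conj y.2
  iseqv := by
    refine ⟨fun y => ⟨1, (P.lact_one c _).symm, ?_⟩, ?_, ?_⟩
    · ext w
      rw [LinearEquiv.conj_apply_apply, W.lift_one]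
      congr 1
      exact (LinearEquiv.eq_symm_apply _).2 (W.lift_one _ _ _)
    · rintro ⟨⟨b, hb⟩, S⟩ ⟨⟨b', hb'⟩, T⟩ ⟨k, h, e⟩
      dsimp only at h e ⊢
      have h' : b = P.lact c k⁻¹ b' := by rw [h, P.lact_inv_lact]
      refine ⟨k⁻¹, h', ?_⟩
      have key : ∀ w, W.lift k⁻¹ b' b h' (W.lift k b b' h w) = w := fun w => by
        rw [← W.lift_mul k⁻¹ k b b' b h h' (by rw [inv_mul_cancel, P.lact_one])]
        have : ∀ l (hl : b = P.lact c l b), l = 1 → W.lift l b b hl w = w := by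
          rintro l hl rfl; exact W.lift_one _ _ _
        exact this _ _ (inv_mul_cancel k)
      ext w
      obtain ⟨u, rfl⟩ := (W.lift k⁻¹ b' b h').surjective w
      obtain ⟨v, rfl⟩ := (W.lift k b b' h).surjective u
      have key' : (W.lift k⁻¹ b' b h').symm v = W.lift k b b' h v :=
        (LinearEquiv.symm_apply_eq _).2 (key v).symm
      rw [e]
      simp [LinearEquiv.conj_apply_apply, key, key']
    · rintro ⟨⟨b, hb⟩, S⟩ ⟨⟨b', hb'⟩, T⟩ ⟨⟨b'', hb''⟩, T'⟩ ⟨k, h, e⟩ ⟨l, h', e'⟩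
      dsimp only at h e h' e' ⊢
      have h'' : b'' = P.lact c (l * k) b := by rw [h', h, P.lact_mul]
      refine ⟨l * k, h'', ?_⟩
      have : W.lift (l * k) b b'' h'' = (W.lift k b b' h).trans (W.lift l b' b'' h') := by
        ext w; exact W.lift_mul l k b b' b'' h h' h'' w
      rw [this, e', e]
      rfl

/-- The fibre over `x : V` of the bundle `End(W)/G → V`: the orbit space of `End(W)` restricted to
the fibre of `B → V` over `x`. -/
def OrbitFib (x : V) : Type _ := Quotient (W.orbitSetoid x)

/-- The class of an endomorphism of `W_b` in `End(W)/G`. -/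
def orbitMk {b : B} {x : V} (hb : P.proj b = x) (T : End ℂ (W.Fib b)) : W.OrbitFib x :=
  Quotient.mk (W.orbitSetoid x) ⟨⟨b, hb⟩, T⟩

/-- Conjugation by a lift depends only on the end points. -/
theorem conj_lift_eq {b b' : B} (k l : K) (h : b' = P.lact c k b) (h' : b' = P.lact c l b)
    (T : End ℂ (W.Fib b)) : (W.lift k b b' h).conj T = (W.lift l b b' h').conj T := by
  have hb : b = P.lact c (l⁻¹ * k) b := by
    rw [P.lact_mul, ← h, h', P.lact_inv_lact]
  have hm : c.hom (l⁻¹ * k) = 1 := by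
    exact inv_eq_one.1 (P.free b _ hb.symm)
  obtain ⟨z, hz⟩ := W.isotropy _ hm
  have key : ∀ w, W.lift k b b' h w = z • W.lift l b b' h' w := fun w => by
    have h3 : b' = P.lact c (l * (l⁻¹ * k)) b := by rw [mul_inv_cancel_left]; exact h
    have := W.lift_mul l (l⁻¹ * k) b b b' hb h' h3 w
    rw [hz, map_smul] at this
    rw [← this]
    have : ∀ m (hm : b' = P.lact c m b), m = k → W.lift m b b' hm w = W.lift k b b' h w := by
      rintro m hm rfl; rfl
    exact (this _ _ (mul_inv_cancel_left l k)).symm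
  ext u
  obtain ⟨w, rfl⟩ := (W.lift k b b' h).surjective u
  rw [LinearEquiv.conj_apply_apply, LinearEquiv.symm_apply_apply, key w,
    LinearEquiv.conj_apply_apply, map_smul, LinearEquiv.symm_apply_apply, key, map_smul, map_smul]

theorem orbitMk_bijective {b : B} {x : V} (hb : P.proj b = x) :
    Function.Bijective (W.orbitMk hb) := by
  constructor
  · intro S T h
    obtain ⟨k, h, e⟩ := Quotient.exact h
    dsimp only at h e
    rw [e, W.conj_lift_eq k 1 h (P.lact_one c b).symm]
    have : W.lift 1 b b (P.lact_one c b).symm = LinearEquiv.refl ℂ _ := by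
      ext w; exact W.lift_one _ _ _
    rw [this]
    rfl
  · intro q
    obtain ⟨⟨⟨b', hb'⟩, T⟩, rfl⟩ := Quotient.exists_rep q
    obtain ⟨k, hk⟩ := P.exists_lact_eq c (hb'.trans hb.symm)
    exact ⟨(W.lift k b' b hk).conj T, (Quotient.sound (s := W.orbitSetoid x) ⟨k, hk, rfl⟩).symm⟩

/-- The bijection of the fibre of `End(W)/G` over `x` with `End(W_b)`, for `b` over `x`: a class is
sent to its representative at `b`. -/
def repEquiv {b : B} {x : V} (hb : P.proj b = x) : W.OrbitFib x ≃ End ℂ (W.Fib b) :=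
  (Equiv.ofBijective _ (W.orbitMk_bijective hb)).symm

theorem repEquiv_symm_apply {b : B} {x : V} (hb : P.proj b = x) (T : End ℂ (W.Fib b)) :
    (W.repEquiv hb).symm T = W.orbitMk hb T := rfl

theorem repEquiv_eq {b b' : B} {x : V} (hb : P.proj b = x) (hb' : P.proj b' = x) (k : K)
    (h : b' = P.lact c k b) (q : W.OrbitFib x) :
    W.repEquiv hb' q = (W.lift k b b' h).conj (W.repEquiv hb q) := by
  rw [← Equiv.eq_symm_apply, repEquiv_symm_apply]
  conv_lhs => rw [← (W.repEquiv hb).symm_apply_apply q, repEquiv_symm_apply]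
  exact Quotient.sound (s := W.orbitSetoid x) ⟨k, h, rfl⟩

instance (x : V) : AddCommGroup (W.OrbitFib x) :=
  (W.repEquiv (P.exists_proj_eq x).choose_spec).addCommGroup

instance (x : V) : Module ℂ (W.OrbitFib x) :=
  (W.repEquiv (P.exists_proj_eq x).choose_spec).module ℂ

/-- Taking representatives at `b` is linear, so the vector space structure of the fibres of
`End(W)/G` is induced from `End(W)`. -/
def rep {b : B} {x : V} (hb : P.proj b = x) : W.OrbitFib x ≃ₗ[ℂ] End ℂ (W.Fib b) :=
  { W.repEquiv hb with
    map_add' := fun p q => by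
      have hb₀ := (P.exists_proj_eq x).choose_spec
      obtain ⟨k, hk⟩ := P.exists_lact_eq c (hb₀.trans hb.symm)
      have e : ∀ q, W.repEquiv hb₀ q = (W.repEquiv hb₀).linearEquiv ℂ q := fun _ => rfl
      simp only [Equiv.toFun_as_coe]
      rw [W.repEquiv_eq hb₀ hb k hk, W.repEquiv_eq hb₀ hb k hk, W.repEquiv_eq hb₀ hb k hk]
      rw [e, e, e, map_add, map_add]
    map_smul' := fun z q => by
      have hb₀ := (P.exists_proj_eq x).choose_spec
      obtain ⟨k, hk⟩ := P.exists_lact_eq c (hb₀.trans hb.symm)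
      have e : ∀ q, W.repEquiv hb₀ q = (W.repEquiv hb₀).linearEquiv ℂ q := fun _ => rfl
      simp only [Equiv.toFun_as_coe, RingHom.id_apply]
      rw [W.repEquiv_eq hb₀ hb k hk, W.repEquiv_eq hb₀ hb k hk]
      rw [e, e, map_smul, map_smul] }

theorem rep_eq {b b' : B} {x : V} (hb : P.proj b = x) (hb' : P.proj b' = x) (k : K)
    (h : b' = P.lact c k b) (q : W.OrbitFib x) :
    W.rep hb' q = (W.lift k b b' h).conj (W.rep hb q) := W.repEquiv_eq hb hb' k h q

theorem exists_local_lift [LieGroup IG ∞ G] (c : LieCover IK IG K G) (S S' : P.LocalSection)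
    {x : V} (hx : x ∈ S.U) (hx' : x ∈ S'.U) : ∃ k : V → K, ContMDiffAt IV IK ∞ k x ∧
      ∀ᶠ y in nhds x, S'.s y = P.lact c (k y) (S.s y) := by
  obtain ⟨U, hU, hxU, s, γ, -, hγ, -, h⟩ := P.locally_trivial x
  have hopen : IsOpen (P.proj ⁻¹' U) := hU.preimage P.proj_smooth.continuous
  have smooth_aux : ∀ T : P.LocalSection, x ∈ T.U → ContMDiffAt IV IG ∞ (fun y => γ (T.s y)) x := by
    intro T hT
    refine ContMDiffAt.comp x (hγ.contMDiffAt (hopen.mem_nhds ?_))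
      (T.smooth.contMDiffAt (T.isOpen.mem_nhds hT))
    change P.proj (T.s x) ∈ U
    rw [T.proj_s]; exact hxU
  obtain ⟨k₀, hk₀⟩ := c.surjective ((γ (S'.s x))⁻¹ * γ (S.s x))
  have hl := c.isLocalDiffeomorph k₀
  have hsm : ContMDiffAt IV IG ∞ (fun y => (γ (S'.s y))⁻¹ * γ (S.s y)) x :=
    (smooth_aux S' hx').inv.mul (smooth_aux S hx)
  refine ⟨fun y => hl.localInverse ((γ (S'.s y))⁻¹ * γ (S.s y)), ?_, ?_⟩
  · refine ContMDiffAt.comp x (g := hl.localInverse) ?_ hsm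
    rw [← hk₀]; exact hl.localInverse_contMDiffAt
  · have h1 : ∀ᶠ y in nhds x, (γ (S'.s y))⁻¹ * γ (S.s y) ∈ hl.localInverse.source := by
      refine hsm.continuousAt.eventually (hl.localInverse_open_source.mem_nhds ?_)
      simp only [← hk₀]; exact hl.localInverse_mem_source
    filter_upwards [h1, hU.mem_nhds hxU] with y hy hyU
    have e1 := h (S.s y) (by rw [S.proj_s]; exact hyU)
    have e2 := h (S'.s y) (by rw [S'.proj_s]; exact hyU)
    rw [S.proj_s] at e1
    rw [S'.proj_s] at e2
    rw [PrincipalBundle.lact, hl.localInverse_right_inv hy]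
    have e3 : P.act (S.s y) (γ (S.s y))⁻¹ = s y := by
      nth_rewrite 1 [← e1]
      rw [P.act_mul, mul_inv_cancel, P.act_one]
    rw [mul_inv_rev, inv_inv, ← P.act_mul, e3, e2]

/-- The frame of `End(W)/G` over a local section `s` of `B → V`, made of the classes of the
elementary endomorphisms at `s x` for a local frame of `W`. -/
def orbitFrame (S : P.LocalSection) (i : W.Fr) (x : V) :
    Basis (W.Idx × W.Idx) ℂ (W.OrbitFib x) :=
  ((W.frame i (S.s x)).linearMap (W.frame i (S.s x))).map (W.rep (S.proj_s x)).symm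

theorem orbitFrame_repr (S : P.LocalSection) (i : W.Fr) (x : V) (q : W.OrbitFib x)
    (β : W.Idx × W.Idx) : (W.orbitFrame S i x).repr q β
      = (W.frame i (S.s x)).repr (W.rep (S.proj_s x) q (W.frame i (S.s x) β.2)) β.1 := by
  rw [orbitFrame, Basis.map_repr, LinearEquiv.trans_apply, LinearEquiv.symm_symm,
    Basis.linearMap, Basis.map_repr, LinearEquiv.trans_apply, LinearEquiv.symm_symm,
    ← LinearMap.toMatrix_apply (W.frame i (S.s x)) (W.frame i (S.s x))]
  rfl

theorem linearMap_basis_apply {J F : Type*} [Fintype J] [DecidableEq J] [AddCommGroup F]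
    [Module ℂ F] (e : Basis J ℂ F) (α : J × J) (w : F) :
    (e.linearMap e α) w = e.repr w α.2 • e α.1 := by
  have : e.linearMap e α = (e.coord α.2).smulRight (e α.1) := by
    refine e.ext fun j => ?_
    rw [Basis.linearMap_apply_apply]
    by_cases hj : j = α.2
    · simp [hj]
    · simp [Ne.symm hj]
  rw [this]; rfl

theorem orbitFrame_change (S S' : P.LocalSection) (i j : W.Fr) (α β : W.Idx × W.Idx) (x : V)
    (k : K) (h : S'.s x = P.lact c k (S.s x)) (h' : S.s x = P.lact c k⁻¹ (S'.s x)) :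
    (W.orbitFrame S' j x).repr (W.orbitFrame S i x α) β
      = (W.frame i (S.s x)).repr (W.lift k⁻¹ _ _ h' (W.frame j (S'.s x) β.2)) α.2
        * (W.frame j (S'.s x)).repr (W.lift k _ _ h (W.frame i (S.s x) α.1)) β.1 := by
  have key : ∀ w, (W.lift k _ _ h).symm w = W.lift k⁻¹ _ _ h' w := fun w => by
    rw [LinearEquiv.symm_apply_eq]
    have h1 : S'.s x = P.lact c (k * k⁻¹) (S'.s x) := by rw [mul_inv_cancel, P.lact_one]
    rw [← W.lift_mul k k⁻¹ _ _ _ h' h h1]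
    have : ∀ l (hl : S'.s x = P.lact c l (S'.s x)), l = 1 → w = W.lift l _ _ hl w := by
      rintro l hl rfl; exact (W.lift_one _ _ _).symm
    exact this _ _ (mul_inv_cancel k)
  rw [orbitFrame_repr, W.rep_eq (S.proj_s x) (S'.proj_s x) k h, LinearEquiv.conj_apply_apply]
  have e : W.rep (S.proj_s x) (W.orbitFrame S i x α)
      = (W.frame i (S.s x)).linearMap (W.frame i (S.s x)) α := by
    rw [orbitFrame, Basis.map_apply, LinearEquiv.apply_symm_apply]
  rw [e, linearMap_basis_apply, key, map_smul, map_smul]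
  rfl

/-- The quotient bundle `End(W)/G → V`. Its local frames come from local sections of `B → V` and
local frames of `W`. -/
def orbitBundle [LieGroup IK ∞ K] [LieGroup IG ∞ G] : SmoothBundle IV V where
  Fib := W.OrbitFib
  Idx := W.Idx × W.Idx
  Fr := P.LocalSection × W.Fr
  base i := i.1.U ∩ i.1.s ⁻¹' (W.base i.2)
  isOpen_base i := i.1.smooth.continuousOn.isOpen_inter_preimage i.1.isOpen (W.isOpen_base _)
  exists_mem_base x := by
    obtain ⟨S, hS⟩ := P.exists_localSection x
    obtain ⟨i, hi⟩ := W.exists_mem_base (S.s x)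
    exact ⟨(S, i), hS, hi⟩
  frame i x := W.orbitFrame i.1 i.2 x
  smooth_change := by
    rintro ⟨S, i⟩ ⟨S', j⟩ α β x ⟨⟨hx, hxi⟩, hx', hxj⟩
    refine ContMDiffAt.contMDiffWithinAt ?_
    obtain ⟨k, hk, hks⟩ := exists_local_lift c S S' hx hx'
    have hs := S.smooth.contMDiffAt (S.isOpen.mem_nhds hx)
    have hs' := S'.smooth.contMDiffAt (S'.isOpen.mem_nhds hx')
    have hact : ContMDiff (IK.prod IB) IB ∞ (fun z : K × B => P.lact c z.1 z.2) :=
      P.act_smooth.comp (contMDiff_snd.prodMk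
        ((c.isLocalDiffeomorph.contMDiff.comp contMDiff_fst).inv))
    have hset : ∀ i j : W.Fr, IsOpen {z : K × B | z.2 ∈ W.base i ∧ P.lact c z.1 z.2 ∈ W.base j} :=
      fun i j => ((W.isOpen_base i).preimage continuous_snd).inter
        ((W.isOpen_base j).preimage hact.continuous)
    have hx1 : S'.s x = P.lact c (k x) (S.s x) := hks.self_of_nhds
    have hx2 : S.s x = P.lact c (k x)⁻¹ (S'.s x) := by rw [hx1, P.lact_inv_lact]
    have m1 := ContMDiffAt.comp x (f := fun y => (k y, S.s y))
      ((W.lift_smooth i j α.1 β.1).contMDiffAt ((hset i j).mem_nhds ⟨hxi, hx1 ▸ hxj⟩))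
      (hk.prodMk hs)
    have m2 := ContMDiffAt.comp x (f := fun y => ((k y)⁻¹, S'.s y))
      ((W.lift_smooth j i β.2 α.2).contMDiffAt ((hset j i).mem_nhds ⟨hxj, hx2 ▸ hxi⟩))
      (hk.inv.prodMk hs')
    have m := ContMDiffAt.comp x (f := fun y => (_, _))
      ((contDiff_mul (𝕜 := ℝ) (𝔸 := ℂ)).contMDiff.contMDiffAt) (m2.prodMk_space m1)
    refine m.congr_of_eventuallyEq ?_
    filter_upwards [hks] with y hy
    have hy2 : S.s y = P.lact c (k y)⁻¹ (S'.s y) := by rw [hy, P.lact_inv_lact]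
    rw [W.orbitFrame_change S S' i j α β y (k y) hy hy2]
    have aux : ∀ (l : K) (b b' : B) (hb : b' = P.lact c l b) (i j : W.Fr) (a d : W.Idx),
        (W.frame j b').repr (W.lift l b b' hb (W.frame i b a)) d
          = (W.frame j (P.lact c l b)).repr (W.lift l b (P.lact c l b) rfl (W.frame i b a)) d := by
      rintro l b b' rfl i j a d; rfl
    rw [aux, aux _ _ _ hy]
    rfl

end EqBundle

end Equivariant

/-! ### Module connections -/

section ModuleConnections

universe u w

variable {EK HK EG HG EB HB EV HV : Type*}
  [NormedAddCommGroup EK] [NormedSpace ℝ EK] [TopologicalSpace HK]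
  [NormedAddCommGroup EG] [NormedSpace ℝ EG] [TopologicalSpace HG]
  [NormedAddCommGroup EB] [NormedSpace ℝ EB] [TopologicalSpace HB]
  [NormedAddCommGroup EV] [NormedSpace ℝ EV] [TopologicalSpace HV]
  {IK : ModelWithCorners ℝ EK HK} {IG : ModelWithCorners ℝ EG HG}
  {IB : ModelWithCorners ℝ EB HB} {IV : ModelWithCorners ℝ EV HV}
  {K G B V : Type*} [Group K] [TopologicalSpace K] [ChartedSpace HK K]
  [Group G] [TopologicalSpace G] [ChartedSpace HG G]
  [TopologicalSpace B] [ChartedSpace HB B] [TopologicalSpace V] [ChartedSpace HV V]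
  {P : PrincipalBundle IG IB IV G B V} {c : LieCover IK IG K G}

namespace EqBundle

/-- For a local section `s` of `B → V` and a local frame `e` of `W`, the map
`(x, k) ↦ k · s x` pulls `W` back to the bundle over `U × K` with frame `(x, k) ↦ k · e (s x)`.
This is the coefficient `α` in that frame of the pullback of a section `φ` of `W`. -/
def pullCoord (W : EqBundle P c) (S : P.LocalSection) (i : W.Fr)
    (φ : W.toSmoothBundle.Sections) (α : W.Idx) (z : V × K) : ℂ :=
  (W.frame i (S.s z.1)).repr
    (W.lift z.2⁻¹ (P.lact c z.2 (S.s z.1)) (S.s z.1) (P.lact_inv_lact c z.2 (S.s z.1)).symm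
      (φ.1 (P.lact c z.2 (S.s z.1)))) α

variable [IsManifold IB 1 B] [IsManifold IV 1 V]

/-- `D` is equivariant for the group `(U(1) × K) / Z`: the element `(z, k)` acts on `W` as `z ^ q`
times the lift of `k`, and acts on vector fields by push-forward. -/
def IsEquivariant (W : EqBundle P c) (q : ℤ) (D : Connection W.toSmoothBundle) : Prop :=
  ∀ (z : Circle) (k : K) (X X' : VField IB B) (φ φ' : W.toSmoothBundle.Sections),
    (∀ b, X'.1 (P.lact c k b) = mfderiv IB IB (P.lact c k) b (X.1 b)) →
    (∀ b, φ'.1 (P.lact c k b) = (z : ℂ) ^ q • W.lift k b (P.lact c k b) rfl (φ.1 b)) →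
    ∀ b, (D.cov X' φ').1 (P.lact c k b)
      = (z : ℂ) ^ q • W.lift k b (P.lact c k b) rfl ((D.cov X φ).1 b)

/-- Over small open sets `U` of `V`, identify `B` with `U × G` by a section `s`. Then `D` is the sum
of the natural flat equivariant connection (the one for which the local frames
`k · s x ↦ k · e (s x)` are parallel) and of the pull-back of a connection matrix `a` of `1`-forms
from the base `U`. Tangent vectors of `B` are written as images of tangent vectors `(η, ζ)` of
`U × K` under the local diffeomorphism `(x, k) ↦ k · s x`. -/
def IsLocallyFlatAddPullback (W : EqBundle P c) (D : Connection W.toSmoothBundle) : Prop :=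
  ∀ x₀ : V, ∃ (S : P.LocalSection) (i : W.Fr)
    (a : ∀ x : V, TangentSpace IV x →ₗ[ℝ] Matrix W.Idx W.Idx ℂ),
    x₀ ∈ S.U ∧ (∀ x ∈ S.U, S.s x ∈ W.base i) ∧
    (∀ α β, ContMDiffOn IV.tangent 𝓘(ℝ, ℂ) ∞
      (fun η : TangentBundle IV V => a η.1 η.2 α β) {η | η.1 ∈ S.U}) ∧
    ∀ (φ : W.toSmoothBundle.Sections), ∀ x ∈ S.U, ∀ (k : K) (η : TangentSpace IV x)
      (ζ : TangentSpace IK k),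
      D.toFun φ (P.lact c k (S.s x))
          (mfderiv (IV.prod IK) IB (fun z : V × K => P.lact c z.2 (S.s z.1)) (x, k) (η, ζ))
        = W.lift k (S.s x) (P.lact c k (S.s x)) rfl
          (∑ α, (mvfderiv (IV.prod IK) (W.pullCoord S i φ α) (x, k) (η, ζ)
            + ∑ β, a x η α β * W.pullCoord S i φ β (x, k)) • W.frame i (S.s x) α)

/-- The curvature of `D`, a `2`-form on `B` with values in `End(W)`, descends to the `2`-form `R` on
`V` with values in `End(W)/G`: at each `b` over `x`, the curvature is the representative at `b` of
the value of `R` at `x` on the projected vectors. -/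
def CurvatureDescendsTo [LieGroup IK ∞ K] [LieGroup IG ∞ G] {n : ℕ}
    {𝒩 : NConnection n IV V} (W : EqBundle P c) (D : Connection W.toSmoothBundle)
    (R : DTwoForm 𝒩 W.orbitBundle) : Prop :=
  ∀ (X Y : VField IB B) (φ : W.toSmoothBundle.Sections) (b : B),
    D.curvature X Y φ b
      = W.rep (x := P.proj b) rfl (R.val (P.proj b) (mfderiv IB IV P.proj b (X.1 b))
          (mfderiv IB IV P.proj b (Y.1 b))) (φ.1 b)

/-- The section `1` of `End(W)/G`: the class of the identity endomorphism. -/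
def oneSection [LieGroup IK ∞ K] [LieGroup IG ∞ G] (W : EqBundle P c) (x : V) :
    W.orbitBundle.Fib x := W.orbitMk (P.exists_proj_eq x).choose_spec 1

/-- The value of `R ⊗ 1 + 1 ⊗ R'`, a `2`-form with values in `End(W)/G ⊗ End(W')/G`. -/
def tensorSumVal [LieGroup IK ∞ K] [LieGroup IG ∞ G] {n : ℕ} {𝒩 : NConnection n IV V}
    (W W' : EqBundle P c) (R : DTwoForm 𝒩 W.orbitBundle) (R' : DTwoForm 𝒩 W'.orbitBundle) (x : V)
    (X Y : TangentSpace IV x) : (W.orbitBundle.tensor W'.orbitBundle).Fib x :=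
  (R.val x X Y ⊗ₜ[ℂ] W'.oneSection x + W.oneSection x ⊗ₜ[ℂ] R'.val x X Y :
    W.orbitBundle.Fib x ⊗[ℂ] W'.orbitBundle.Fib x)

/-- `κ` is the canonical identification `End(W)/G ⊗ End(W')/G = End(W ⊗ W')/G`: the isomorphism of
smooth bundles over `V` with `[S] ⊗ [T] ↦ [S ⊗ T]` for endomorphisms `S` of `W_b`, `T` of `W'_b`. -/
def IsCanonicalIso [LieGroup IK ∞ K] [LieGroup IG ∞ G] (W W' : EqBundle P c)
    (κ : ∀ x, (W.orbitBundle.tensor W'.orbitBundle).Fib x ≃ₗ[ℂ] (W.tensor W').orbitBundle.Fib x) :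
    Prop :=
  SmoothBundle.IsBundleIso _ _ κ ∧
  ∀ (b : B) (S : End ℂ (W.Fib b)) (T : End ℂ (W'.Fib b)),
    κ (P.proj b) ((W.orbitMk rfl S : W.orbitBundle.Fib (P.proj b)) ⊗ₜ[ℂ]
        (W'.orbitMk rfl T : W'.orbitBundle.Fib (P.proj b)))
      = (W.tensor W').orbitMk rfl (TensorProduct.map S T)

end EqBundle

end ModuleConnections

/-! ### Lie d-groups, their central extensions, and modules of weight `q` -/

section DGroups

universe u w

theorem isLocalDiffeomorph_prodMap {E₁ H₁ E₂ H₂ E₃ H₃ E₄ H₄ Kh Gh Kv Gv : Type*}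
    [NormedAddCommGroup E₁] [NormedSpace ℝ E₁] [TopologicalSpace H₁]
    [NormedAddCommGroup E₂] [NormedSpace ℝ E₂] [TopologicalSpace H₂]
    [NormedAddCommGroup E₃] [NormedSpace ℝ E₃] [TopologicalSpace H₃]
    [NormedAddCommGroup E₄] [NormedSpace ℝ E₄] [TopologicalSpace H₄]
    {IKh : ModelWithCorners ℝ E₁ H₁} {IGh : ModelWithCorners ℝ E₂ H₂}
    {IKv : ModelWithCorners ℝ E₃ H₃} {IGv : ModelWithCorners ℝ E₄ H₄}
    [TopologicalSpace Kh] [ChartedSpace H₁ Kh] [TopologicalSpace Gh] [ChartedSpace H₂ Gh]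
    [TopologicalSpace Kv] [ChartedSpace H₃ Kv] [TopologicalSpace Gv] [ChartedSpace H₄ Gv]
    {f : Kh → Gh} {g : Kv → Gv}
    (hf : IsLocalDiffeomorph IKh IGh ∞ f) (hg : IsLocalDiffeomorph IKv IGv ∞ g) :
    IsLocalDiffeomorph (IKh.prod IKv) (IGh.prod IGv) ∞ (Prod.map f g) := by
  rintro ⟨x, y⟩
  obtain ⟨Φ, hx, hΦ⟩ := hf x
  obtain ⟨Θ, hy, hΘ⟩ := hg y
  refine ⟨{ toPartialEquiv := Φ.toPartialEquiv.prod Θ.toPartialEquiv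
            open_source := Φ.open_source.prod Θ.open_source
            open_target := Φ.open_target.prod Θ.open_target
            contMDiffOn_toFun := Φ.contMDiffOn_toFun.prodMap Θ.contMDiffOn_toFun
            contMDiffOn_invFun := Φ.contMDiffOn_invFun.prodMap Θ.contMDiffOn_invFun },
    ⟨hx, hy⟩, ?_⟩
  rintro ⟨z, w⟩ ⟨hz, hw⟩
  exact Prod.ext (hΦ hz) (hΘ hw)

/-- The labels of horizontal and vertical components of distinguished objects. -/
inductive HVPart
  | h
  | v

/-- A central extension `0 → ℤ/k → K → G → 1` of Lie groups. -/
structure CentralExtension {EK HK EG HG : Type*}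
    [NormedAddCommGroup EK] [NormedSpace ℝ EK] [TopologicalSpace HK]
    [NormedAddCommGroup EG] [NormedSpace ℝ EG] [TopologicalSpace HG]
    (k : ℕ) (IK : ModelWithCorners ℝ EK HK) (IG : ModelWithCorners ℝ EG HG) (K G : Type*)
    [Group K] [TopologicalSpace K] [ChartedSpace HK K]
    [Group G] [TopologicalSpace G] [ChartedSpace HG G] extends LieCover IK IG K G where
  incl : Multiplicative (ZMod k) →* K
  incl_injective : Function.Injective incl
  exact : incl.range = hom.ker
  central : ∀ a g, incl a * g = g * incl a

variable {EKh HKh EGh HGh EKv HKv EGv HGv EB HB EV HV : Type*}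
  [NormedAddCommGroup EKh] [NormedSpace ℝ EKh] [TopologicalSpace HKh]
  [NormedAddCommGroup EGh] [NormedSpace ℝ EGh] [TopologicalSpace HGh]
  [NormedAddCommGroup EKv] [NormedSpace ℝ EKv] [TopologicalSpace HKv]
  [NormedAddCommGroup EGv] [NormedSpace ℝ EGv] [TopologicalSpace HGv]
  [NormedAddCommGroup EB] [NormedSpace ℝ EB] [TopologicalSpace HB]
  [NormedAddCommGroup EV] [NormedSpace ℝ EV] [TopologicalSpace HV]
  {IKh : ModelWithCorners ℝ EKh HKh} {IGh : ModelWithCorners ℝ EGh HGh}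
  {IKv : ModelWithCorners ℝ EKv HKv} {IGv : ModelWithCorners ℝ EGv HGv}
  {IB : ModelWithCorners ℝ EB HB} {IV : ModelWithCorners ℝ EV HV}
  {Kh Gh Kv Gv B V : Type*} [Group Kh] [TopologicalSpace Kh] [ChartedSpace HKh Kh]
  [Group Gh] [TopologicalSpace Gh] [ChartedSpace HGh Gh]
  [Group Kv] [TopologicalSpace Kv] [ChartedSpace HKv Kv]
  [Group Gv] [TopologicalSpace Gv] [ChartedSpace HGv Gv]
  [TopologicalSpace B] [ChartedSpace HB B] [TopologicalSpace V] [ChartedSpace HV V]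

/-- The covering homomorphism `Kh × Kv → Gh × Gv` of the Lie d-groups `(Kh, Kv)` and `(Gh, Gv)`
defined by a horizontal and a vertical covering homomorphism. -/
def LieCover.prod (c : LieCover IKh IGh Kh Gh) (d : LieCover IKv IGv Kv Gv) :
    LieCover (IKh.prod IKv) (IGh.prod IGv) (Kh × Kv) (Gh × Gv) where
  hom := c.hom.prodMap d.hom
  surjective := c.surjective.prodMap d.surjective
  isLocalDiffeomorph := isLocalDiffeomorph_prodMap c.isLocalDiffeomorph d.isLocalDiffeomorph

/-- A `Ψ^q`-module for the central extensions `0 → ℤ/k → Kh → Gh → 1` and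
`0 → ℤ/k → Kv → Gv → 1` and a principal bundle `B → V` of the Lie d-group `(Gh, Gv)`: a d-bundle
`W = W_h ⊕ W_v` over `B`, equivariant for the Lie d-group `(Kh, Kv)`, on whose horizontal
(vertical) component the element `(a_h, a_v)` of the isotropy groups acts as multiplication by
`exp(2πi q a_h / k)` (by `exp(2πi q a_v / k)`). -/
structure PsiModule {k : ℕ} [NeZero k] (P : PrincipalBundle (IGh.prod IGv) IB IV (Gh × Gv) B V)
    (ch : CentralExtension k IKh IGh Kh Gh) (cv : CentralExtension k IKv IGv Kv Gv) (q : ℤ) where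
  comp : HVPart → EqBundle.{u, w} P (ch.toLieCover.prod cv.toLieCover)
  weight_h : ∀ (ah av : ZMod k) (b : B) h (w : (comp .h).Fib b),
    (comp .h).lift (ch.incl (.ofAdd ah), cv.incl (.ofAdd av)) b b h w
      = (ZMod.toCircle ah : ℂ) ^ q • w
  weight_v : ∀ (ah av : ZMod k) (b : B) h (w : (comp .v).Fib b),
    (comp .v).lift (ch.incl (.ofAdd ah), cv.incl (.ofAdd av)) b b h w
      = (ZMod.toCircle av : ℂ) ^ q • w

variable [IsManifold IB 1 B] [IsManifold IV 1 V] {k : ℕ} [NeZero k]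
  {P : PrincipalBundle (IGh.prod IGv) IB IV (Gh × Gv) B V}
  {ch : CentralExtension k IKh IGh Kh Gh} {cv : CentralExtension k IKv IGv Kv Gv} {q : ℤ}

/-- A d-connection on `W = W_h ⊕ W_v`: a connection preserving the splitting, i.e. a pair of
connections on `W_h` and `W_v`. -/
def PsiModule.DConnection (W : PsiModule.{u, w} P ch cv q) : Type _ :=
  ∀ p : HVPart, Connection (W.comp p).toSmoothBundle

/-- `Ψ^q`-module d-connections: the equivariant d-connections which locally are the sum of the
natural flat connection along the fibres of `B → V` and of the pull-back of a connection from the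
base. -/
structure PsiModule.IsModuleDConnection (W : PsiModule.{u, w} P ch cv q) (D : W.DConnection) :
    Prop where
  equivariant : ∀ p, (W.comp p).IsEquivariant q (D p)
  locally_flat_add_pullback : ∀ p, (W.comp p).IsLocallyFlatAddPullback (D p)

end DGroups

end

/-! Descent. Over a small open set `U` of `V`, condition 2 provides the invariant frame `k · e (s
x)` of `W`, in which the connection is `d + p^* a` for a matrix `a` of 1-forms on `U`. Its curvature
matrix in that frame is `p^*(da + a ∧ a)`: tangent vectors enter only through `dp`, and the entries
are constant along the fibres of `p`. Reading the matrix in the frame of `End(W)/G` made of the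
classes of elementary endomorphisms at `s x` gives a 2-form on `U` (`exists_local_descent`). No
exterior derivative is needed: `a` is written as `∑ A_μ dy_μ` with coordinate functions `y_μ`, so
that `da = ∑ dA_μ ∧ dy_μ`, and `[X, Y] f = X Y f - Y X f` (`mvfderiv_mlieBracket`) removes the
second derivatives in `curvature_coeff`.

Uniqueness. The projection is a submersion, vector fields and sections take arbitrary values at a
point, and a class in `End(W)/G` is determined by its representative at one `b` (`eq_of_rep_eq`).
The same argument makes the local 2-forms agree on overlaps, so they glue. The splitting into `hh`,
`hv` and `vv` components is pointwise linear algebra, and the components can be recovered from the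
total value.

Tensor products. An additive operator on sections that satisfies the Leibniz rule at a point
(`IsDerivationAt`) is determined by its values on a local frame; hence two such operators on `W ⊗
W'` that agree on all products `φ ⊗ ψ` are equal (`eq_of_tmul`). This yields the uniqueness of the
tensor product connection and the independence of its local formula from the frames, hence its
existence. Curvature is such an operator along the zero vector. On `φ ⊗ ψ` the mixed terms `D φ ⊗ D'
ψ` cancel in the commutator, which leaves `R φ ⊗ ψ + φ ⊗ R' ψ`.

The identification of the endomorphism bundles is the finite-dimensional isomorphism `End ⊗ End =
End(⊗)` in the fibres. It commutes with conjugation by diagonal lifts, so it passes to the quotient,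
and it matches local frames up to reindexing, so it is smooth. -/

noncomputable section

set_option linter.unusedSectionVars false

/-! ### Derivatives of complex functions along tangent vectors -/

section Calculus

variable {E : Type*} [NormedAddCommGroup E] [NormedSpace ℝ E] {H : Type*} [TopologicalSpace H]
  {I : ModelWithCorners ℝ E H} {M : Type*} [TopologicalSpace M] [ChartedSpace H M]
  {E' : Type*} [NormedAddCommGroup E'] [NormedSpace ℝ E'] {H' : Type*} [TopologicalSpace H']
  {I' : ModelWithCorners ℝ E' H'} {M' : Type*} [TopologicalSpace M'] [ChartedSpace H' M']

theorem mvfderiv_congr_nhds {f g : M → ℂ} {x : M} (h : f =ᶠ[nhds x] g) (X : TangentSpace I x) :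
    mvfderiv I f x X = mvfderiv I g x X := by
  have e := h.mfderiv_eq (I := I) (I' := 𝓘(ℝ, ℂ))
  simp only [mvfderiv, ContinuousLinearMap.comp_apply]
  exact congrArg (fun L : TangentSpace I x →L[ℝ] ℂ => L X) e

theorem mvfderiv_complex_mul_apply {f g : M → ℂ} {x : M} (hf : MDifferentiableAt I 𝓘(ℝ, ℂ) f x)
    (hg : MDifferentiableAt I 𝓘(ℝ, ℂ) g x) (X : TangentSpace I x) :
    mvfderiv I (fun y => f y * g y) x X = f x * mvfderiv I g x X + mvfderiv I f x X * g x := by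
  have h := (hf.hasMFDerivAt.mul' hg.hasMFDerivAt).mfderiv
  exact congrArg (fun L : TangentSpace I x →L[ℝ] ℂ => L X) h

theorem mvfderiv_complex_sum_apply {ι : Type*} (s : Finset ι) {f : ι → M → ℂ} {x : M}
    (hf : ∀ i ∈ s, MDifferentiableAt I 𝓘(ℝ, ℂ) (f i) x) (X : TangentSpace I x) :
    MDifferentiableAt I 𝓘(ℝ, ℂ) (fun y => ∑ i ∈ s, f i y) x ∧
    mvfderiv I (fun y => ∑ i ∈ s, f i y) x X = ∑ i ∈ s, mvfderiv I (f i) x X := by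
  classical
  induction s using Finset.induction_on with
  | empty =>
    simp only [Finset.sum_empty]
    exact ⟨mdifferentiableAt_const, by rw [mvfderiv_const]; rfl⟩
  | insert i s hi ih =>
    simp only [Finset.sum_insert hi]
    obtain ⟨h1, h2⟩ := ih fun j hj => hf j (Finset.mem_insert_of_mem hj)
    have h0 := hf i (Finset.mem_insert_self _ _)
    refine ⟨h0.add h1, ?_⟩
    rw [mvfderiv_fun_add h0 h1, add_apply, h2]

theorem mvfderiv_complex_comp_apply {g : M' → ℂ} {f : M → M'} {x : M}
    (hg : MDifferentiableAt I' 𝓘(ℝ, ℂ) g (f x)) (hf : MDifferentiableAt I I' f x)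
    (X : TangentSpace I x) :
    mvfderiv I (fun y => g (f y)) x X = mvfderiv I' g (f x) (mfderiv I I' f x X) :=
  mfderiv_comp_apply x hg hf X

/-- The tangent map of `f` composed with the field is smooth, and the derivative along the field is
its fibre component. -/
theorem contMDiffOn_mvfderiv_apply [IsManifold I 1 M] {f : M → ℂ} {U : Set M} (hU : IsOpen U)
    (hf : ContMDiffOn I 𝓘(ℝ, ℂ) ∞ f U) {X : ∀ x : M, TangentSpace I x}
    (hX : ContMDiffOn I I.tangent ∞ (fun x => (⟨x, X x⟩ : TangentBundle I M)) U) :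
    ContMDiffOn I 𝓘(ℝ, ℂ) ∞ (fun x => mvfderiv I f x (X x)) U := by
  have h1 := hf.contMDiffOn_tangentMapWithin (m := ∞) (by simp) hU.uniqueMDiffOn
  have h2 := h1.comp hX (fun x hx => hx)
  have h3 := (contMDiff_snd_tangentBundle_modelSpace (n := ∞) (𝕜 := ℝ) ℂ 𝓘(ℝ, ℂ)).comp_contMDiffOn h2
  refine h3.congr fun x hx => ?_
  simp only [Function.comp, tangentMapWithin]
  rw [mfderivWithin_of_isOpen hU hx]
  rfl

end Calculus

/-! ### The Lie bracket as a commutator of derivations -/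

section Bracket

open VectorField

variable {E : Type*} [NormedAddCommGroup E] [NormedSpace ℝ E]
  {M : Type*} [TopologicalSpace M] [ChartedSpace E M] [IsManifold 𝓘(ℝ, E) ∞ M]

/-- Chain rule for `f = (f ∘ φ⁻¹) ∘ φ`. The chart is centred at `x₀` rather than at `x` because the
formula is needed at all points near the centre, in order to be differentiated again. -/
theorem mvfderiv_eq_fderiv_chart {f : M → ℂ} {x₀ x : M} (hx : x ∈ (extChartAt 𝓘(ℝ, E) x₀).source)
    (hf : MDifferentiableAt 𝓘(ℝ, E) 𝓘(ℝ, ℂ) f x) (X : TangentSpace 𝓘(ℝ, E) x) :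
    mvfderiv 𝓘(ℝ, E) f x X = fderiv ℝ (f ∘ (extChartAt 𝓘(ℝ, E) x₀).symm)
      (extChartAt 𝓘(ℝ, E) x₀ x) (mfderiv 𝓘(ℝ, E) 𝓘(ℝ, E) (extChartAt 𝓘(ℝ, E) x₀) x X) := by
  set φ := extChartAt 𝓘(ℝ, E) x₀
  have hφ : MDifferentiableAt 𝓘(ℝ, E) 𝓘(ℝ, E) φ x :=
    (contMDiffAt_extChartAt' (n := 1) (by simpa [φ] using hx)).mdifferentiableAt (by simp)
  have hφs : MDifferentiableAt 𝓘(ℝ, E) 𝓘(ℝ, E) φ.symm (φ x) := by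
    have := contMDiffOn_extChartAt_symm (n := 1) (I := 𝓘(ℝ, E)) x₀
    exact (this.contMDiffAt ((isOpen_extChartAt_target x₀).mem_nhds
      (φ.map_source hx))).mdifferentiableAt (by simp)
  have hf' : MDifferentiableAt 𝓘(ℝ, E) 𝓘(ℝ, ℂ) f (φ.symm (φ x)) := by rwa [φ.left_inv hx]
  have hc : MDifferentiableAt 𝓘(ℝ, E) 𝓘(ℝ, ℂ) (f ∘ φ.symm) (φ x) := hf'.comp (φ x) hφs
  have e : f =ᶠ[nhds x] fun y => (f ∘ φ.symm) (φ y) := by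
    filter_upwards [extChartAt_source_mem_nhds' (I := 𝓘(ℝ, E)) hx] with y hy
    simp [φ.left_inv hy]
  rw [mvfderiv_congr_nhds e, mvfderiv_complex_comp_apply hc hφ]
  have : mvfderiv 𝓘(ℝ, E) (f ∘ φ.symm) (φ x) = fderiv ℝ (f ∘ φ.symm) (φ x) := by
    ext v; simp only [mvfderiv, mfderiv_eq_fderiv]; rfl
  rw [this]
  rfl

/-- Differentiation along the bracket is the commutator of the differentiations. -/
theorem mvfderiv_mlieBracket [CompleteSpace E] {f : M → ℂ} {U : Set M} (hU : IsOpen U)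
    (hf : ContMDiffOn 𝓘(ℝ, E) 𝓘(ℝ, ℂ) ∞ f U) (X Y : VField 𝓘(ℝ, E) M) {x : M} (hx : x ∈ U) :
    mvfderiv 𝓘(ℝ, E) f x (mlieBracket 𝓘(ℝ, E) X.1 Y.1 x)
      = mvfderiv 𝓘(ℝ, E) (fun y => mvfderiv 𝓘(ℝ, E) f y (Y.1 y)) x (X.1 x)
        - mvfderiv 𝓘(ℝ, E) (fun y => mvfderiv 𝓘(ℝ, E) f y (X.1 y)) x (Y.1 x) := by
  set φ := extChartAt 𝓘(ℝ, E) x with hφ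
  have hs : x ∈ φ.source := mem_extChartAt_source x
  have hfd : ∀ y ∈ U, MDifferentiableAt 𝓘(ℝ, E) 𝓘(ℝ, ℂ) f y := fun y hy =>
    (hf.contMDiffAt (hU.mem_nhds hy)).mdifferentiableAt (by simp)
  have hsymm : ContMDiffAt 𝓘(ℝ, E) 𝓘(ℝ, E) 2 φ.symm (φ x) :=
    (contMDiffOn_extChartAt_symm (n := 2) (I := 𝓘(ℝ, E)) x).contMDiffAt
      ((isOpen_extChartAt_target x).mem_nhds (φ.map_source hs))
  have hfφ : ContDiffAt ℝ 2 (f ∘ φ.symm) (φ x) := by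
    rw [← contMDiffAt_iff_contDiffAt]
    refine ContMDiffAt.comp _ ?_ hsymm
    rw [φ.left_inv hs]
    exact (hf.contMDiffAt (hU.mem_nhds hx)).of_le ENat.LEInfty.out
  -- `P Z` is the coordinate expression of the field `Z` in the chart `φ`.
  let P : VField 𝓘(ℝ, E) M → E → E := fun Z =>
    mpullbackWithin 𝓘(ℝ, E) 𝓘(ℝ, E) φ.symm Z.1 (Set.range 𝓘(ℝ, E))
  have hP : ∀ Z : VField 𝓘(ℝ, E) M, DifferentiableAt ℝ (P Z) (φ x) := fun Z => by
    have h := (Z.2 x).mdifferentiableAt (by simp)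
    have := (mdifferentiableWithinAt_univ.2 h).differentiableWithinAt_mpullbackWithin_vectorField
    rw [show (extChartAt 𝓘(ℝ, E) x).symm ⁻¹' Set.univ ∩ Set.range 𝓘(ℝ, E) = Set.univ by simp]
      at this
    exact differentiableWithinAt_univ.1 this
  have hPv : ∀ (Z : VField 𝓘(ℝ, E) M), ∀ y ∈ φ.source,
      mfderiv 𝓘(ℝ, E) 𝓘(ℝ, E) φ y (Z.1 y) = P Z (φ y) := fun Z y hy => by
    have h1 := mfderivWithin_extChartAt_symm_comp_mfderiv_extChartAt' (I := 𝓘(ℝ, E)) hy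
    have h2 := isInvertible_mfderivWithin_extChartAt_symm (I := 𝓘(ℝ, E)) (φ.map_source hy)
    simp only [P, mpullbackWithin_apply]
    obtain ⟨L, hL⟩ := h2
    have h3 : ∀ v : TangentSpace 𝓘(ℝ, E) y,
        L (mfderiv 𝓘(ℝ, E) 𝓘(ℝ, E) φ y v) = v := fun v => by
      have := congrArg (fun A : TangentSpace 𝓘(ℝ, E) y →L[ℝ] TangentSpace 𝓘(ℝ, E) y => A v) h1
      rw [← hφ, ← hL] at this
      exact this
    rw [← hφ] at hL
    rw [← hL, ContinuousLinearMap.inverse_equiv]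
    -- `φ.symm (φ y)` equals `y` only propositionally, so the two values of `Z` lie in different
    -- tangent spaces; both are compared as elements of `E`.
    have h4 : ∀ y' (h : y' = y), (Z.1 y' : E) = Z.1 y := by rintro _ rfl; rfl
    have h5 : (Z.1 (φ.symm (φ y)) : E) = Z.1 y := h4 _ (φ.left_inv hy)
    exact ((ContinuousLinearEquiv.symm_apply_eq L).2 (h5.trans (h3 (Z.1 y)).symm)).symm
  have hD : ∀ Z : VField 𝓘(ℝ, E) M, ∀ᶠ y in nhds x, mvfderiv 𝓘(ℝ, E) f y (Z.1 y)
      = (fun z => fderiv ℝ (f ∘ φ.symm) z (P Z z)) (φ y) := fun Z => by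
    filter_upwards [extChartAt_source_mem_nhds (I := 𝓘(ℝ, E)) x, hU.mem_nhds hx] with y hy hyU
    rw [mvfderiv_eq_fderiv_chart hy (hfd y hyU), hPv Z y hy]
  have hφd : MDifferentiableAt 𝓘(ℝ, E) 𝓘(ℝ, E) φ x :=
    (contMDiffAt_extChartAt (n := 1)).mdifferentiableAt (by simp)
  have hDD : ∀ Z T : VField 𝓘(ℝ, E) M,
      mvfderiv 𝓘(ℝ, E) (fun y => mvfderiv 𝓘(ℝ, E) f y (Z.1 y)) x (T.1 x)
        = fderiv ℝ (fun z => fderiv ℝ (f ∘ φ.symm) z (P Z z)) (φ x) (P T (φ x)) := fun Z T => by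
    have hd : DifferentiableAt ℝ (fun z => fderiv ℝ (f ∘ φ.symm) z (P Z z)) (φ x) :=
      ((hfφ.fderiv_right (m := 1) (by norm_num)).differentiableAt (by simp)).clm_apply (hP Z)
    rw [mvfderiv_congr_nhds (hD Z), mvfderiv_complex_comp_apply hd.mdifferentiableAt hφd,
      hPv T x hs]
    simp only [mvfderiv, mfderiv_eq_fderiv]
    rfl
  -- In coordinates the identity is the vector space formula for the bracket, which rests on the
  -- symmetry of the second derivative of the `C²` function `f ∘ φ.symm`.
  rw [hDD, hDD, ← fderiv_apply_lieBracket hfφ (by simp) (hP Y) (hP X),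
    mvfderiv_eq_fderiv_chart hs (hfd x hx)]
  congr 1
  -- The bracket on the manifold is the pullback by the chart of the bracket of the coordinate
  -- expressions; the derivative of the chart undoes this pullback.
  rw [← mlieBracketWithin_univ, mlieBracketWithin_apply]
  obtain ⟨L, hL⟩ := isInvertible_mfderiv_extChartAt (I := 𝓘(ℝ, E)) hs
  rw [← hL, ContinuousLinearMap.inverse_equiv]
  refine (ContinuousLinearEquiv.apply_symm_apply L _).trans ?_
  rw [show (extChartAt 𝓘(ℝ, E) x).symm ⁻¹' Set.univ ∩ Set.range 𝓘(ℝ, E) = Set.univ by simp]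
  exact congrFun lieBracketWithin_univ (φ x)

end Bracket

/-! ### Cut-off functions and extension of tangent vectors -/

section Bump

variable {E : Type*} [NormedAddCommGroup E] [NormedSpace ℝ E] [FiniteDimensional ℝ E]
  {M : Type*} [TopologicalSpace M] [ChartedSpace E M] [T2Space M] [IsManifold 𝓘(ℝ, E) ∞ M]

theorem exists_bump {x : M} {U : Set M} (hU : U ∈ nhds x) : ∃ χ : M → ℝ,
    ContMDiff 𝓘(ℝ, E) 𝓘(ℝ, ℝ) ∞ χ ∧ (∀ᶠ y in nhds x, χ y = 1) ∧ tsupport χ ⊆ U := by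
  obtain ⟨χ, -, h⟩ := (SmoothBumpFunction.nhds_basis_tsupport (I := 𝓘(ℝ, E)) x).mem_iff.1 hU
  exact ⟨χ, χ.contMDiff, χ.eventuallyEq_one, h⟩

theorem exists_complex_bump {x : M} {U : Set M} (hU : U ∈ nhds x) : ∃ χ : M → ℂ,
    ContMDiff 𝓘(ℝ, E) 𝓘(ℝ, ℂ) ∞ χ ∧ (∀ᶠ y in nhds x, χ y = 1) ∧ tsupport χ ⊆ U := by
  obtain ⟨χ, h1, h2, h3⟩ := exists_bump (E := E) hU
  refine ⟨fun y => (χ y : ℂ), Complex.ofRealCLM.contMDiff.comp h1, ?_, ?_⟩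
  · filter_upwards [h2] with y hy
    simp [hy]
  · refine subset_trans (closure_mono fun y hy => ?_) h3
    simpa using hy

/-- Every tangent vector is the value of a smooth vector field. -/
theorem exists_vField_apply_eq (x : M) (v : TangentSpace 𝓘(ℝ, E) x) :
    ∃ X : VField 𝓘(ℝ, E) M, X.1 x = v := by
  obtain ⟨s, hs, h⟩ := FiberBundle.exists_contMDiffOn_extend (k := ∞) 𝓘(ℝ, E) E
    (V := (TangentSpace 𝓘(ℝ, E) : M → Type _)) (x₀ := x) v
  obtain ⟨U, hUs, hU, hxU⟩ := mem_nhds_iff.1 hs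
  obtain ⟨χ, h1, h2, h3⟩ := exists_bump (E := E) (hU.mem_nhds hxU)
  refine ⟨⟨_, ContMDiffOn.smul_section_of_tsupport h1.contMDiffOn hU h3 (h.mono hUs)⟩, ?_⟩
  simp [h2.self_of_nhds]

end Bump

/-! ### Smooth sections and derivations at a point -/

section Sections

universe u w u' w'

variable {E : Type*} [NormedAddCommGroup E] [NormedSpace ℝ E] {H : Type*} [TopologicalSpace H]
  {I : ModelWithCorners ℝ E H} {M : Type*} [TopologicalSpace M] [ChartedSpace H M]

theorem contMDiffAt_mul_complex {f g : M → ℂ} {x : M} (hf : ContMDiffAt I 𝓘(ℝ, ℂ) ∞ f x)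
    (hg : ContMDiffAt I 𝓘(ℝ, ℂ) ∞ g x) : ContMDiffAt I 𝓘(ℝ, ℂ) ∞ (fun y => f y * g y) x :=
  ((contDiff_mul (𝕜 := ℝ) (𝔸 := ℂ)).contMDiff.contMDiffAt).comp x (hf.prodMk_space hg)

namespace SmoothBundle

variable {W : SmoothBundle.{u, w} I M} {W' : SmoothBundle.{u', w'} I M}

theorem Sections.ext {φ ψ : W.Sections} (h : ∀ x, φ.1 x = ψ.1 x) : φ = ψ :=
  Subtype.ext (funext h)

theorem repr_change (i j : W.Fr) (x : M) (v : W.Fib x) (β : W.Idx) :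
    (W.frame j x).repr v β
      = ∑ α, (W.frame i x).repr v α * (W.frame j x).repr (W.frame i x α) β := by
  conv_lhs => rw [← (W.frame i x).sum_repr v]
  simp only [map_sum, map_smul, Finsupp.finsetSum_apply, Finsupp.smul_apply, smul_eq_mul]

/-- Smoothness of a section may be tested near each point in one local frame. -/
theorem isSmoothSection_of_frames {σ : ∀ x, W.Fib x}
    (h : ∀ x, ∃ i, x ∈ W.base i ∧ ∀ α, ContMDiffAt I 𝓘(ℝ, ℂ) ∞
      (fun y => (W.frame i y).repr (σ y) α) x) : W.IsSmoothSection σ := by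
  intro j β x hx
  obtain ⟨i, hi, hs⟩ := h x
  refine ContMDiffAt.contMDiffWithinAt ?_
  have : ContMDiffAt I 𝓘(ℝ, ℂ) ∞ (fun y => ∑ α, (W.frame i y).repr (σ y) α
      * (W.frame j y).repr (W.frame i y α) β) x :=
    contMDiffAt_finsetSum fun α _ => contMDiffAt_mul_complex (hs α)
      ((W.smooth_change i j α β).contMDiffAt
        (((W.isOpen_base i).inter (W.isOpen_base j)).mem_nhds ⟨hi, hx⟩))
  exact this.congr_of_eventuallyEq (Filter.Eventually.of_forall fun y => repr_change i j y _ β)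

theorem IsSmoothSection.contMDiffAt {σ : ∀ x, W.Fib x} (h : W.IsSmoothSection σ) {i : W.Fr} {x : M}
    (hx : x ∈ W.base i) (α : W.Idx) :
    ContMDiffAt I 𝓘(ℝ, ℂ) ∞ (fun y => (W.frame i y).repr (σ y) α) x :=
  (h i α).contMDiffAt ((W.isOpen_base i).mem_nhds hx)

theorem isSmoothSection_sum {ι : Type*} (s : Finset ι) (f : ι → M → ℂ)
    (hf : ∀ a, ContMDiff I 𝓘(ℝ, ℂ) ∞ (f a)) (e : ι → W.Sections) :
    W.IsSmoothSection fun x => ∑ a ∈ s, f a x • (e a).1 x := by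
  intro i α
  have : ContMDiffOn I 𝓘(ℝ, ℂ) ∞ (fun x => ∑ a ∈ s, f a x * (W.frame i x).repr ((e a).1 x) α)
      (W.base i) :=
    contMDiffOn_finsetSum fun a _ => contMDiffOn_mul_complex (hf a).contMDiffOn ((e a).2 i α)
  refine this.congr fun x _ => ?_
  simp [map_sum, Finsupp.finsetSum_apply]

/-- An additive map on smooth sections which satisfies the Leibniz rule at `x` for the derivative
of functions along the tangent vector `X`. -/
structure IsDerivationAt (W : SmoothBundle.{u, w} I M) (x : M) (X : TangentSpace I x)
    (T : W.Sections → W.Fib x) : Prop where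
  add : ∀ φ ψ, T (W.addSection φ ψ) = T φ + T ψ
  leibniz : ∀ (f : M → ℂ) (hf : ContMDiff I 𝓘(ℝ, ℂ) ∞ f) (φ : W.Sections),
    T (W.smulSection f hf φ) = mvfderiv I f x X • φ.1 x + f x • T φ

theorem IsDerivationAt.sum {x : M} {X : TangentSpace I x} {T : W.Sections → W.Fib x}
    (hT : W.IsDerivationAt x X T) {ι : Type*} (s : Finset ι) (f : ι → M → ℂ)
    (hf : ∀ a, ContMDiff I 𝓘(ℝ, ℂ) ∞ (f a)) (e : ι → W.Sections) (τ : W.Sections)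
    (hτ : ∀ y, τ.1 y = ∑ a ∈ s, f a y • (e a).1 y) :
    T τ = ∑ a ∈ s, (mvfderiv I (f a) x X • (e a).1 x + f a x • T (e a)) := by
  classical
  induction s using Finset.induction_on generalizing τ with
  | empty =>
    -- The value at the zero section is read off from the Leibniz rule for the zero function.
    have h := hT.leibniz (fun _ => 0) contMDiff_const τ
    have e : W.smulSection (fun _ => 0) contMDiff_const τ = τ :=
      Sections.ext fun y => by rw [hτ y]; simp [smulSection]
    rw [e, mvfderiv_const] at h
    rw [h]
    simp
  | insert a s ha ih =>
    let τ' : W.Sections := ⟨_, isSmoothSection_sum s f hf e⟩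
    have h : τ = W.addSection (W.smulSection (f a) (hf a) (e a)) τ' := Sections.ext fun y => by
      rw [hτ y, Finset.sum_insert ha]; rfl
    rw [h, hT.add, hT.leibniz, ih τ' fun _ => rfl, Finset.sum_insert ha]

/-- The smooth global sections `e α` agree with the local frame `i` near `x`. -/
def IsFrameNear (W : SmoothBundle.{u, w} I M) (i : W.Fr) (e : W.Idx → W.Sections) (x : M) : Prop :=
  ∀ᶠ y in nhds x, y ∈ W.base i ∧ ∀ α, (e α).1 y = W.frame i y α

theorem IsFrameNear.eventually {i : W.Fr} {e : W.Idx → W.Sections} {x : M}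
    (h : W.IsFrameNear i e x) : ∀ᶠ y in nhds x, W.IsFrameNear i e y :=
  eventually_eventually_nhds.2 h

theorem IsFrameNear.tensor {i : W.Fr} {e : W.Idx → W.Sections} {x : M} {j : W'.Fr}
    {e' : W'.Idx → W'.Sections} (h : W.IsFrameNear i e x) (h' : W'.IsFrameNear j e' x) :
    (W.tensor W').IsFrameNear (i, j) (fun α => W.tmulSection W' (e α.1) (e' α.2)) x := by
  filter_upwards [h, h'] with y hy hy'
  refine ⟨⟨hy.1, hy'.1⟩, fun α => ?_⟩
  change (e α.1).1 y ⊗ₜ[ℂ] (e' α.2).1 y = (W.frame i y).tensorProduct (W'.frame j y) α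
  rw [hy.2, hy'.2]
  exact (Basis.tensorProduct_apply' _ _ _).symm

end SmoothBundle

end Sections

/-! ### Localization of derivations, and curvature of tensor products -/

section GlobalFrames

universe u w u' w'

variable {E : Type*} [NormedAddCommGroup E] [NormedSpace ℝ E] [FiniteDimensional ℝ E]
  {M : Type*} [TopologicalSpace M] [ChartedSpace E M] [T2Space M] [IsManifold 𝓘(ℝ, E) ∞ M]

namespace SmoothBundle

variable {W : SmoothBundle.{u, w} 𝓘(ℝ, E) M} {W' : SmoothBundle.{u', w'} 𝓘(ℝ, E) M}

/-- A family of vectors with smooth coefficients over an open set, cut off by a function supported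
there, is a smooth section. -/
theorem isSmoothSection_smul_of_tsupport {χ : M → ℂ} (hχ : ContMDiff 𝓘(ℝ, E) 𝓘(ℝ, ℂ) ∞ χ)
    {U : Set M} (hχU : tsupport χ ⊆ U) {σ : ∀ x, W.Fib x}
    (hσ : ∀ x ∈ U, ∃ i, x ∈ W.base i ∧ ∀ α, ContMDiffAt 𝓘(ℝ, E) 𝓘(ℝ, ℂ) ∞
      (fun y => (W.frame i y).repr (σ y) α) x) :
    W.IsSmoothSection fun x => χ x • σ x := by
  refine isSmoothSection_of_frames fun x => ?_
  by_cases hx : x ∈ tsupport χ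
  · obtain ⟨i, hi, hs⟩ := hσ x (hχU hx)
    refine ⟨i, hi, fun α => ?_⟩
    simpa using contMDiffAt_mul_complex hχ.contMDiffAt (hs α)
  · obtain ⟨i, hi⟩ := W.exists_mem_base x
    refine ⟨i, hi, fun α => ?_⟩
    refine (contMDiffAt_const (c := (0 : ℂ))).congr_of_eventuallyEq ?_
    filter_upwards [(isClosed_tsupport χ).isOpen_compl.mem_nhds hx] with y hy
    have : χ y = 0 := image_eq_zero_of_notMem_tsupport hy
    simp [this]

theorem exists_isFrameNear {i : W.Fr} {x : M} (hx : x ∈ W.base i) :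
    ∃ e : W.Idx → W.Sections, W.IsFrameNear i e x := by
  obtain ⟨χ, h1, h2, h3⟩ := exists_complex_bump (E := E) ((W.isOpen_base i).mem_nhds hx)
  refine ⟨fun α => ⟨fun y => χ y • W.frame i y α,
    isSmoothSection_smul_of_tsupport h1 h3 fun y hy => ⟨i, hy, fun β => ?_⟩⟩, ?_⟩
  · simp only [Basis.repr_self]
    exact contMDiffAt_const
  · filter_upwards [h2, (W.isOpen_base i).mem_nhds hx] with y hy hyi
    exact ⟨hyi, fun α => by simp [hy]⟩

/-- Every vector is the value of a smooth section. -/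
theorem exists_section_apply_eq (x : M) (v : W.Fib x) : ∃ φ : W.Sections, φ.1 x = v := by
  obtain ⟨i, hi⟩ := W.exists_mem_base x
  obtain ⟨e, he⟩ := exists_isFrameNear hi
  refine ⟨⟨_, isSmoothSection_sum Finset.univ (fun α _ => (W.frame i x).repr v α)
    (fun _ => contMDiff_const) e⟩, ?_⟩
  simp only [he.self_of_nhds.2]
  exact (W.frame i x).sum_repr v

/-- A derivation at a point is determined by its values on a local frame. -/
theorem IsDerivationAt.eq_sum {x : M} {X : TangentSpace 𝓘(ℝ, E) x} {T : W.Sections → W.Fib x}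
    (hT : W.IsDerivationAt x X T) {i : W.Fr} {e : W.Idx → W.Sections} (he : W.IsFrameNear i e x)
    (σ : W.Sections) :
    T σ = ∑ α, (mvfderiv 𝓘(ℝ, E) (fun y => (W.frame i y).repr (σ.1 y) α) x X • W.frame i x α
      + (W.frame i x).repr (σ.1 x) α • T (e α)) := by
  obtain ⟨U, hU, hUo, hxU⟩ := mem_nhds_iff.1 he
  obtain ⟨χ, h1, h2, h3⟩ := exists_complex_bump (E := E) (hUo.mem_nhds hxU)
  -- The local coefficients, cut off by `χ`, are globally smooth, and `χ σ` is globally their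
  -- combination of the sections `e α`. Since `χ = 1` near `x`, the operator takes the same value on
  -- `χ σ` as on `σ`.
  have hf : ∀ α, ContMDiff 𝓘(ℝ, E) 𝓘(ℝ, ℂ) ∞
      (fun y => χ y * (W.frame i y).repr (σ.1 y) α) := fun α => by
    refine contMDiff_of_tsupport fun y hy => ?_
    have hy' : y ∈ tsupport χ := closure_mono (Function.support_mul_subset_left _ _) hy
    exact contMDiffAt_mul_complex h1.contMDiffAt (σ.2.contMDiffAt (hU (h3 hy')).1 α)
  have hχ : mvfderiv 𝓘(ℝ, E) χ x X = 0 := by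
    rw [mvfderiv_congr_nhds (g := fun _ => 1) h2, mvfderiv_const]; rfl
  have hσ := hT.leibniz χ h1 σ
  rw [hχ, h2.self_of_nhds, zero_smul, one_smul, zero_add] at hσ
  rw [← hσ, hT.sum Finset.univ _ hf e _ fun y => ?_]
  · refine Finset.sum_congr rfl fun α _ => ?_
    rw [mvfderiv_congr_nhds (g := fun y => (W.frame i y).repr (σ.1 y) α),
      h2.self_of_nhds, one_mul, he.self_of_nhds.2]
    filter_upwards [h2] with y hy
    simp [hy]
  · change χ y • σ.1 y = _
    -- On the support of `χ` the sections `e α` are the frame; off it both sides vanish.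
    by_cases hy : y ∈ tsupport χ
    · simp only [(hU (h3 hy)).2, mul_smul]
      rw [← Finset.smul_sum, (W.frame i y).sum_repr]
    · simp [image_eq_zero_of_notMem_tsupport hy]

/-- The products of sections extending local frames of `W` and `W'` form a local frame of `W ⊗ W'`,
and a derivation is determined by its values on a frame. -/
theorem IsDerivationAt.eq_of_tmul {x : M} {X : TangentSpace 𝓘(ℝ, E) x}
    {T T' : (W.tensor W').Sections → (W.tensor W').Fib x}
    (hT : (W.tensor W').IsDerivationAt x X T) (hT' : (W.tensor W').IsDerivationAt x X T')
    (h : ∀ φ ψ, T (W.tmulSection W' φ ψ) = T' (W.tmulSection W' φ ψ)) (σ : (W.tensor W').Sections) :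
    T σ = T' σ := by
  obtain ⟨i, hi⟩ := W.exists_mem_base x
  obtain ⟨e, he⟩ := exists_isFrameNear hi
  obtain ⟨j, hj⟩ := W'.exists_mem_base x
  obtain ⟨e', he'⟩ := exists_isFrameNear hj
  rw [hT.eq_sum (he.tensor he'), hT'.eq_sum (he.tensor he')]
  simp only [h]

end SmoothBundle

namespace Connection

open SmoothBundle

variable {W : SmoothBundle.{u, w} 𝓘(ℝ, E) M} {W' : SmoothBundle.{u', w'} 𝓘(ℝ, E) M}

theorem ext_toFun {D D' : Connection W} (h : ∀ φ x X, D.toFun φ x X = D'.toFun φ x X) : D = D' := by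
  cases D; cases D'
  congr
  funext φ x
  exact LinearMap.ext (h φ x)

theorem isDerivationAt (D : Connection W) (x : M) (X : TangentSpace 𝓘(ℝ, E) x) :
    W.IsDerivationAt x X fun φ => D.toFun φ x X :=
  ⟨fun φ ψ => D.add φ ψ x X, fun f hf φ => D.leibniz f hf φ x X⟩

theorem IsTensor.unique {D : Connection W} {D' : Connection W'}
    {Dt Dt' : Connection (W.tensor W')} (h : D.IsTensor D' Dt) (h' : D.IsTensor D' Dt') :
    Dt = Dt' :=
  ext_toFun fun σ x X => (Dt.isDerivationAt x X).eq_of_tmul (Dt'.isDerivationAt x X)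
    (fun φ ψ => (h φ ψ x X).trans (h' φ ψ x X).symm) σ

theorem cov_addSection (D : Connection W) (X : VField 𝓘(ℝ, E) M) (φ ψ : W.Sections) :
    D.cov X (W.addSection φ ψ) = W.addSection (D.cov X φ) (D.cov X ψ) :=
  Sections.ext fun x => D.add φ ψ x _

theorem contMDiff_mvfderiv_vField {f : M → ℂ} (hf : ContMDiff 𝓘(ℝ, E) 𝓘(ℝ, ℂ) ∞ f)
    (X : VField 𝓘(ℝ, E) M) :
    ContMDiff 𝓘(ℝ, E) 𝓘(ℝ, ℂ) ∞ (fun x => mvfderiv 𝓘(ℝ, E) f x (X.1 x)) :=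
  contMDiffOn_univ.1 (contMDiffOn_mvfderiv_apply isOpen_univ hf.contMDiffOn X.2.contMDiffOn)

theorem cov_smulSection (D : Connection W) (X : VField 𝓘(ℝ, E) M) {f : M → ℂ}
    (hf : ContMDiff 𝓘(ℝ, E) 𝓘(ℝ, ℂ) ∞ f) (φ : W.Sections) :
    D.cov X (W.smulSection f hf φ)
      = W.addSection (W.smulSection _ (contMDiff_mvfderiv_vField hf X) φ)
        (W.smulSection f hf (D.cov X φ)) :=
  Sections.ext fun x => D.leibniz f hf φ x _

/-- Taking the tangent vector to be `0` encodes that curvature is linear over functions. In the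
Leibniz expansion, the first-derivative terms `X f • D_Y φ` and `Y f • D_X φ` occur symmetrically
and cancel, and the second derivatives of `f` cancel against `[X, Y] f`. -/
theorem curvature_isDerivationAt (D : Connection W) (X Y : VField 𝓘(ℝ, E) M) (x : M) :
    W.IsDerivationAt x 0 fun φ => D.curvature X Y φ x := by
  constructor
  · intro φ ψ
    simp only [curvature, cov_addSection, D.add]
    simp only [addSection]
    abel
  · intro f hf φ
    have hX := D.leibniz _ (contMDiff_mvfderiv_vField hf Y) φ x (X.1 x)
    have hY := D.leibniz _ (contMDiff_mvfderiv_vField hf X) φ x (Y.1 x)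
    have hb := mvfderiv_mlieBracket isOpen_univ hf.contMDiffOn X Y (Set.mem_univ x)
    have h1 : (D.cov X (D.cov Y (W.smulSection f hf φ))).1 x
        = D.toFun (W.smulSection _ (contMDiff_mvfderiv_vField hf Y) φ) x (X.1 x)
          + D.toFun (W.smulSection f hf (D.cov Y φ)) x (X.1 x) := by
      rw [cov_smulSection, cov_addSection]; rfl
    have h2 : (D.cov Y (D.cov X (W.smulSection f hf φ))).1 x
        = D.toFun (W.smulSection _ (contMDiff_mvfderiv_vField hf X) φ) x (Y.1 x)
          + D.toFun (W.smulSection f hf (D.cov X φ)) x (Y.1 x) := by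
      rw [cov_smulSection, cov_addSection]; rfl
    simp only [curvature]
    rw [h1, h2, hX, hY, D.leibniz, D.leibniz, D.leibniz, hb, map_zero]
    simp only [cov]
    module

theorem cov_tmulSection {D : Connection W} {D' : Connection W'} {Dt : Connection (W.tensor W')}
    (h : D.IsTensor D' Dt) (X : VField 𝓘(ℝ, E) M) (φ : W.Sections) (ψ : W'.Sections) :
    Dt.cov X (W.tmulSection W' φ ψ) = (W.tensor W').addSection
      (W.tmulSection W' (D.cov X φ) ψ) (W.tmulSection W' φ (D'.cov X ψ)) :=
  Sections.ext fun x => h φ ψ x _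

/-- Both orders of differentiation produce the same mixed terms `D_Y φ ⊗ D'_X ψ + D_X φ ⊗ D'_Y ψ`,
which drop out of the commutator. -/
theorem IsTensor.curvature_tmul {D : Connection W} {D' : Connection W'}
    {Dt : Connection (W.tensor W')} (h : D.IsTensor D' Dt) (X Y : VField 𝓘(ℝ, E) M)
    (φ : W.Sections) (ψ : W'.Sections) (x : M) :
    Dt.curvature X Y (W.tmulSection W' φ ψ) x
      = (D.curvature X Y φ x ⊗ₜ[ℂ] ψ.1 x + φ.1 x ⊗ₜ[ℂ] D'.curvature X Y ψ x :
        W.Fib x ⊗[ℂ] W'.Fib x) := by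
  have key : ∀ Z T : VField 𝓘(ℝ, E) M, (Dt.cov Z (Dt.cov T (W.tmulSection W' φ ψ))).1 x
      = (((D.cov Z (D.cov T φ)).1 x ⊗ₜ[ℂ] ψ.1 x + (D.cov T φ).1 x ⊗ₜ[ℂ] (D'.cov Z ψ).1 x)
        + ((D.cov Z φ).1 x ⊗ₜ[ℂ] (D'.cov T ψ).1 x + φ.1 x ⊗ₜ[ℂ] (D'.cov Z (D'.cov T ψ)).1 x) :
        W.Fib x ⊗[ℂ] W'.Fib x) := fun Z T => by
    rw [cov_tmulSection h, cov_addSection, cov_tmulSection h, cov_tmulSection h]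
    rfl
  have hb := h φ ψ x (VectorField.mlieBracket 𝓘(ℝ, E) X.1 Y.1 x)
  simp only [curvature]
  rw [hb, key, key]
  have aux : ∀ (a b c : W.Fib x) (a' b' c' : W'.Fib x) (p q : W.Fib x ⊗[ℂ] W'.Fib x)
      (u : W.Fib x) (u' : W'.Fib x),
      ((a ⊗ₜ[ℂ] u' + p) + (q + u ⊗ₜ[ℂ] a')) - ((b ⊗ₜ[ℂ] u' + q) + (p + u ⊗ₜ[ℂ] b'))
        - (c ⊗ₜ[ℂ] u' + u ⊗ₜ[ℂ] c') = (a - b - c) ⊗ₜ[ℂ] u' + u ⊗ₜ[ℂ] (a' - b' - c') := by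
    intros
    simp only [TensorProduct.sub_tmul, TensorProduct.tmul_sub]
    abel
  exact aux _ _ _ _ _ _ _ _ _ _

end Connection

end GlobalFrames

/-! ### Existence of the tensor product connection -/

section TensorConnection

universe u w u' w'

variable {E : Type*} [NormedAddCommGroup E] [NormedSpace ℝ E] [FiniteDimensional ℝ E]
  {M : Type*} [TopologicalSpace M] [ChartedSpace E M] [T2Space M] [IsManifold 𝓘(ℝ, E) ∞ M]

namespace SmoothBundle

theorem coeff_mdifferentiableAt {W : SmoothBundle.{u, w} 𝓘(ℝ, E) M} (σ : W.Sections) {i : W.Fr}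
    {x : M} (hx : x ∈ W.base i) (α : W.Idx) :
    MDifferentiableAt 𝓘(ℝ, E) 𝓘(ℝ, ℂ) (fun y => (W.frame i y).repr (σ.1 y) α) x :=
  (σ.2.contMDiffAt hx α).mdifferentiableAt (by simp)

variable (W : SmoothBundle.{u, w} 𝓘(ℝ, E) M) (W' : SmoothBundle.{u', w'} 𝓘(ℝ, E) M)

/-- The tensor product in the fibres of `W` and `W'`, as a bilinear map into the fibres of
`W ⊗ W'`. -/
def tmulₗ (x : M) : W.Fib x →ₗ[ℂ] W'.Fib x →ₗ[ℂ] (W.tensor W').Fib x :=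
  TensorProduct.mk ℂ (W.Fib x) (W'.Fib x)

variable {W W'}

/-- The coefficients of a vector of `W ⊗ W'` in the tensor product of two local frames. -/
def tensorCoeff (i : W.Fr) (j : W'.Fr) (x : M) (v : (W.tensor W').Fib x) (α : W.Idx) (β : W'.Idx) :
    ℂ :=
  ((W.tensor W').frame (i, j) x).repr v (α, β)

variable (i : W.Fr) (j : W'.Fr) (x : M)

theorem tensorCoeff_add (v v' : (W.tensor W').Fib x) (α : W.Idx) (β : W'.Idx) :
    tensorCoeff i j x (v + v') α β = tensorCoeff i j x v α β + tensorCoeff i j x v' α β := by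
  rw [tensorCoeff, map_add]; rfl

theorem tensorCoeff_smul (z : ℂ) (v : (W.tensor W').Fib x) (α : W.Idx) (β : W'.Idx) :
    tensorCoeff i j x (z • v) α β = z * tensorCoeff i j x v α β := by
  rw [tensorCoeff, map_smul]; rfl

theorem tensorCoeff_sum {ι : Type*} (s : Finset ι) (v : ι → (W.tensor W').Fib x) (α : W.Idx)
    (β : W'.Idx) :
    tensorCoeff i j x (∑ a ∈ s, v a) α β = ∑ a ∈ s, tensorCoeff i j x (v a) α β := by
  rw [tensorCoeff, map_sum]; exact Finsupp.finsetSum_apply _ _ _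

theorem tensorCoeff_tmulₗ (v : W.Fib x) (v' : W'.Fib x) (α : W.Idx) (β : W'.Idx) :
    tensorCoeff i j x (W.tmulₗ W' x v v') α β
      = (W.frame i x).repr v α * (W'.frame j x).repr v' β :=
  (Basis.tensorProduct_repr_tmul_apply _ _ _ _ _ _).trans (mul_comm _ _)

theorem tensorCoeff_tmulSection (φ : W.Sections) (ψ : W'.Sections) (α : W.Idx) (β : W'.Idx) :
    tensorCoeff i j x ((W.tmulSection W' φ ψ).1 x) α β
      = (W.frame i x).repr (φ.1 x) α * (W'.frame j x).repr (ψ.1 x) β :=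
  tensorCoeff_tmulₗ i j x _ _ α β

theorem sum_tensorCoeff (v : (W.tensor W').Fib x) :
    ∑ α, ∑ β, tensorCoeff i j x v α β • W.tmulₗ W' x (W.frame i x α) (W'.frame j x β) = v := by
  refine Eq.trans ?_ (((W.tensor W').frame (i, j) x).sum_repr v)
  refine Eq.trans ?_ (Fintype.sum_prod_type _).symm
  refine Finset.sum_congr rfl fun α _ => Finset.sum_congr rfl fun β _ => ?_
  exact congrArg _ (Basis.tensorProduct_apply' _ _ (α, β)).symm

theorem contMDiffOn_tensorCoeff (σ : (W.tensor W').Sections) (α : W.Idx) (β : W'.Idx) :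
    ContMDiffOn 𝓘(ℝ, E) 𝓘(ℝ, ℂ) ∞ (fun y => tensorCoeff i j y (σ.1 y) α β)
      (W.base i ∩ W'.base j) :=
  σ.2 (i, j) (α, β)

variable {i j x}

theorem mdifferentiableAt_tensorCoeff (hx : x ∈ W.base i) (hx' : x ∈ W'.base j)
    (σ : (W.tensor W').Sections) (α : W.Idx) (β : W'.Idx) :
    MDifferentiableAt 𝓘(ℝ, E) 𝓘(ℝ, ℂ) (fun y => tensorCoeff i j y (σ.1 y) α β) x :=
  ((contMDiffOn_tensorCoeff i j σ α β).contMDiffAt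
    (((W.isOpen_base i).inter (W'.isOpen_base j)).mem_nhds ⟨hx, hx'⟩)).mdifferentiableAt (by simp)

end SmoothBundle

namespace Connection

open SmoothBundle

variable {W : SmoothBundle.{u, w} 𝓘(ℝ, E) M} {W' : SmoothBundle.{u', w'} 𝓘(ℝ, E) M} (D : Connection W) (D' : Connection W')

/-- The tensor product connection in the local frame `e ⊗ e'`. -/
def tensorLocal (i : W.Fr) (e : W.Idx → W.Sections) (j : W'.Fr) (e' : W'.Idx → W'.Sections)
    (σ : (W.tensor W').Sections) (x : M) : TangentSpace 𝓘(ℝ, E) x →ₗ[ℝ] (W.tensor W').Fib x :=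
  ∑ α, ∑ β,
    ((mvfderiv 𝓘(ℝ, E) (fun y => tensorCoeff i j y (σ.1 y) α β) x
        : TangentSpace 𝓘(ℝ, E) x →ₗ[ℝ] ℂ).smulRight
          (W.tmulₗ W' x (W.frame i x α) (W'.frame j x β))
      + tensorCoeff i j x (σ.1 x) α β •
        ((((W.tmulₗ W' x).flip ((e' β).1 x)).restrictScalars ℝ) ∘ₗ D.toFun (e α) x
          + ((W.tmulₗ W' x ((e α).1 x)).restrictScalars ℝ) ∘ₗ D'.toFun (e' β) x))

theorem tensorLocal_apply (i : W.Fr) (e : W.Idx → W.Sections) (j : W'.Fr)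
    (e' : W'.Idx → W'.Sections) (σ : (W.tensor W').Sections) (x : M)
    (X : TangentSpace 𝓘(ℝ, E) x) :
    D.tensorLocal D' i e j e' σ x X = ∑ α, ∑ β,
      (mvfderiv 𝓘(ℝ, E) (fun y => tensorCoeff i j y (σ.1 y) α β) x X
          • W.tmulₗ W' x (W.frame i x α) (W'.frame j x β)
        + tensorCoeff i j x (σ.1 x) α β •
          (W.tmulₗ W' x (D.toFun (e α) x X) ((e' β).1 x)
            + W.tmulₗ W' x ((e α).1 x) (D'.toFun (e' β) x X))) := by
  simp only [tensorLocal, LinearMap.sum_apply]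
  rfl

variable {D D'} {i : W.Fr} {e : W.Idx → W.Sections} {j : W'.Fr} {e' : W'.Idx → W'.Sections}
  {x : M}

theorem tensorLocal_isDerivationAt (hx : x ∈ W.base i) (hx' : x ∈ W'.base j)
    (X : TangentSpace 𝓘(ℝ, E) x) :
    (W.tensor W').IsDerivationAt x X fun σ => D.tensorLocal D' i e j e' σ x X := by
  constructor
  · intro σ τ
    rw [tensorLocal_apply, tensorLocal_apply, tensorLocal_apply, ← Finset.sum_add_distrib]
    refine Finset.sum_congr rfl fun α _ => ?_
    rw [← Finset.sum_add_distrib]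
    refine Finset.sum_congr rfl fun β _ => ?_
    have h1 : ∀ y, tensorCoeff i j y (((W.tensor W').addSection σ τ).1 y) α β
        = tensorCoeff i j y (σ.1 y) α β + tensorCoeff i j y (τ.1 y) α β :=
      fun y => tensorCoeff_add i j y _ _ α β
    simp only [h1]
    rw [mvfderiv_fun_add (mdifferentiableAt_tensorCoeff hx hx' σ α β)
      (mdifferentiableAt_tensorCoeff hx hx' τ α β), add_apply]
    module
  · intro f hf σ
    -- The term `df(X) • σ` is expanded in the frame, so that both sides of the Leibniz rule become
    -- double sums that agree term by term.
    have h0 := congrArg (fun v => mvfderiv 𝓘(ℝ, E) f x X • v) (sum_tensorCoeff i j x (σ.1 x))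
    beta_reduce at h0
    rw [tensorLocal_apply, tensorLocal_apply, ← h0, Finset.smul_sum, Finset.smul_sum,
      ← Finset.sum_add_distrib]
    refine Finset.sum_congr rfl fun α _ => ?_
    rw [Finset.smul_sum, Finset.smul_sum, ← Finset.sum_add_distrib]
    refine Finset.sum_congr rfl fun β _ => ?_
    have h1 : ∀ y, tensorCoeff i j y (((W.tensor W').smulSection f hf σ).1 y) α β
        = f y * tensorCoeff i j y (σ.1 y) α β :=
      fun y => tensorCoeff_smul i j y _ _ α β
    simp only [h1]
    rw [mvfderiv_complex_mul_apply (hf.mdifferentiable (by simp) x)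
      (mdifferentiableAt_tensorCoeff hx hx' σ α β)]
    module

/-- The coefficients of `φ ⊗ ψ` are products, so the product rule splits each summand into a part
that differentiates `φ` and a part that differentiates `ψ`; `eq_sum` reassembles them into the
covariant derivatives. -/
theorem tensorLocal_tmul (h : W.IsFrameNear i e x) (h' : W'.IsFrameNear j e' x)
    (X : TangentSpace 𝓘(ℝ, E) x) (φ : W.Sections) (ψ : W'.Sections) :
    D.tensorLocal D' i e j e' (W.tmulSection W' φ ψ) x X
      = W.tmulₗ W' x (D.toFun φ x X) (ψ.1 x) + W.tmulₗ W' x (φ.1 x) (D'.toFun ψ x X) := by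
  obtain ⟨hi, he⟩ := h.self_of_nhds
  obtain ⟨hj, he'⟩ := h'.self_of_nhds
  have e1 := (D.isDerivationAt x X).eq_sum h φ
  have e2 := (D'.isDerivationAt x X).eq_sum h' ψ
  beta_reduce at e1 e2
  have h1 : W.tmulₗ W' x (D.toFun φ x X) (ψ.1 x) = ∑ α, ∑ β, W.tmulₗ W' x
      (mvfderiv 𝓘(ℝ, E) (fun y => (W.frame i y).repr (φ.1 y) α) x X • W.frame i x α
        + (W.frame i x).repr (φ.1 x) α • D.toFun (e α) x X)
      ((W'.frame j x).repr (ψ.1 x) β • W'.frame j x β) := by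
    rw [e1]
    conv_lhs => enter [2]; rw [← (W'.frame j x).sum_repr (ψ.1 x)]
    simp only [map_sum, LinearMap.sum_apply]
    exact Finset.sum_comm
  have h2 : W.tmulₗ W' x (φ.1 x) (D'.toFun ψ x X) = ∑ α, ∑ β, W.tmulₗ W' x
      ((W.frame i x).repr (φ.1 x) α • W.frame i x α)
      (mvfderiv 𝓘(ℝ, E) (fun y => (W'.frame j y).repr (ψ.1 y) β) x X • W'.frame j x β
        + (W'.frame j x).repr (ψ.1 x) β • D'.toFun (e' β) x X) := by
    rw [e2]
    conv_lhs => enter [1, 2]; rw [← (W.frame i x).sum_repr (φ.1 x)]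
    simp only [map_sum, LinearMap.sum_apply]
    exact Finset.sum_comm
  rw [tensorLocal_apply, h1, h2, ← Finset.sum_add_distrib]
  refine Finset.sum_congr rfl fun α _ => ?_
  rw [← Finset.sum_add_distrib]
  refine Finset.sum_congr rfl fun β _ => ?_
  simp only [tensorCoeff_tmulSection]
  rw [mvfderiv_complex_mul_apply (coeff_mdifferentiableAt φ hi α) (coeff_mdifferentiableAt ψ hj β),
    he, he']
  simp only [map_add, map_smul, LinearMap.add_apply, LinearMap.smul_apply]
  module

/-- Both local formulas are derivations along `X` with the same values on products. This allows
`exists_isTensor` to choose frames point by point. -/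
theorem tensorLocal_eq {i₂ : W.Fr} {e₂ : W.Idx → W.Sections} {j₂ : W'.Fr}
    {e₂' : W'.Idx → W'.Sections} (h : W.IsFrameNear i e x) (h' : W'.IsFrameNear j e' x)
    (h₂ : W.IsFrameNear i₂ e₂ x) (h₂' : W'.IsFrameNear j₂ e₂' x) (X : TangentSpace 𝓘(ℝ, E) x)
    (σ : (W.tensor W').Sections) :
    D.tensorLocal D' i e j e' σ x X = D.tensorLocal D' i₂ e₂ j₂ e₂' σ x X :=
  (tensorLocal_isDerivationAt h.self_of_nhds.1 h'.self_of_nhds.1 X).eq_of_tmul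
    (tensorLocal_isDerivationAt h₂.self_of_nhds.1 h₂'.self_of_nhds.1 X)
    (fun φ ψ => (tensorLocal_tmul h h' X φ ψ).trans (tensorLocal_tmul h₂ h₂' X φ ψ).symm) σ

theorem contMDiffOn_tensorLocal (σ : (W.tensor W').Sections) (X : VField 𝓘(ℝ, E) M) (γ : W.Idx)
    (δ : W'.Idx) :
    ContMDiffOn 𝓘(ℝ, E) 𝓘(ℝ, ℂ) ∞
      (fun y => tensorCoeff i j y (D.tensorLocal D' i e j e' σ y (X.1 y)) γ δ)
      (W.base i ∩ W'.base j) := by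
  classical
  have hU := (W.isOpen_base i).inter (W'.isOpen_base j)
  have m1 : ∀ τ : W.Sections, ∀ α, ContMDiffOn 𝓘(ℝ, E) 𝓘(ℝ, ℂ) ∞
      (fun y => (W.frame i y).repr (τ.1 y) α) (W.base i ∩ W'.base j) :=
    fun τ α => (τ.2 i α).mono Set.inter_subset_left
  have m2 : ∀ τ : W'.Sections, ∀ α, ContMDiffOn 𝓘(ℝ, E) 𝓘(ℝ, ℂ) ∞
      (fun y => (W'.frame j y).repr (τ.1 y) α) (W.base i ∩ W'.base j) :=
    fun τ α => (τ.2 j α).mono Set.inter_subset_right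
  have m3 := fun α β => contMDiffOn_tensorCoeff i j σ α β
  have m4 := fun α β => contMDiffOn_mvfderiv_apply hU (m3 α β) X.2.contMDiffOn
  -- The Kronecker deltas are the coefficients of the frame vectors in their own frame.
  have key : ContMDiffOn 𝓘(ℝ, E) 𝓘(ℝ, ℂ) ∞ (fun y => ∑ α, ∑ β,
      (mvfderiv 𝓘(ℝ, E) (fun y => tensorCoeff i j y (σ.1 y) α β) y (X.1 y)
          * ((if α = γ then 1 else 0) * (if β = δ then 1 else 0))
        + tensorCoeff i j y (σ.1 y) α β *
          ((W.frame i y).repr ((D.cov X (e α)).1 y) γ * (W'.frame j y).repr ((e' β).1 y) δ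
            + (W.frame i y).repr ((e α).1 y) γ * (W'.frame j y).repr ((D'.cov X (e' β)).1 y) δ)))
      (W.base i ∩ W'.base j) := by
    refine contMDiffOn_finsetSum fun α _ => contMDiffOn_finsetSum fun β _ => ?_
    refine (contMDiffOn_mul_complex (m4 α β) contMDiffOn_const).add
      (contMDiffOn_mul_complex (m3 α β) ?_)
    exact (contMDiffOn_mul_complex (m1 _ _) (m2 _ _)).add
      (contMDiffOn_mul_complex (m1 _ _) (m2 _ _))
  refine key.congr fun y hy => ?_
  rw [tensorLocal_apply, tensorCoeff_sum]
  refine Finset.sum_congr rfl fun α _ => ?_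
  rw [tensorCoeff_sum]
  refine Finset.sum_congr rfl fun β _ => ?_
  rw [tensorCoeff_add, tensorCoeff_smul, tensorCoeff_smul, tensorCoeff_add, tensorCoeff_tmulₗ,
    tensorCoeff_tmulₗ, tensorCoeff_tmulₗ, Basis.repr_self, Basis.repr_self, Finsupp.single_apply,
    Finsupp.single_apply]
  rfl

/-- Two connections have a tensor product connection. -/
theorem exists_isTensor (D : Connection W) (D' : Connection W') :
    ∃ Dt : Connection (W.tensor W'), D.IsTensor D' Dt := by
  choose i hi using W.exists_mem_base
  choose e he using fun x => exists_isFrameNear (hi x)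
  choose j hj using W'.exists_mem_base
  choose e' he' using fun x => exists_isFrameNear (hj x)
  refine ⟨⟨fun σ x => D.tensorLocal D' (i x) (e x) (j x) (e' x) σ x,
    fun φ ψ x X => (tensorLocal_isDerivationAt (hi x) (hj x) X).add φ ψ,
    fun f hf φ x X => (tensorLocal_isDerivationAt (hi x) (hj x) X).leibniz f hf φ,
    fun σ X => isSmoothSection_of_frames fun x => ⟨(i x, j x), ⟨hi x, hj x⟩, fun α => ?_⟩⟩,
    fun φ ψ x X => tensorLocal_tmul (he x) (he' x) X φ ψ⟩
  have h := (contMDiffOn_tensorLocal (D := D) (D' := D') (i := i x) (e := e x) (j := j x)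
    (e' := e' x) σ X α.1 α.2).contMDiffAt
    (((W.isOpen_base _).inter (W'.isOpen_base _)).mem_nhds ⟨hi x, hj x⟩)
  -- At `y` the connection is defined by the frames chosen for `y`, while smoothness near `x` is
  -- known for the frames chosen for `x`; the latter are still frames near `y`, so both formulas
  -- agree there.
  refine h.congr_of_eventuallyEq ?_
  filter_upwards [(he x).eventually, (he' x).eventually] with y hy hy'
  exact congrArg (fun v => tensorCoeff (i x) (j x) y v α.1 α.2)
    (tensorLocal_eq (he y) (he' y) hy hy' (X.1 y) σ)

end Connection

end TensorConnection

/-! ### Decomposition of 2-forms by the nonlinear connection -/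

section DForms

universe u w

variable {E : Type*} [NormedAddCommGroup E] [NormedSpace ℝ E] {H : Type*} [TopologicalSpace H]
  {I : ModelWithCorners ℝ E H} {M : Type*} [TopologicalSpace M] [ChartedSpace H M]
  [IsManifold I 1 M] {n : ℕ}

theorem AlternatingMap.ext_pair {A F : Type*} [AddCommGroup A] [Module ℝ A] [AddCommGroup F]
    [Module ℝ F] {f g : A [⋀^Fin 2]→ₗ[ℝ] F} (h : ∀ a b, f ![a, b] = g ![a, b]) : f = g := by
  ext v
  have : v = ![v 0, v 1] := by ext i; fin_cases i <;> rfl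
  rw [this, h]

theorem AlternatingMap.compLinearMap_pair {A F : Type*} [AddCommGroup A] [Module ℝ A]
    [AddCommGroup F] [Module ℝ F] (f : A [⋀^Fin 2]→ₗ[ℝ] F) (L : A →ₗ[ℝ] A) (a b : A) :
    f.compLinearMap L ![a, b] = f ![L a, L b] := by
  rw [AlternatingMap.compLinearMap_apply]
  congr 1
  ext i
  fin_cases i <;> rfl

theorem AlternatingMap.pair_add_left {A F : Type*} [AddCommGroup A] [Module ℝ A]
    [AddCommGroup F] [Module ℝ F] (f : A [⋀^Fin 2]→ₗ[ℝ] F) (a a' b : A) :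
    f ![a + a', b] = f ![a, b] + f ![a', b] := by
  simpa using! f.map_vecCons_add ![b] a a'

theorem AlternatingMap.pair_swap {A F : Type*} [AddCommGroup A] [Module ℝ A]
    [AddCommGroup F] [Module ℝ F] (f : A [⋀^Fin 2]→ₗ[ℝ] F) (a b : A) :
    f ![a, b] = - f ![b, a] := by
  have := f.map_swap ![b, a] (i := 0) (j := 1) (by decide)
  rw [← this]
  congr 1
  ext i
  fin_cases i <;> rfl

theorem AlternatingMap.pair_add_right {A F : Type*} [AddCommGroup A] [Module ℝ A]
    [AddCommGroup F] [Module ℝ F] (f : A [⋀^Fin 2]→ₗ[ℝ] F) (a b b' : A) :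
    f ![a, b + b'] = f ![a, b] + f ![a, b'] := by
  rw [f.pair_swap, f.pair_add_left, f.pair_swap a b, f.pair_swap a b', neg_add]

theorem AlternatingMap.pair_zero_left {A F : Type*} [AddCommGroup A] [Module ℝ A]
    [AddCommGroup F] [Module ℝ F] (f : A [⋀^Fin 2]→ₗ[ℝ] F) (b : A) : f ![0, b] = 0 :=
  f.map_coord_zero 0 rfl

theorem AlternatingMap.pair_zero_right {A F : Type*} [AddCommGroup A] [Module ℝ A]
    [AddCommGroup F] [Module ℝ F] (f : A [⋀^Fin 2]→ₗ[ℝ] F) (b : A) : f ![b, 0] = 0 :=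
  f.map_coord_zero 1 rfl

theorem SmoothBundle.IsSmoothSection.add {W : SmoothBundle.{u, w} I M} {σ τ : ∀ x, W.Fib x}
    (hσ : W.IsSmoothSection σ) (hτ : W.IsSmoothSection τ) :
    W.IsSmoothSection fun x => σ x + τ x :=
  (W.addSection ⟨σ, hσ⟩ ⟨τ, hτ⟩).2

namespace NConnection

variable (𝒩 : NConnection n I M)

/-- The projection to the horizontal subspace. -/
def hₗ (x : M) : TangentSpace I x →ₗ[ℝ] TangentSpace I x := LinearMap.id - (𝒩.N x).toLinearMap

/-- The projection to the vertical subspace. -/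
def vₗ (x : M) : TangentSpace I x →ₗ[ℝ] TangentSpace I x := (𝒩.N x).toLinearMap

variable (x : M) (X : TangentSpace I x)

theorem h_add_v : 𝒩.h x X + 𝒩.v x X = X := sub_add_cancel _ _

theorem v_v : 𝒩.v x (𝒩.v x X) = 𝒩.v x X := 𝒩.N_of_mem x _ (𝒩.N_mem x X)

theorem v_h : 𝒩.v x (𝒩.h x X) = 0 := by
  rw [h, v, map_sub, 𝒩.N_of_mem x _ (𝒩.N_mem x X), sub_self]

theorem h_h : 𝒩.h x (𝒩.h x X) = 𝒩.h x X := by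
  have := 𝒩.v_h x X
  rw [v] at this
  rw [h, this, sub_zero]

theorem h_v : 𝒩.h x (𝒩.v x X) = 0 := by
  have := 𝒩.v_v x X
  rw [h]
  rw [v, v] at *
  rw [this, sub_self]

/-- The vertical part of a vector field. -/
def vField (X : VField I M) : VField I M := ⟨fun x => 𝒩.v x (X.1 x), 𝒩.smooth.comp X.2⟩

/-- The horizontal part of a vector field. -/
def hField (X : VField I M) : VField I M :=
  ⟨fun x => 𝒩.h x (X.1 x), ContMDiff.sub_section X.2 (𝒩.vField X).2⟩

end NConnection

namespace DTwoForm

variable {𝒩 : NConnection n I M} {W : SmoothBundle.{u, w} I M}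

/-- The sum of the components of a distinguished `2`-form. -/
def total (R : DTwoForm 𝒩 W) : TwoForm W where
  toFun x := R.hh.toFun x + R.hv.toFun x + R.vv.toFun x
  smooth X Y := ((R.hh.smooth X Y).add (R.hv.smooth X Y)).add (R.vv.smooth X Y)

/-- The `hv` and `vv` components each need a vertical argument, and the vertical part of a
horizontal vector is zero. Together with the analogous formulas for `vv` and `hv`, this recovers
every component from the total value. -/
theorem hh_eq_val (R : DTwoForm 𝒩 W) (x : M) (X Y : TangentSpace I x) :
    R.hh.toFun x ![X, Y] = R.val x (𝒩.h x X) (𝒩.h x Y) := by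
  rw [val, R.hv_type, R.vv_type, 𝒩.v_h, 𝒩.v_h, AlternatingMap.pair_zero_left,
    AlternatingMap.pair_zero_right, AlternatingMap.pair_zero_left, ← R.hh_type]
  simp

theorem vv_eq_val (R : DTwoForm 𝒩 W) (x : M) (X Y : TangentSpace I x) :
    R.vv.toFun x ![X, Y] = R.val x (𝒩.v x X) (𝒩.v x Y) := by
  rw [val, R.hv_type, R.hh_type, 𝒩.h_v, 𝒩.h_v, AlternatingMap.pair_zero_left,
    AlternatingMap.pair_zero_right, AlternatingMap.pair_zero_left, ← R.vv_type]
  simp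

theorem hv_eq_val (R : DTwoForm 𝒩 W) (x : M) (X Y : TangentSpace I x) :
    R.hv.toFun x ![X, Y] = R.val x X Y - R.val x (𝒩.h x X) (𝒩.h x Y)
      - R.val x (𝒩.v x X) (𝒩.v x Y) := by
  rw [← hh_eq_val, ← vv_eq_val, val]
  abel

theorem _root_.TwoForm.ext_apply {R R' : TwoForm W}
    (h : ∀ x X Y, R.toFun x ![X, Y] = R'.toFun x ![X, Y]) : R = R' := by
  cases R; cases R'
  congr
  exact funext fun x => AlternatingMap.ext_pair (h x)

/-- A distinguished `2`-form is determined by its values. -/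
theorem ext_val {R R' : DTwoForm 𝒩 W} (h : ∀ x X Y, R.val x X Y = R'.val x X Y) : R = R' := by
  have h1 : R.hh = R'.hh := TwoForm.ext_apply fun x X Y => by rw [hh_eq_val, h, hh_eq_val]
  have h2 : R.vv = R'.vv := TwoForm.ext_apply fun x X Y => by rw [vv_eq_val, h, vv_eq_val]
  have h3 : R.hv = R'.hv := TwoForm.ext_apply fun x X Y => by
    rw [hv_eq_val, h, h, h, hv_eq_val]
  cases R; cases R'
  congr

variable (𝒩)

/-- The decomposition of a `2`-form into its `hh`-, `hv`- and `vv`-components. -/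
def ofTwoForm (R : TwoForm W) : DTwoForm 𝒩 W :=
  have hh : ∀ x X Y, (R.toFun x).compLinearMap (𝒩.hₗ x) ![X, Y]
      = R.toFun x ![𝒩.h x X, 𝒩.h x Y] := fun x X Y => AlternatingMap.compLinearMap_pair _ _ X Y
  have vv : ∀ x X Y, (R.toFun x).compLinearMap (𝒩.vₗ x) ![X, Y]
      = R.toFun x ![𝒩.v x X, 𝒩.v x Y] := fun x X Y => AlternatingMap.compLinearMap_pair _ _ X Y
  -- The `hv` component is defined as what remains after removing the purely horizontal and purely
  -- vertical parts; bilinearity identifies it with the two mixed terms.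
  have hv : ∀ x X Y, (R.toFun x - (R.toFun x).compLinearMap (𝒩.hₗ x)
      - (R.toFun x).compLinearMap (𝒩.vₗ x)) ![X, Y]
      = R.toFun x ![𝒩.h x X, 𝒩.v x Y] + R.toFun x ![𝒩.v x X, 𝒩.h x Y] := fun x X Y => by
    rw [AlternatingMap.sub_apply, AlternatingMap.sub_apply, hh, vv]
    nth_rewrite 1 [← 𝒩.h_add_v x X, ← 𝒩.h_add_v x Y]
    rw [AlternatingMap.pair_add_left, AlternatingMap.pair_add_right,
      AlternatingMap.pair_add_right]
    abel
  { hh := ⟨fun x => (R.toFun x).compLinearMap (𝒩.hₗ x), fun X Y => by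
      simp only [hh]; exact R.smooth (𝒩.hField X) (𝒩.hField Y)⟩
    vv := ⟨fun x => (R.toFun x).compLinearMap (𝒩.vₗ x), fun X Y => by
      simp only [vv]; exact R.smooth (𝒩.vField X) (𝒩.vField Y)⟩
    hv := ⟨fun x => R.toFun x - (R.toFun x).compLinearMap (𝒩.hₗ x)
        - (R.toFun x).compLinearMap (𝒩.vₗ x), fun X Y => by
      simp only [hv]
      exact (R.smooth (𝒩.hField X) (𝒩.vField Y)).add (R.smooth (𝒩.vField X) (𝒩.hField Y))⟩
    hh_type := fun x X Y => by rw [hh, hh, 𝒩.h_h, 𝒩.h_h]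
    vv_type := fun x X Y => by rw [vv, vv, 𝒩.v_v, 𝒩.v_v]
    hv_type := fun x X Y => by
      rw [hv, hv, hv, 𝒩.h_h, 𝒩.v_v, 𝒩.v_h, 𝒩.h_v, 𝒩.h_h, 𝒩.v_v, 𝒩.v_h, 𝒩.h_v,
        AlternatingMap.pair_zero_left, add_zero, zero_add] }

theorem ofTwoForm_val (R : TwoForm W) (x : M) (X Y : TangentSpace I x) :
    (ofTwoForm 𝒩 R).val x X Y = R.toFun x ![X, Y] := by
  change ((R.toFun x).compLinearMap (𝒩.hₗ x) + (R.toFun x - (R.toFun x).compLinearMap (𝒩.hₗ x)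
        - (R.toFun x).compLinearMap (𝒩.vₗ x)) + (R.toFun x).compLinearMap (𝒩.vₗ x)) ![X, Y] = _
  congr 1
  abel

end DTwoForm

end DForms

/-! ### Smoothness of fibrewise isomorphisms -/

section BundleIso

universe u w u' w'

variable {E : Type*} [NormedAddCommGroup E] [NormedSpace ℝ E] {H : Type*} [TopologicalSpace H]
  {I : ModelWithCorners ℝ E H} {M : Type*} [TopologicalSpace M] [ChartedSpace H M]

namespace SmoothBundle

variable {W : SmoothBundle.{u, w} I M} {W' : SmoothBundle.{u', w'} I M}

/-- Smoothness of a fibrewise linear map may be tested near each point in one pair of local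
frames. -/
theorem contMDiffOn_coeff_of_frames {κ : ∀ x, W.Fib x →ₗ[ℂ] W'.Fib x}
    (h : ∀ x, ∃ i j, x ∈ W.base i ∧ x ∈ W'.base j ∧ ∀ α β, ContMDiffAt I 𝓘(ℝ, ℂ) ∞
      (fun y => (W'.frame j y).repr (κ y (W.frame i y α)) β) x) (i : W.Fr) (j : W'.Fr)
    (α : W.Idx) (β : W'.Idx) :
    ContMDiffOn I 𝓘(ℝ, ℂ) ∞ (fun x => (W'.frame j x).repr (κ x (W.frame i x α)) β)
      (W.base i ∩ W'.base j) := by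
  rintro x ⟨hi, hj⟩
  obtain ⟨i', j', hi', hj', hs⟩ := h x
  have key : ContMDiffAt I 𝓘(ℝ, ℂ) ∞ (fun y => ∑ γ, ∑ δ,
      (W.frame i' y).repr (W.frame i y α) γ * ((W'.frame j' y).repr (κ y (W.frame i' y γ)) δ
        * (W'.frame j y).repr (W'.frame j' y δ) β)) x :=
    contMDiffAt_finsetSum fun γ _ => contMDiffAt_finsetSum fun δ _ => contMDiffAt_mul_complex
      ((W.smooth_change i i' α γ).contMDiffAt
        (((W.isOpen_base i).inter (W.isOpen_base i')).mem_nhds ⟨hi, hi'⟩))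
      (contMDiffAt_mul_complex (hs γ δ) ((W'.smooth_change j' j δ β).contMDiffAt
        (((W'.isOpen_base j').inter (W'.isOpen_base j)).mem_nhds ⟨hj', hj⟩)))
  refine (key.congr_of_eventuallyEq (Filter.Eventually.of_forall fun y => ?_)).contMDiffWithinAt
  conv_lhs => rw [← (W.frame i' y).sum_repr (W.frame i y α)]
  simp only [map_sum, map_smul, Finsupp.finsetSum_apply, Finsupp.smul_apply, smul_eq_mul]
  refine Finset.sum_congr rfl fun γ _ => ?_
  rw [repr_change j' j, Finset.mul_sum]

theorem isBundleIso_of_frames {κ : ∀ x, W.Fib x ≃ₗ[ℂ] W'.Fib x}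
    (h : ∀ x, ∃ i j, x ∈ W.base i ∧ x ∈ W'.base j ∧ ∀ α β,
      ContMDiffAt I 𝓘(ℝ, ℂ) ∞ (fun y => (W'.frame j y).repr (κ y (W.frame i y α)) β) x ∧
      ContMDiffAt I 𝓘(ℝ, ℂ) ∞ (fun y => (W.frame i y).repr ((κ y).symm (W'.frame j y β)) α) x) :
    IsBundleIso W W' κ := by
  refine ⟨fun i j α β => contMDiffOn_coeff_of_frames (κ := fun x => (κ x).toLinearMap)
    (fun x => ?_) i j α β, fun i j α β => ?_⟩
  · obtain ⟨i, j, hi, hj, hs⟩ := h x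
    exact ⟨i, j, hi, hj, fun α β => (hs α β).1⟩
  · rw [Set.inter_comm]
    refine contMDiffOn_coeff_of_frames (κ := fun x => (κ x).symm.toLinearMap) (fun x => ?_) j i α β
    obtain ⟨i, j, hi, hj, hs⟩ := h x
    exact ⟨j, i, hj, hi, fun α β => (hs β α).2⟩

/-- When frames correspond up to a reindexing, the matrix coefficients in both directions are
constants. -/
theorem isBundleIso_of_frame_eq {κ : ∀ x, W.Fib x ≃ₗ[ℂ] W'.Fib x}
    (h : ∀ x, ∃ i j, ∃ ε : W.Idx ≃ W'.Idx, x ∈ W.base i ∧ x ∈ W'.base j ∧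
      ∀ y α, κ y (W.frame i y α) = W'.frame j y (ε α)) :
    IsBundleIso W W' κ := by
  refine isBundleIso_of_frames fun x => ?_
  obtain ⟨i, j, ε, hi, hj, hε⟩ := h x
  refine ⟨i, j, hi, hj, fun α β => ⟨?_, ?_⟩⟩
  · simp only [hε, Basis.repr_self]
    exact contMDiffAt_const
  · have : ∀ y, (κ y).symm (W'.frame j y β) = W.frame i y (ε.symm β) := fun y => by
      rw [LinearEquiv.symm_apply_eq, hε, Equiv.apply_symm_apply]
    simp only [this, Basis.repr_self]
    exact contMDiffAt_const

theorem IsBundleIso.isSmoothSection {κ : ∀ x, W.Fib x ≃ₗ[ℂ] W'.Fib x} (h : IsBundleIso W W' κ)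
    {σ : ∀ x, W.Fib x} (hσ : W.IsSmoothSection σ) : W'.IsSmoothSection fun x => κ x (σ x) := by
  refine isSmoothSection_of_frames fun x => ?_
  obtain ⟨i, hi⟩ := W.exists_mem_base x
  obtain ⟨j, hj⟩ := W'.exists_mem_base x
  refine ⟨j, hj, fun β => ?_⟩
  have key : ContMDiffAt I 𝓘(ℝ, ℂ) ∞ (fun y => ∑ α, (W.frame i y).repr (σ y) α
      * (W'.frame j y).repr (κ y (W.frame i y α)) β) x :=
    contMDiffAt_finsetSum fun α _ => contMDiffAt_mul_complex (hσ.contMDiffAt hi α)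
      ((h.1 i j α β).contMDiffAt
        (((W.isOpen_base i).inter (W'.isOpen_base j)).mem_nhds ⟨hi, hj⟩))
  refine key.congr_of_eventuallyEq (Filter.Eventually.of_forall fun y => ?_)
  change (W'.frame j y).repr (κ y (σ y)) β = _
  conv_lhs => rw [← (W.frame i y).sum_repr (σ y)]
  simp only [map_sum, map_smul, Finsupp.finsetSum_apply, Finsupp.smul_apply, smul_eq_mul]

end SmoothBundle

end BundleIso

/-! ### The endomorphism bundle of a tensor product -/

section Orbit

universe u w u' w'

variable {EK HK EG HG EB HB EV HV : Type*}
  [NormedAddCommGroup EK] [NormedSpace ℝ EK] [TopologicalSpace HK]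
  [NormedAddCommGroup EG] [NormedSpace ℝ EG] [TopologicalSpace HG]
  [NormedAddCommGroup EB] [NormedSpace ℝ EB] [TopologicalSpace HB]
  [NormedAddCommGroup EV] [NormedSpace ℝ EV] [TopologicalSpace HV]
  {IK : ModelWithCorners ℝ EK HK} {IG : ModelWithCorners ℝ EG HG}
  {IB : ModelWithCorners ℝ EB HB} {IV : ModelWithCorners ℝ EV HV}
  {K G B V : Type*} [Group K] [TopologicalSpace K] [ChartedSpace HK K]
  [Group G] [TopologicalSpace G] [ChartedSpace HG G]
  [TopologicalSpace B] [ChartedSpace HB B] [TopologicalSpace V] [ChartedSpace HV V]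
  {P : PrincipalBundle IG IB IV G B V} {c : LieCover IK IG K G}

namespace EqBundle

variable (W : EqBundle.{u, w} P c) (W' : EqBundle.{u', w'} P c)

theorem rep_orbitMk {b : B} {x : V} (hb : P.proj b = x) (T : End ℂ (W.Fib b)) :
    W.rep hb (W.orbitMk hb T) = T :=
  (W.repEquiv hb).apply_symm_apply T

/-- Conjugation fixes the identity, so the base point chosen in the definition of `oneSection` is
irrelevant. -/
theorem rep_orbitMk_one {b b' : B} {x : V} (hb : P.proj b = x) (hb' : P.proj b' = x) :
    W.rep hb' (W.orbitMk hb 1) = 1 := by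
  obtain ⟨k, hk⟩ := P.exists_lact_eq c (hb.trans hb'.symm)
  rw [W.rep_eq hb hb' k hk, rep_orbitMk]
  ext w
  simp [LinearEquiv.conj_apply_apply]

/-- Finiteness and freeness of the fibres are what make `End ⊗ End → End(⊗)` an isomorphism. -/
instance finite_fib (b : B) : Module.Finite ℂ (W.Fib b) := by
  obtain ⟨i, -⟩ := W.exists_mem_base b
  exact Module.Finite.of_basis (W.frame i b)

instance free_fib (b : B) : Module.Free ℂ (W.Fib b) := by
  obtain ⟨i, -⟩ := W.exists_mem_base b
  exact Module.Free.of_basis (W.frame i b)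

/-- The identification of `End(W_b) ⊗ End(W'_b)` with `End(W_b ⊗ W'_b)`. -/
def endTensorEquiv (b : B) : (End ℂ (W.Fib b) ⊗[ℂ] End ℂ (W'.Fib b)) ≃ₗ[ℂ]
    End ℂ ((W.tensor W').Fib b) :=
  homTensorHomEquiv ℂ (W.Fib b) (W'.Fib b) (W.Fib b) (W'.Fib b)

theorem endTensorEquiv_tmul (b : B) (S : End ℂ (W.Fib b)) (T : End ℂ (W'.Fib b)) :
    W.endTensorEquiv W' b (S ⊗ₜ[ℂ] T) = TensorProduct.map S T :=
  (homTensorHomEquiv_apply (R := ℂ) (S ⊗ₜ[ℂ] T)).trans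
    (TensorProduct.homTensorHomMap_apply S T)

/-- The identification of the fibres of `End(W)/G ⊗ End(W')/G` and of `End(W ⊗ W')/G`. -/
def orbitTensorEquiv (x : V) : (W.OrbitFib x ⊗[ℂ] W'.OrbitFib x) ≃ₗ[ℂ] (W.tensor W').OrbitFib x :=
  (TensorProduct.congr (W.rep (P.exists_proj_eq x).choose_spec)
    (W'.rep (P.exists_proj_eq x).choose_spec)) ≪≫ₗ W.endTensorEquiv W' _ ≪≫ₗ
    ((W.tensor W').rep (P.exists_proj_eq x).choose_spec).symm

/-- `orbitTensorEquiv` is defined through one chosen point over `x`. Conjugation by the diagonal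
lift `L ⊗ L'` sends `S ⊗ T` to the tensor product of the separate conjugates, so the description
carries over to every point `b` over `x`. -/
theorem rep_orbitTensorEquiv {b : B} {x : V} (hb : P.proj b = x) (S : W.OrbitFib x)
    (T : W'.OrbitFib x) : (W.tensor W').rep hb (W.orbitTensorEquiv W' x (S ⊗ₜ[ℂ] T))
      = TensorProduct.map (W.rep hb S) (W'.rep hb T) := by
  have hb₀ := (P.exists_proj_eq x).choose_spec
  have h0 : (W.tensor W').rep hb₀ (W.orbitTensorEquiv W' x (S ⊗ₜ[ℂ] T))
      = TensorProduct.map (W.rep hb₀ S) (W'.rep hb₀ T) := by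
    rw [orbitTensorEquiv, LinearEquiv.trans_apply, LinearEquiv.trans_apply,
      LinearEquiv.apply_symm_apply, TensorProduct.congr_tmul, endTensorEquiv_tmul]
  obtain ⟨k, hk⟩ := P.exists_lact_eq c (hb₀.trans hb.symm)
  rw [(W.tensor W').rep_eq hb₀ hb k hk, h0, W.rep_eq hb₀ hb k hk, W'.rep_eq hb₀ hb k hk]
  refine TensorProduct.ext' fun v v' => ?_
  refine (LinearEquiv.conj_apply_apply _ _ _).trans ?_
  change TensorProduct.congr (W.lift k _ b hk) (W'.lift k _ b hk)
    (TensorProduct.map (W.rep hb₀ S) (W'.rep hb₀ T)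
      ((TensorProduct.congr (W.lift k _ b hk) (W'.lift k _ b hk)).symm (v ⊗ₜ[ℂ] v'))) = _
  rw [TensorProduct.congr_symm_tmul, TensorProduct.map_tmul, TensorProduct.congr_tmul]
  exact (TensorProduct.map_tmul _ _ _ _).symm

theorem rep_orbitFrame (S : P.LocalSection) (i : W.Fr) (x : V) (α : W.Idx × W.Idx)
    (w : W.Fib (S.s x)) : W.rep (S.proj_s x) (W.orbitFrame S i x α) w
      = (W.frame i (S.s x)).repr w α.2 • W.frame i (S.s x) α.1 := by
  rw [orbitFrame, Basis.map_apply, LinearEquiv.apply_symm_apply, linearMap_basis_apply]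

/-- The tensor product of two elementary endomorphisms is elementary for the product frame: the two
row indices form its row, the two column indices its column. -/
theorem orbitTensorEquiv_orbitFrame (S : P.LocalSection) (i : W.Fr) (j : W'.Fr) (x : V)
    (α : W.Idx × W.Idx) (β : W'.Idx × W'.Idx) :
    W.orbitTensorEquiv W' x (W.orbitFrame S i x α ⊗ₜ[ℂ] W'.orbitFrame S j x β)
      = (W.tensor W').orbitFrame S (i, j) x ((α.1, β.1), (α.2, β.2)) := by
  refine ((W.tensor W').rep (S.proj_s x)).injective ?_
  rw [rep_orbitTensorEquiv]
  refine TensorProduct.ext' fun v v' => ?_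
  rw [TensorProduct.map_tmul, rep_orbitFrame, rep_orbitFrame]
  refine Eq.trans ?_ ((W.tensor W').rep_orbitFrame S (i, j) x ((α.1, β.1), (α.2, β.2))
    (v ⊗ₜ[ℂ] v')).symm
  have e1 : ((W.tensor W').frame (i, j) (S.s x)).repr (v ⊗ₜ[ℂ] v') (α.2, β.2)
      = (W'.frame j (S.s x)).repr v' β.2 * (W.frame i (S.s x)).repr v α.2 :=
    Basis.tensorProduct_repr_tmul_apply _ _ _ _ _ _
  have e2 : (W.tensor W').frame (i, j) (S.s x) (α.1, β.1)
      = (W.frame i (S.s x) α.1 ⊗ₜ[ℂ] W'.frame j (S.s x) β.1 :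
        W.Fib (S.s x) ⊗[ℂ] W'.Fib (S.s x)) := Basis.tensorProduct_apply' _ _ _
  change _ = ((W.tensor W').frame (i, j) (S.s x)).repr (v ⊗ₜ[ℂ] v') (α.2, β.2)
    • (W.tensor W').frame (i, j) (S.s x) (α.1, β.1)
  rw [e1, e2]
  change (_ : W.Fib (S.s x) ⊗[ℂ] W'.Fib (S.s x)) = _
  rw [TensorProduct.smul_tmul_smul, mul_comm]
  rfl

variable [LieGroup IK ∞ K] [LieGroup IG ∞ G]

theorem isCanonicalIso_orbitTensorEquiv :
    IsCanonicalIso W W' fun x => W.orbitTensorEquiv W' x := by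
  constructor
  · refine SmoothBundle.isBundleIso_of_frame_eq fun x => ?_
    obtain ⟨S, hS⟩ := P.exists_localSection x
    obtain ⟨i, hi⟩ := W.exists_mem_base (S.s x)
    obtain ⟨j, hj⟩ := W'.exists_mem_base (S.s x)
    -- One local section `S` serves both factors and the product. The reindexing turns (row, column)
    -- of each factor into (rows, columns).
    refine ⟨((S, i), (S, j)), (S, (i, j)), Equiv.prodProdProdComm _ _ _ _, ⟨⟨hS, hi⟩, hS, hj⟩,
      ⟨hS, hi, hj⟩, fun y α => ?_⟩
    have key : ∀ (α : (W.Idx × W.Idx) × (W'.Idx × W'.Idx)) y, W.orbitTensorEquiv W' y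
        ((W.orbitBundle.tensor W'.orbitBundle).frame ((S, i), (S, j)) y α)
        = (W.tensor W').orbitBundle.frame (S, (i, j)) y
          ((α.1.1, α.2.1), (α.1.2, α.2.2)) := fun α y => by
      refine Eq.trans (congrArg _ ?_) (W.orbitTensorEquiv_orbitFrame W' S i j y α.1 α.2)
      exact Basis.tensorProduct_apply' _ _ _
    exact key α y
  · intro b S T
    refine ((W.tensor W').rep rfl).injective ?_
    refine (W.rep_orbitTensorEquiv W' rfl _ _).trans ?_
    rw [rep_orbitMk, rep_orbitMk]
    exact ((W.tensor W').rep_orbitMk rfl _).symm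

/-- In every local frame the coefficients form the identity matrix, which is constant. -/
theorem isSmoothSection_oneSection : W.orbitBundle.IsSmoothSection W.oneSection := by
  rintro ⟨S, i⟩ α
  refine (contMDiffOn_const (c := Finsupp.single α.2 (1 : ℂ) α.1)).congr fun x _ => ?_
  refine (W.orbitFrame_repr S i x _ α).trans ?_
  rw [oneSection, W.rep_orbitMk_one]
  simp

end EqBundle

end Orbit

/-! ### Wedge products of complex linear forms -/

section Wedge

/-- The wedge product of two complex valued linear forms, as a `2`-form. -/
def wedgePair {A : Type*} [AddCommGroup A] [Module ℝ A] (f g : A →ₗ[ℝ] ℂ) :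
    A [⋀^Fin 2]→ₗ[ℝ] ℂ where
  toFun v := f (v 0) * g (v 1) - f (v 1) * g (v 0)
  map_update_add' v i a b := by
    fin_cases i <;> simp <;> ring
  map_update_smul' v i r a := by
    fin_cases i <;> simp <;> ring
  map_eq_zero_of_eq' v i j h hij := by
    have : v 0 = v 1 := by
      fin_cases i <;> fin_cases j <;> simp_all
    simp [this]

end Wedge

/-! ### The curvature matrix `dθ + θ ∧ θ` in local coefficients -/

section LocalCurvature

universe u w

variable {E : Type*} [NormedAddCommGroup E] [NormedSpace ℝ E] [FiniteDimensional ℝ E]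
  {M : Type*} [TopologicalSpace M] [ChartedSpace E M] [T2Space M] [IsManifold 𝓘(ℝ, E) ∞ M]

/-- If `θ = ∑ μ, A μ • d(y μ)`, then `X (θ Y) - Y (θ X) - θ [X, Y]` is the value on `(X, Y)` of the
`2`-form `∑ μ, d(A μ) ∧ d(y μ)`. -/
theorem mvfderiv_sum_mul_mvfderiv {ι : Type*} [Fintype ι] {A y : ι → M → ℂ} {N : Set M}
    (hN : IsOpen N) (hA : ∀ μ, ContMDiffOn 𝓘(ℝ, E) 𝓘(ℝ, ℂ) ∞ (A μ) N)
    (hy : ∀ μ, ContMDiffOn 𝓘(ℝ, E) 𝓘(ℝ, ℂ) ∞ (y μ) N) (X Y : VField 𝓘(ℝ, E) M) {b : M}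
    (hb : b ∈ N) :
    mvfderiv 𝓘(ℝ, E) (fun z => ∑ μ, A μ z * mvfderiv 𝓘(ℝ, E) (y μ) z (Y.1 z)) b (X.1 b)
      - mvfderiv 𝓘(ℝ, E) (fun z => ∑ μ, A μ z * mvfderiv 𝓘(ℝ, E) (y μ) z (X.1 z)) b (Y.1 b)
      - ∑ μ, A μ b * mvfderiv 𝓘(ℝ, E) (y μ) b (VectorField.mlieBracket 𝓘(ℝ, E) X.1 Y.1 b)
      = ∑ μ, (mvfderiv 𝓘(ℝ, E) (A μ) b (X.1 b) * mvfderiv 𝓘(ℝ, E) (y μ) b (Y.1 b)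
        - mvfderiv 𝓘(ℝ, E) (A μ) b (Y.1 b) * mvfderiv 𝓘(ℝ, E) (y μ) b (X.1 b)) := by
  have dA : ∀ μ, MDifferentiableAt 𝓘(ℝ, E) 𝓘(ℝ, ℂ) (A μ) b := fun μ =>
    ((hA μ).contMDiffAt (hN.mem_nhds hb)).mdifferentiableAt (by simp)
  have dy : ∀ (Z : VField 𝓘(ℝ, E) M) μ, MDifferentiableAt 𝓘(ℝ, E) 𝓘(ℝ, ℂ)
      (fun z => mvfderiv 𝓘(ℝ, E) (y μ) z (Z.1 z)) b := fun Z μ =>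
    ((contMDiffOn_mvfderiv_apply hN (hy μ) Z.2.contMDiffOn).contMDiffAt
      (hN.mem_nhds hb)).mdifferentiableAt (by simp)
  have key : ∀ (Z : VField 𝓘(ℝ, E) M) (v : TangentSpace 𝓘(ℝ, E) b),
      mvfderiv 𝓘(ℝ, E) (fun z => ∑ μ, A μ z * mvfderiv 𝓘(ℝ, E) (y μ) z (Z.1 z)) b v
        = ∑ μ, (A μ b * mvfderiv 𝓘(ℝ, E) (fun z => mvfderiv 𝓘(ℝ, E) (y μ) z (Z.1 z)) b v
          + mvfderiv 𝓘(ℝ, E) (A μ) b v * mvfderiv 𝓘(ℝ, E) (y μ) b (Z.1 b)) := fun Z v => by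
    refine (mvfderiv_complex_sum_apply Finset.univ
      (f := fun μ z => A μ z * mvfderiv 𝓘(ℝ, E) (y μ) z (Z.1 z))
      (fun μ _ => (dA μ).mul (dy Z μ)) v).2.trans ?_
    exact Finset.sum_congr rfl fun μ _ => mvfderiv_complex_mul_apply (dA μ) (dy Z μ) v
  rw [key, key, ← Finset.sum_sub_distrib, ← Finset.sum_sub_distrib]
  refine Finset.sum_congr rfl fun μ _ => ?_
  -- The second derivatives of `y μ` cancel against its derivative along the bracket, which leaves
  -- only products of first derivatives.
  rw [mvfderiv_mlieBracket hN (hy μ) X Y hb]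
  ring

/-- The curvature of a connection with connection matrix `∑ μ, A μ • d(y μ)` in the coefficients
`C`. -/
theorem Connection.curvature_coeff {W : SmoothBundle.{u, w} 𝓘(ℝ, E) M} (D : Connection W)
    {ι J : Type*} [Fintype ι] [Fintype J] {N : Set M} (hN : IsOpen N)
    (C : ∀ b, W.Fib b →ₗ[ℂ] J → ℂ)
    (hC : ∀ (φ : W.Sections) α, ContMDiffOn 𝓘(ℝ, E) 𝓘(ℝ, ℂ) ∞ (fun b => C b (φ.1 b) α) N)
    {A : ι → J → J → M → ℂ} {y : ι → M → ℂ}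
    (hA : ∀ μ α β, ContMDiffOn 𝓘(ℝ, E) 𝓘(ℝ, ℂ) ∞ (A μ α β) N)
    (hy : ∀ μ, ContMDiffOn 𝓘(ℝ, E) 𝓘(ℝ, ℂ) ∞ (y μ) N)
    (hD : ∀ φ : W.Sections, ∀ b ∈ N, ∀ (v : TangentSpace 𝓘(ℝ, E) b) α,
      C b (D.toFun φ b v) α = mvfderiv 𝓘(ℝ, E) (fun z => C z (φ.1 z) α) b v
        + ∑ β, (∑ μ, A μ α β b * mvfderiv 𝓘(ℝ, E) (y μ) b v) * C b (φ.1 b) β)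
    (X Y : VField 𝓘(ℝ, E) M) (φ : W.Sections) {b : M} (hb : b ∈ N) (α : J) :
    C b (D.curvature X Y φ b) α = ∑ β,
      (∑ μ, (mvfderiv 𝓘(ℝ, E) (A μ α β) b (X.1 b) * mvfderiv 𝓘(ℝ, E) (y μ) b (Y.1 b)
        - mvfderiv 𝓘(ℝ, E) (A μ α β) b (Y.1 b) * mvfderiv 𝓘(ℝ, E) (y μ) b (X.1 b))
      + ∑ γ, ((∑ μ, A μ α γ b * mvfderiv 𝓘(ℝ, E) (y μ) b (X.1 b))
            * (∑ μ, A μ γ β b * mvfderiv 𝓘(ℝ, E) (y μ) b (Y.1 b))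
          - (∑ μ, A μ α γ b * mvfderiv 𝓘(ℝ, E) (y μ) b (Y.1 b))
            * (∑ μ, A μ γ β b * mvfderiv 𝓘(ℝ, E) (y μ) b (X.1 b)))) * C b (φ.1 b) β := by
  set f : J → M → ℂ := fun α z => C z (φ.1 z) α with hf
  set θ : VField 𝓘(ℝ, E) M → J → J → M → ℂ := fun Z α β z =>
    ∑ μ, A μ α β z * mvfderiv 𝓘(ℝ, E) (y μ) z (Z.1 z) with hθ
  have nb := hN.mem_nhds hb
  have sθ : ∀ Z α β, ContMDiffOn 𝓘(ℝ, E) 𝓘(ℝ, ℂ) ∞ (θ Z α β) N := fun Z α β =>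
    contMDiffOn_finsetSum fun μ _ => contMDiffOn_mul_complex (hA μ α β)
      (contMDiffOn_mvfderiv_apply hN (hy μ) Z.2.contMDiffOn)
  have df : ∀ α, MDifferentiableAt 𝓘(ℝ, E) 𝓘(ℝ, ℂ) (f α) b := fun α =>
    ((hC φ α).contMDiffAt nb).mdifferentiableAt (by simp)
  have dXf : ∀ (Z : VField 𝓘(ℝ, E) M) α, MDifferentiableAt 𝓘(ℝ, E) 𝓘(ℝ, ℂ)
      (fun z => mvfderiv 𝓘(ℝ, E) (f α) z (Z.1 z)) b := fun Z α =>
    ((contMDiffOn_mvfderiv_apply hN (hC φ α) Z.2.contMDiffOn).contMDiffAt nb).mdifferentiableAt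
      (by simp)
  have dθ : ∀ Z α β, MDifferentiableAt 𝓘(ℝ, E) 𝓘(ℝ, ℂ) (θ Z α β) b := fun Z α β =>
    ((sθ Z α β).contMDiffAt nb).mdifferentiableAt (by simp)
  -- The covariant derivative applied twice in coefficients. The terms `θ(T) Z f + θ(Z) T f` are
  -- symmetric in `Z` and `T`, so they disappear in the commutator.
  have cov : ∀ (Z T : VField 𝓘(ℝ, E) M), C b (D.toFun (D.cov T φ) b (Z.1 b)) α
      = mvfderiv 𝓘(ℝ, E) (fun z => mvfderiv 𝓘(ℝ, E) (f α) z (T.1 z)) b (Z.1 b)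
        + ∑ β, (θ T α β b * mvfderiv 𝓘(ℝ, E) (f β) b (Z.1 b)
          + mvfderiv 𝓘(ℝ, E) (θ T α β) b (Z.1 b) * f β b)
        + ∑ β, θ Z α β b * (mvfderiv 𝓘(ℝ, E) (f β) b (T.1 b) + ∑ γ, θ T β γ b * f γ b) := by
    intro Z T
    have h1 : ∀ z ∈ N, ∀ α, C z ((D.cov T φ).1 z) α
        = mvfderiv 𝓘(ℝ, E) (f α) z (T.1 z) + ∑ β, θ T α β z * f β z := fun z hz α =>
      hD φ z hz (T.1 z) α
    have h2 : (fun z => C z ((D.cov T φ).1 z) α) =ᶠ[nhds b]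
        fun z => mvfderiv 𝓘(ℝ, E) (f α) z (T.1 z) + ∑ β, θ T α β z * f β z := by
      filter_upwards [nb] with z hz
      exact h1 z hz α
    have h3 := mvfderiv_complex_sum_apply Finset.univ (f := fun β z => θ T α β z * f β z)
      (fun β _ => (dθ T α β).mul (df β)) (Z.1 b)
    rw [hD _ b hb (Z.1 b) α, mvfderiv_congr_nhds h2, mvfderiv_fun_add (dXf T α) h3.1, add_apply,
      h3.2]
    congr 1
    · congr 1
      exact Finset.sum_congr rfl fun β _ => mvfderiv_complex_mul_apply (dθ T α β) (df β) _
    · exact Finset.sum_congr rfl fun β _ => by rw [h1 b hb β]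
  have hbr := mvfderiv_mlieBracket hN (hC φ α) X Y hb
  have hθd : ∀ β, _ := fun β =>
    mvfderiv_sum_mul_mvfderiv hN (fun μ => hA μ α β) hy X Y hb
  have hsplit : C b (D.curvature X Y φ b) α = C b (D.toFun (D.cov Y φ) b (X.1 b)) α
      - C b (D.toFun (D.cov X φ) b (Y.1 b)) α
      - C b (D.toFun φ b (VectorField.mlieBracket 𝓘(ℝ, E) X.1 Y.1 b)) α := by
    rw [curvature, map_sub, map_sub]; rfl
  rw [hsplit, cov X Y, cov Y X, hD φ b hb _ α, hbr]
  simp only [← hθd]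
  -- Applying the connection matrix twice is applying the product of the two matrices.
  have swap : ∀ Z T : VField 𝓘(ℝ, E) M, ∑ β, θ Z α β b * ∑ γ, θ T β γ b * f γ b
      = ∑ β, (∑ γ, θ Z α γ b * θ T γ β b) * f β b := fun Z T => by
    simp only [Finset.mul_sum, Finset.sum_mul]
    rw [Finset.sum_comm]
    exact Finset.sum_congr rfl fun β _ => Finset.sum_congr rfl fun γ _ => by ring
  simp only [mul_add, Finset.sum_add_distrib, swap, Finset.sum_sub_distrib, sub_mul, add_mul]
  ring

end LocalCurvature

/-! ### Lifting to the covering group and the connection in the invariant frame -/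

section LocalForm

universe u w

variable {EK HK EG HG EB HB EV HV : Type*}
  [NormedAddCommGroup EK] [NormedSpace ℝ EK] [TopologicalSpace HK]
  [NormedAddCommGroup EG] [NormedSpace ℝ EG] [TopologicalSpace HG]
  [NormedAddCommGroup EB] [NormedSpace ℝ EB] [TopologicalSpace HB]
  [NormedAddCommGroup EV] [NormedSpace ℝ EV] [TopologicalSpace HV]
  {IK : ModelWithCorners ℝ EK HK} {IG : ModelWithCorners ℝ EG HG}
  {IB : ModelWithCorners ℝ EB HB} {IV : ModelWithCorners ℝ EV HV}
  {K G B V : Type*} [Group K] [TopologicalSpace K] [ChartedSpace HK K]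
  [Group G] [TopologicalSpace G] [ChartedSpace HG G]
  [TopologicalSpace B] [ChartedSpace HB B] [TopologicalSpace V] [ChartedSpace HV V]
  {P : PrincipalBundle IG IB IV G B V} {c : LieCover IK IG K G}

namespace PrincipalBundle

variable (P c) in
theorem lact_smooth [LieGroup IG ∞ G] :
    ContMDiff (IK.prod IB) IB ∞ (fun z : K × B => P.lact c z.1 z.2) :=
  P.act_smooth.comp (contMDiff_snd.prodMk ((c.isLocalDiffeomorph.contMDiff.comp contMDiff_fst).inv))

variable (c) in
/-- Locally on `B`, the points are `κ b · s (proj b)` for a smooth function `κ` with values in the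
covering group `K`. -/
theorem exists_smooth_lact_eq [LieGroup IG ∞ G] (S : P.LocalSection) {b₀ : B}
    (hb₀ : P.proj b₀ ∈ S.U) : ∃ (N : Set B) (κ : B → K), IsOpen N ∧ b₀ ∈ N ∧
      N ⊆ P.proj ⁻¹' S.U ∧ ContMDiffOn IB IK ∞ κ N ∧
      ∀ b, b = P.lact c (κ b) (S.s (P.proj b)) := by
  classical
  obtain ⟨U, hU, hxU, s, γ, -, hγ, -, h⟩ := P.locally_trivial (P.proj b₀)
  set O : Set B := P.proj ⁻¹' (U ∩ S.U)
  have hO : IsOpen O := (hU.inter S.isOpen).preimage P.proj_smooth.continuous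
  have hbO : b₀ ∈ O := ⟨hxU, hb₀⟩
  -- Since `k` acts by `π(k)⁻¹` on the right, the condition `κ b · s (p b) = b` amounts to `π (κ b)
  -- = g b`. The value `κ b` is found by inverting the covering `π` locally.
  set g : B → G := fun b => (γ b)⁻¹ * γ (S.s (P.proj b)) with hg
  have sg : ContMDiffOn IB IG ∞ g O := by
    refine ((hγ.mono fun b hb => hb.1).inv).mul (hγ.comp (S.smooth.comp
      P.proj_smooth.contMDiffOn fun b hb => hb.2) fun b hb => ?_)
    change P.proj (S.s (P.proj b)) ∈ U
    rw [S.proj_s]; exact hb.1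
  obtain ⟨k₀, hk₀⟩ := c.surjective (g b₀)
  have hl := c.isLocalDiffeomorph k₀
  -- A set theoretic choice, used outside `N`, so that the relation holds at every `b` and `coeffAt`
  -- is defined on all fibres.
  choose κ₀ hκ₀ using fun b => P.exists_lact_eq c (b := S.s (P.proj b)) (b' := b) (S.proj_s _)
  set N : Set B := O ∩ g ⁻¹' hl.localInverse.source
  refine ⟨N, fun b => if b ∈ N then hl.localInverse (g b) else κ₀ b,
    sg.continuousOn.isOpen_inter_preimage hO hl.localInverse_open_source,
    ⟨hbO, ?_⟩, fun b hb => hb.1.2, ?_, fun b => ?_⟩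
  · change g b₀ ∈ hl.localInverse.source
    rw [← hk₀]; exact hl.localInverse_mem_source
  · have h1 : ContMDiffOn IB IK ∞ (fun b => hl.localInverse (g b)) N :=
      ContMDiffOn.comp (g := hl.localInverse) (t := hl.localInverse.source)
        hl.localInverse.contMDiffOn_toFun (sg.mono Set.inter_subset_left) fun b hb => hb.2
    exact h1.congr fun b hb => if_pos hb
  · by_cases hb : b ∈ N
    · refine Eq.trans ?_ (congrArg (fun k => P.lact c k (S.s (P.proj b))) (if_pos hb).symm)
      have e1 := h (S.s (P.proj b)) (by rw [S.proj_s]; exact hb.1.1)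
      have e2 := h b hb.1.1
      rw [S.proj_s] at e1
      rw [lact, hl.localInverse_right_inv hb.2, hg]
      have e3 : P.act (S.s (P.proj b)) (γ (S.s (P.proj b)))⁻¹ = s (P.proj b) := by
        nth_rewrite 1 [← e1]
        rw [P.act_mul, mul_inv_cancel, P.act_one]
      rw [mul_inv_rev, inv_inv, ← P.act_mul, e3, e2]
    · exact (hκ₀ b).trans (congrArg (fun k => P.lact c k (S.s (P.proj b))) (if_neg hb).symm)

/-- The projection of a principal bundle is a submersion. -/
theorem mfderiv_proj_surjective [LieGroup IG ∞ G] (c : LieCover IK IG K G) (b : B) :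
    Function.Surjective (mfderiv IB IV P.proj b) := by
  obtain ⟨S, hS⟩ := P.exists_localSection (P.proj b)
  obtain ⟨k, hk⟩ := P.exists_lact_eq c (b := S.s (P.proj b)) (b' := b) (S.proj_s _)
  -- A translate of the local section passes through `b`; as it is a right inverse of the
  -- projection, the chain rule gives a right inverse of the derivative.
  set σ : V → B := fun x => P.lact c k (S.s x) with hσ
  have hσb : σ (P.proj b) = b := hk.symm
  have sσ : MDifferentiableAt IV IB σ (P.proj b) := by
    refine (ContMDiffAt.comp (P.proj b) (f := fun x => (k, S.s x)) (P.lact_smooth c).contMDiffAt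
      (contMDiffAt_const.prodMk (S.smooth.contMDiffAt (S.isOpen.mem_nhds hS)))).mdifferentiableAt
      (n := ∞) (by simp)
  have hp : MDifferentiableAt IB IV P.proj (σ (P.proj b)) :=
    P.proj_smooth.mdifferentiable (by simp) _
  have hid : P.proj ∘ σ = id := funext fun x => by simp [σ, P.proj_lact, S.proj_s]
  have hc := mfderiv_comp (P.proj b) hp sσ
  rw [hid, mfderiv_id] at hc
  have key : ∀ b' (hb : b' = b), Function.Surjective (mfderiv IB IV P.proj b') →
      Function.Surjective (mfderiv IB IV P.proj b) := by rintro _ rfl h; exact h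
  refine key _ hσb fun v => ⟨mfderiv IV IB σ (P.proj b) v, ?_⟩
  exact (congrArg (fun L : EV →L[ℝ] EV => L v) hc).symm

end PrincipalBundle

namespace EqBundle

variable (W : EqBundle P c)

theorem lift_inv_lift (k : K) (b b' : B) (h : b' = P.lact c k b) (h' : b = P.lact c k⁻¹ b')
    (w : W.Fib b) : W.lift k⁻¹ b' b h' (W.lift k b b' h w) = w := by
  rw [← W.lift_mul k⁻¹ k b b' b h h' (by rw [inv_mul_cancel, P.lact_one])]
  -- The lift carries a proof that depends on the group element, so `k⁻¹ * k` is generalized to a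
  -- variable before being replaced by `1`.
  have : ∀ l (hl : b = P.lact c l b), l = 1 → W.lift l b b hl w = w := by
    rintro l hl rfl; exact W.lift_one _ _ _
  exact this _ _ (inv_mul_cancel k)

theorem lift_symm (k : K) (b b' : B) (h : b' = P.lact c k b) (h' : b = P.lact c k⁻¹ b')
    (w : W.Fib b') : (W.lift k b b' h).symm w = W.lift k⁻¹ b' b h' w := by
  obtain ⟨u, rfl⟩ := (W.lift k b b' h).surjective w
  rw [LinearEquiv.symm_apply_apply, W.lift_inv_lift]

/-- The coefficients of the lifted values of a smooth section are smooth. -/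
theorem contMDiffAt_repr_lift [LieGroup IG ∞ G] {EM HM : Type*} [NormedAddCommGroup EM]
    [NormedSpace ℝ EM] [TopologicalSpace HM] {IM : ModelWithCorners ℝ EM HM} {M : Type*}
    [TopologicalSpace M] [ChartedSpace HM M] {g t : M → B} {κ : M → K} {m : M}
    (hg : ContMDiffAt IM IB ∞ g m) (hκ : ContMDiffAt IM IK ∞ κ m)
    (ht : ∀ y, t y = P.lact c (κ y) (g y)) (i : W.Fr) (hi : t m ∈ W.base i)
    (φ : W.toSmoothBundle.Sections) (α : W.Idx) :
    ContMDiffAt IM 𝓘(ℝ, ℂ) ∞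
      (fun y => (W.frame i (t y)).repr (W.lift (κ y) (g y) (t y) (ht y) (φ.1 (g y))) α) m := by
  obtain ⟨j, hj⟩ := W.exists_mem_base (g m)
  have hset : IsOpen {z : K × B | z.2 ∈ W.base j ∧ P.lact c z.1 z.2 ∈ W.base i} :=
    ((W.isOpen_base j).preimage continuous_snd).inter
      ((W.isOpen_base i).preimage (P.lact_smooth c).continuous)
  have h1 : ∀ δ, ContMDiffAt IM 𝓘(ℝ, ℂ) ∞ (fun y => (W.frame j (g y)).repr (φ.1 (g y)) δ) m :=
    fun δ => ContMDiffAt.comp m (g := fun b => (W.frame j b).repr (φ.1 b) δ)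
      ((φ.2 j δ).contMDiffAt ((W.isOpen_base j).mem_nhds hj)) hg
  have h2 : ∀ δ, ContMDiffAt IM 𝓘(ℝ, ℂ) ∞ (fun y => (W.frame i (P.lact c (κ y) (g y))).repr
      (W.lift (κ y) (g y) (P.lact c (κ y) (g y)) rfl (W.frame j (g y) δ)) α) m := fun δ =>
    ContMDiffAt.comp m (f := fun y => (κ y, g y))
      ((W.lift_smooth j i δ α).contMDiffAt (hset.mem_nhds ⟨hj, ht m ▸ hi⟩)) (hκ.prodMk hg)
  have aux : ∀ (k : K) (b b' : B) (h : b' = P.lact c k b) (w : W.Fib b),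
      (W.frame i b').repr (W.lift k b b' h w) α
        = (W.frame i (P.lact c k b)).repr (W.lift k b (P.lact c k b) rfl w) α := by
    rintro k b b' rfl w; rfl
  have h3 := contMDiffAt_finsetSum (t := Finset.univ) (I := 𝓘(ℝ, ℂ)) (I' := IM) (n := ∞) (x := m)
    (f := fun δ y => (W.frame j (g y)).repr (φ.1 (g y)) δ *
      (W.frame i (P.lact c (κ y) (g y))).repr
      (W.lift (κ y) (g y) (P.lact c (κ y) (g y)) rfl (W.frame j (g y) δ)) α)
    fun δ _ => contMDiffAt_mul_complex (h1 δ) (h2 δ)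
  refine h3.congr_of_eventuallyEq (Filter.Eventually.of_forall fun y => ?_)
  refine (aux _ _ _ _ _).trans ?_
  conv_lhs => rw [← (W.frame j (g y)).sum_repr (φ.1 (g y))]
  simp only [map_sum, map_smul, Finsupp.coe_finsetSum, Finset.sum_apply, Finsupp.smul_apply,
    smul_eq_mul]

theorem contMDiffAt_pullCoord [LieGroup IK ∞ K] [LieGroup IG ∞ G] (S : P.LocalSection) (i : W.Fr)
    (φ : W.toSmoothBundle.Sections) (α : W.Idx) {x : V} (hx : x ∈ S.U) (hi : S.s x ∈ W.base i)
    (k : K) : ContMDiffAt (IV.prod IK) 𝓘(ℝ, ℂ) ∞ (W.pullCoord S i φ α) (x, k) := by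
  have hs : ContMDiffAt (IV.prod IK) IB ∞ (fun z : V × K => S.s z.1) (x, k) :=
    ContMDiffAt.comp (x, k) (g := S.s) (S.smooth.contMDiffAt (S.isOpen.mem_nhds hx))
      contMDiffAt_fst
  exact W.contMDiffAt_repr_lift (g := fun z : V × K => P.lact c z.2 (S.s z.1))
    (t := fun z => S.s z.1) (κ := fun z => z.2⁻¹)
    (ContMDiffAt.comp (x, k) (f := fun z : V × K => (z.2, S.s z.1))
      (P.lact_smooth c).contMDiffAt (contMDiffAt_snd.prodMk hs))
    contMDiffAt_snd.inv (fun z => (P.lact_inv_lact c _ _).symm) i hi φ α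

variable [IsManifold IB 1 B] [IsManifold IV 1 V]

/-- The coefficients at `b = k · s x` of a vector in the frame `k · e (s x)`. -/
def coeffAt (S : P.LocalSection) (i : W.Fr) {κ : B → K}
    (hκ : ∀ b, b = P.lact c (κ b) (S.s (P.proj b))) (b : B) : W.Fib b ≃ₗ[ℂ] W.Idx → ℂ :=
  (W.lift (κ b) (S.s (P.proj b)) b (hκ b)).symm ≪≫ₗ (W.frame i (S.s (P.proj b))).equivFun

/-- `coeffAt` inverts the lift by `κ b`, whereas `pullCoord` lifts by the inverse element;
`lift_symm` identifies the two. Smoothness and derivatives are known for the second form. -/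
theorem coeffAt_eq_pullCoord (S : P.LocalSection) (i : W.Fr) {κ : B → K}
    (hκ : ∀ b, b = P.lact c (κ b) (S.s (P.proj b))) (φ : W.toSmoothBundle.Sections) (b : B)
    (α : W.Idx) : W.coeffAt S i hκ b (φ.1 b) α = W.pullCoord S i φ α (P.proj b, κ b) := by
  have key : ∀ b' (h : b' = P.lact c (κ b) (S.s (P.proj b))),
      (W.frame i (S.s (P.proj b))).repr ((W.lift (κ b) _ b' h).symm (φ.1 b')) α
        = W.pullCoord S i φ α (P.proj b, κ b) := by
    rintro _ rfl
    rw [W.lift_symm _ _ _ _ (P.lact_inv_lact c _ _).symm]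
    rfl
  exact key b (hκ b)

/-- A locally flat connection plus a pulled back connection matrix, in local coefficients. -/
theorem coeffAt_toFun [LieGroup IK ∞ K] [LieGroup IG ∞ G] (D : Connection W.toSmoothBundle)
    (S : P.LocalSection) (i : W.Fr)
    (a : ∀ x : V, TangentSpace IV x →ₗ[ℝ] Matrix W.Idx W.Idx ℂ)
    (hi : ∀ x ∈ S.U, S.s x ∈ W.base i)
    (hD : ∀ (φ : W.toSmoothBundle.Sections), ∀ x ∈ S.U, ∀ (k : K) (η : TangentSpace IV x)
      (ζ : TangentSpace IK k),
      D.toFun φ (P.lact c k (S.s x))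
          (mfderiv (IV.prod IK) IB (fun z : V × K => P.lact c z.2 (S.s z.1)) (x, k) (η, ζ))
        = W.lift k (S.s x) (P.lact c k (S.s x)) rfl
          (∑ α, (mvfderiv (IV.prod IK) (W.pullCoord S i φ α) (x, k) (η, ζ)
            + ∑ β, a x η α β * W.pullCoord S i φ β (x, k)) • W.frame i (S.s x) α))
    {N : Set B} {κ : B → K} (hN : IsOpen N) (hNU : N ⊆ P.proj ⁻¹' S.U)
    (sκ : ContMDiffOn IB IK ∞ κ N) (hκ : ∀ b, b = P.lact c (κ b) (S.s (P.proj b)))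
    (φ : W.toSmoothBundle.Sections) {b : B} (hb : b ∈ N) (v : TangentSpace IB b) (α : W.Idx) :
    W.coeffAt S i hκ b (D.toFun φ b v) α
      = mvfderiv IB (fun z => W.coeffAt S i hκ z (φ.1 z) α) b v
        + ∑ β, a (P.proj b) (mfderiv IB IV P.proj b v) α β * W.coeffAt S i hκ b (φ.1 b) β := by
  have hx : P.proj b ∈ S.U := hNU hb
  have dκ : MDifferentiableAt IB IK κ b :=
    (sκ.contMDiffAt (hN.mem_nhds hb)).mdifferentiableAt (by simp)
  have dp : MDifferentiableAt IB IV P.proj b := P.proj_smooth.mdifferentiable (by simp) _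
  have dΘ : MDifferentiableAt IB (IV.prod IK) (fun z => (P.proj z, κ z)) b := dp.prodMk dκ
  have mΘ : mfderiv IB (IV.prod IK) (fun z => (P.proj z, κ z)) b v
      = (mfderiv IB IV P.proj b v, mfderiv IB IK κ b v) := by
    rw [mfderiv_prodMk dp dκ]; rfl
  have hcoe : ∀ α, (fun z => W.coeffAt S i hκ z (φ.1 z) α)
      = fun z => W.pullCoord S i φ α (P.proj z, κ z) := fun α =>
    funext fun z => W.coeffAt_eq_pullCoord S i hκ φ z α
  have e1 : mvfderiv IB (fun z => W.coeffAt S i hκ z (φ.1 z) α) b v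
      = mvfderiv (IV.prod IK) (W.pullCoord S i φ α) (P.proj b, κ b)
        (mfderiv IB IV P.proj b v, mfderiv IB IK κ b v) := by
    rw [hcoe]
    refine (mvfderiv_complex_comp_apply (f := fun z => (P.proj z, κ z))
      (g := W.pullCoord S i φ α)
      ((W.contMDiffAt_pullCoord S i φ α hx (hi _ hx) (κ b)).mdifferentiableAt (by simp)) dΘ
      v).trans ?_
    exact congrArg (mvfderiv (IV.prod IK) (W.pullCoord S i φ α) (P.proj b, κ b)) mΘ
  have dΨ : MDifferentiableAt (IV.prod IK) IB (fun z : V × K => P.lact c z.2 (S.s z.1))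
      (P.proj b, κ b) :=
    (ContMDiffAt.comp (P.proj b, κ b) (f := fun z : V × K => (z.2, S.s z.1))
      (P.lact_smooth c).contMDiffAt (contMDiffAt_snd.prodMk
      (ContMDiffAt.comp (P.proj b, κ b) (g := S.s) (S.smooth.contMDiffAt (S.isOpen.mem_nhds hx))
      contMDiffAt_fst))).mdifferentiableAt (n := ∞) (by simp)
  -- The map `b ↦ (p b, κ b)` followed by `(x, k) ↦ k · s x` is the identity of `B`. Hence `v` is
  -- the image of `(dp v, dκ v)`, which is the form of tangent vector occurring in `hD`.
  have hΨ : (v : EB) = mfderiv (IV.prod IK) IB (fun z : V × K => P.lact c z.2 (S.s z.1))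
      (P.proj b, κ b) (mfderiv IB IV P.proj b v, mfderiv IB IK κ b v) := by
    have h1 := mfderiv_comp b dΨ dΘ
    have h2 : (fun z : V × K => P.lact c z.2 (S.s z.1)) ∘ (fun z => (P.proj z, κ z)) = id :=
      funext fun z => (hκ z).symm
    rw [h2, mfderiv_id] at h1
    have h3 := congrArg (fun L : EB →L[ℝ] EB => L v) h1
    exact Eq.trans h3 (congrArg (mfderiv (IV.prod IK) IB
      (fun z : V × K => P.lact c z.2 (S.s z.1)) (P.proj b, κ b)) mΘ)
  -- The point `b` equals `κ b · s (p b)` only propositionally; a free `b'` lets the equation be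
  -- eliminated while `p b` and `κ b` stay fixed.
  have key : ∀ b' (h : b' = P.lact c (κ b) (S.s (P.proj b))) (v' : TangentSpace IB b'),
      (v' : EB) = mfderiv (IV.prod IK) IB (fun z : V × K => P.lact c z.2 (S.s z.1))
        (P.proj b, κ b) (mfderiv IB IV P.proj b v, mfderiv IB IK κ b v) →
      (W.frame i (S.s (P.proj b))).repr ((W.lift (κ b) _ b' h).symm (D.toFun φ b' v')) α
        = mvfderiv (IV.prod IK) (W.pullCoord S i φ α) (P.proj b, κ b)
            (mfderiv IB IV P.proj b v, mfderiv IB IK κ b v)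
          + ∑ β, a (P.proj b) (mfderiv IB IV P.proj b v) α β
            * W.pullCoord S i φ β (P.proj b, κ b) := by
    rintro _ rfl v' hv'
    have h1 := (congrArg (D.toFun φ _) hv').trans (hD φ _ hx (κ b) (mfderiv IB IV P.proj b v)
      (mfderiv IB IK κ b v))
    rw [h1, LinearEquiv.symm_apply_apply, Basis.repr_sum_self]
  rw [e1]
  refine (key b (hκ b) v hΨ).trans ?_
  congr 1
  exact Finset.sum_congr rfl fun β _ => by rw [W.coeffAt_eq_pullCoord]

end EqBundle

end LocalForm

/-! ### Matrix valued 1-forms in coordinates -/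

section Coordinates

open Bundle

variable {EV : Type*} [NormedAddCommGroup EV] [NormedSpace ℝ EV] [FiniteDimensional ℝ EV]
  {V : Type*} [TopologicalSpace V] [ChartedSpace EV V] [IsManifold 𝓘(ℝ, EV) ∞ V]

/-- A smooth matrix valued `1`-form is locally of the form `∑ μ, A μ • d(y μ)`. -/
theorem exists_eq_sum_mul_mvfderiv {J : Type*}
    {a : ∀ x : V, TangentSpace 𝓘(ℝ, EV) x →ₗ[ℝ] Matrix J J ℂ} {U : Set V} (hU : IsOpen U)
    (ha : ∀ α β, ContMDiffOn 𝓘(ℝ, EV).tangent 𝓘(ℝ, ℂ) ∞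
      (fun η : TangentBundle 𝓘(ℝ, EV) V => a η.1 η.2 α β) {η | η.1 ∈ U}) {x₀ : V} (hx₀ : x₀ ∈ U) :
    ∃ U' ⊆ U, IsOpen U' ∧ x₀ ∈ U' ∧
      ∃ (A : Fin (Module.finrank ℝ EV) → J → J → V → ℂ) (y : Fin (Module.finrank ℝ EV) → V → ℂ),
        (∀ μ α β, ContMDiffOn 𝓘(ℝ, EV) 𝓘(ℝ, ℂ) ∞ (A μ α β) U') ∧
        (∀ μ, ContMDiffOn 𝓘(ℝ, EV) 𝓘(ℝ, ℂ) ∞ (y μ) U') ∧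
        ∀ x ∈ U', ∀ (η : TangentSpace 𝓘(ℝ, EV) x) α β,
          a x η α β = ∑ μ, A μ α β x * mvfderiv 𝓘(ℝ, EV) (y μ) x η := by
  set e := trivializationAt EV (TangentSpace 𝓘(ℝ, EV) : V → Type _) x₀ with he
  set bs := Module.finBasis ℝ EV
  set φ := extChartAt 𝓘(ℝ, EV) x₀ with hφ
  have hbase : e.baseSet = φ.source := by
    rw [he, TangentBundle.trivializationAt_baseSet, hφ, extChartAt_source]
  -- `L μ ∘ φ` is the coordinate function `y μ`, regarded as complex valued; `d μ` below is the
  -- matching coordinate field, and `A μ` is `a` evaluated on it.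
  let L : Fin (Module.finrank ℝ EV) → EV →L[ℝ] ℂ := fun μ =>
    Complex.ofRealCLM.comp (LinearMap.toContinuousLinearMap (bs.coord μ))
  let d : Fin (Module.finrank ℝ EV) → ∀ x : V, TangentSpace 𝓘(ℝ, EV) x := fun μ x =>
    e.symmL ℝ x (bs μ)
  have sd : ∀ μ, ContMDiffOn 𝓘(ℝ, EV) 𝓘(ℝ, EV).tangent ∞
      (fun x => (⟨x, d μ x⟩ : TangentBundle 𝓘(ℝ, EV) V)) e.baseSet := fun μ => by
    have h1 := (Trivialization.contMDiffOn_symm (IB := 𝓘(ℝ, EV)) (n := ∞) e).comp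
      (contMDiffOn_id.prodMk (contMDiffOn_const (c := bs μ)) :
        ContMDiffOn 𝓘(ℝ, EV) (𝓘(ℝ, EV).prod 𝓘(ℝ, EV)) ∞ (fun x : V => (x, bs μ)) e.baseSet)
      (fun x hx => e.mem_target.2 hx)
    refine h1.congr fun x hx => ?_
    exact (congrArg (fun v => (⟨x, v⟩ : TangentBundle 𝓘(ℝ, EV) V))
      (e.symmL_apply hx (bs μ))).trans (e.mk_symm hx (bs μ))
  refine ⟨U ∩ φ.source, Set.inter_subset_left, hU.inter (isOpen_extChartAt_source x₀),
    ⟨hx₀, mem_extChartAt_source x₀⟩, fun μ α β x => a x (d μ x) α β, fun μ x => L μ (φ x),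
    fun μ α β => ?_, fun μ => ?_, ?_⟩
  · exact (ha α β).comp ((sd μ).mono (hbase ▸ Set.inter_subset_right)) fun x hx => hx.1
  · exact (L μ).contMDiff.comp_contMDiffOn ((contMDiffOn_extChartAt (n := ∞)).mono
      (by rw [hφ, extChartAt_source]; exact Set.inter_subset_right))
  · intro x hx η α β
    have hxe : x ∈ e.baseSet := hbase ▸ hx.2
    have hxs : x ∈ (chartAt EV x₀).source := by
      have := hx.2
      rwa [hφ, extChartAt_source] at this
    have hT := TangentBundle.continuousLinearMapAt_trivializationAt (I := 𝓘(ℝ, EV)) hxs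
    -- At points of the chart, the tangent bundle trivialization at `x₀` is the derivative of the
    -- chart, so the components of `η` along the fields `d μ` are the derivatives of the coordinates
    -- along `η`.
    have hη : η = ∑ μ, bs.coord μ (mfderiv 𝓘(ℝ, EV) 𝓘(ℝ, EV) φ x η) • d μ x := by
      have h1 : e.symmL ℝ x (e.continuousLinearMapAt ℝ x η) = η :=
        e.symmL_continuousLinearMapAt hxe η
      have hT' : e.continuousLinearMapAt ℝ x η = mfderiv 𝓘(ℝ, EV) 𝓘(ℝ, EV) φ x η :=
        congrArg (fun T : TangentSpace 𝓘(ℝ, EV) x →L[ℝ] EV => T η) hT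
      have h2 := bs.sum_repr (mfderiv 𝓘(ℝ, EV) 𝓘(ℝ, EV) φ x η)
      have h3 := h1.symm.trans (congrArg (e.symmL ℝ x) (hT'.trans h2.symm))
      refine h3.trans ?_
      rw [map_sum]
      exact Finset.sum_congr rfl fun μ _ => map_smul (e.symmL ℝ x) _ _
    have hy : ∀ μ, mvfderiv 𝓘(ℝ, EV) (fun x => L μ (φ x)) x η
        = (bs.coord μ (mfderiv 𝓘(ℝ, EV) 𝓘(ℝ, EV) φ x η) : ℂ) := fun μ => by
      have hd : MDifferentiableAt 𝓘(ℝ, EV) 𝓘(ℝ, EV) φ x :=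
        (contMDiffAt_extChartAt' (n := 1) hxs).mdifferentiableAt (by simp)
      refine (mvfderiv_complex_comp_apply (L μ).differentiableAt.mdifferentiableAt hd η).trans ?_
      simp only [mvfderiv, mfderiv_eq_fderiv, ContinuousLinearMap.fderiv]
      rfl
    simp only [hy]
    conv_lhs => rw [hη]
    rw [map_sum, Matrix.sum_apply]
    refine Finset.sum_congr rfl fun μ _ => ?_
    rw [map_smul, Matrix.smul_apply, Complex.real_smul, mul_comm]

end Coordinates

/-! ### Local descent of the curvature -/

section Descent

theorem AlternatingMap.finsetSum_apply {A F ι : Type*} [AddCommGroup A] [Module ℝ A]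
    [AddCommGroup F] [Module ℝ F] (s : Finset ι) (f : ι → A [⋀^Fin 2]→ₗ[ℝ] F) (v : Fin 2 → A) :
    (∑ i ∈ s, f i) v = ∑ i ∈ s, f i v := by
  classical
  induction s using Finset.induction_on with
  | empty => rfl
  | insert i s hi ih => rw [Finset.sum_insert hi, Finset.sum_insert hi, AlternatingMap.add_apply, ih]

universe u w

variable {EK HK EG HG EB EV : Type*}
  [NormedAddCommGroup EK] [NormedSpace ℝ EK] [TopologicalSpace HK]
  [NormedAddCommGroup EG] [NormedSpace ℝ EG] [TopologicalSpace HG]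
  [NormedAddCommGroup EB] [NormedSpace ℝ EB] [FiniteDimensional ℝ EB]
  [NormedAddCommGroup EV] [NormedSpace ℝ EV] [FiniteDimensional ℝ EV]
  {IK : ModelWithCorners ℝ EK HK} {IG : ModelWithCorners ℝ EG HG}
  {K G B V : Type*} [Group K] [TopologicalSpace K] [ChartedSpace HK K]
  [Group G] [TopologicalSpace G] [ChartedSpace HG G] [LieGroup IK ∞ K] [LieGroup IG ∞ G]
  [TopologicalSpace B] [T2Space B] [ChartedSpace EB B] [IsManifold 𝓘(ℝ, EB) ∞ B]
  [TopologicalSpace V] [ChartedSpace EV V] [IsManifold 𝓘(ℝ, EV) ∞ V]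
  {P : PrincipalBundle IG 𝓘(ℝ, EB) 𝓘(ℝ, EV) G B V} {c : LieCover IK IG K G}

/-- The matrix of `2`-forms `∑ μ, d(A μ) ∧ d(y μ) + a ∧ a`. -/
def matrixTwoForm {ι J : Type*} [Fintype ι] [Fintype J]
    (a : ∀ x : V, TangentSpace 𝓘(ℝ, EV) x →ₗ[ℝ] Matrix J J ℂ) (A : ι → J → J → V → ℂ)
    (y : ι → V → ℂ) (x : V) (α β : J) : TangentSpace 𝓘(ℝ, EV) x [⋀^Fin 2]→ₗ[ℝ] ℂ :=
  ∑ μ, wedgePair (mvfderiv 𝓘(ℝ, EV) (A μ α β) x).toLinearMap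
      (mvfderiv 𝓘(ℝ, EV) (y μ) x).toLinearMap
    + ∑ γ, wedgePair ((Matrix.entryLinearMap ℝ ℂ α γ).comp (a x))
      ((Matrix.entryLinearMap ℝ ℂ γ β).comp (a x))

theorem matrixTwoForm_apply {ι J : Type*} [Fintype ι] [Fintype J]
    (a : ∀ x : V, TangentSpace 𝓘(ℝ, EV) x →ₗ[ℝ] Matrix J J ℂ) (A : ι → J → J → V → ℂ)
    (y : ι → V → ℂ) (x : V) (α β : J) (ξ η : TangentSpace 𝓘(ℝ, EV) x) :
    matrixTwoForm a A y x α β ![ξ, η] =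
      ∑ μ, (mvfderiv 𝓘(ℝ, EV) (A μ α β) x ξ * mvfderiv 𝓘(ℝ, EV) (y μ) x η
        - mvfderiv 𝓘(ℝ, EV) (A μ α β) x η * mvfderiv 𝓘(ℝ, EV) (y μ) x ξ)
      + ∑ γ, (a x ξ α γ * a x η γ β - a x η α γ * a x ξ γ β) := by
  rw [matrixTwoForm, AlternatingMap.add_apply, AlternatingMap.finsetSum_apply, AlternatingMap.finsetSum_apply]
  rfl

theorem contMDiffOn_matrixTwoForm {ι J : Type*} [Fintype ι] [Fintype J]
    {a : ∀ x : V, TangentSpace 𝓘(ℝ, EV) x →ₗ[ℝ] Matrix J J ℂ} {A : ι → J → J → V → ℂ}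
    {y : ι → V → ℂ} {U : Set V} (hU : IsOpen U)
    (ha : ∀ α β, ContMDiffOn 𝓘(ℝ, EV).tangent 𝓘(ℝ, ℂ) ∞
      (fun η : TangentBundle 𝓘(ℝ, EV) V => a η.1 η.2 α β) {η | η.1 ∈ U})
    (hA : ∀ μ α β, ContMDiffOn 𝓘(ℝ, EV) 𝓘(ℝ, ℂ) ∞ (A μ α β) U)
    (hy : ∀ μ, ContMDiffOn 𝓘(ℝ, EV) 𝓘(ℝ, ℂ) ∞ (y μ) U) (X Y : VField 𝓘(ℝ, EV) V) (α β : J) :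
    ContMDiffOn 𝓘(ℝ, EV) 𝓘(ℝ, ℂ) ∞ (fun x => matrixTwoForm a A y x α β ![X.1 x, Y.1 x]) U := by
  have sa : ∀ (Z : VField 𝓘(ℝ, EV) V) α β,
      ContMDiffOn 𝓘(ℝ, EV) 𝓘(ℝ, ℂ) ∞ (fun x => a x (Z.1 x) α β) U := fun Z α β =>
    (ha α β).comp Z.2.contMDiffOn fun x hx => hx
  have sd : ∀ (Z : VField 𝓘(ℝ, EV) V) {f : V → ℂ}, ContMDiffOn 𝓘(ℝ, EV) 𝓘(ℝ, ℂ) ∞ f U →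
      ContMDiffOn 𝓘(ℝ, EV) 𝓘(ℝ, ℂ) ∞ (fun x => mvfderiv 𝓘(ℝ, EV) f x (Z.1 x)) U :=
    fun Z f hf => contMDiffOn_mvfderiv_apply hU hf Z.2.contMDiffOn
  refine ContMDiffOn.congr (ContMDiffOn.add
    (contMDiffOn_finsetSum (t := Finset.univ) fun μ _ => (contMDiffOn_mul_complex (sd X (hA μ α β)) (sd Y (hy μ))).sub
      (contMDiffOn_mul_complex (sd Y (hA μ α β)) (sd X (hy μ))))
    (contMDiffOn_finsetSum (t := Finset.univ) fun γ _ => (contMDiffOn_mul_complex (sa X α γ) (sa Y γ β)).sub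
      (contMDiffOn_mul_complex (sa Y α γ) (sa X γ β)))) fun x _ => ?_
  exact matrixTwoForm_apply a A y x α β (X.1 x) (Y.1 x)

namespace EqBundle

variable (W : EqBundle.{u, w} P c)

/-- The representative at `b` is the conjugate, by the lift of `κ b`, of the representative at `s (p
b)`, and `coeffAt` removes that lift. So the matrix in the invariant frame depends on `p b` alone.
-/
theorem coeffAt_rep (S : P.LocalSection) (i : W.Fr) {κ : B → K}
    (hκ : ∀ b, b = P.lact c (κ b) (S.s (P.proj b))) (b : B) (q : W.OrbitFib (P.proj b))
    (u : W.Fib b) (α : W.Idx) : W.coeffAt S i hκ b (W.rep rfl q u) α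
      = ∑ β, (W.orbitFrame S i (P.proj b)).repr q (α, β) * W.coeffAt S i hκ b u β := by
  rw [W.rep_eq (S.proj_s (P.proj b)) rfl (κ b) (hκ b), LinearEquiv.conj_apply_apply]
  change (W.frame i (S.s (P.proj b))).repr ((W.lift (κ b) (S.s (P.proj b)) b (hκ b)).symm
    (W.lift (κ b) (S.s (P.proj b)) b (hκ b) _)) α = ∑ β, _ *
      (W.frame i (S.s (P.proj b))).repr ((W.lift (κ b) (S.s (P.proj b)) b (hκ b)).symm u) β
  rw [LinearEquiv.symm_apply_apply]
  set z := (W.lift (κ b) (S.s (P.proj b)) b (hκ b)).symm u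
  conv_lhs => rw [← (W.frame i (S.s (P.proj b))).sum_repr z]
  simp only [map_sum, map_smul, Finsupp.coe_finsetSum, Finset.sum_apply, Finsupp.smul_apply,
    smul_eq_mul, orbitFrame_repr]
  exact Finset.sum_congr rfl fun β _ => mul_comm _ _

/-- The `2`-form with values in `End(W)/G` with a given matrix in a local frame. -/
def orbitTwoForm (S : P.LocalSection) (i : W.Fr) (x : V)
    (Ω : W.Idx → W.Idx → TangentSpace 𝓘(ℝ, EV) x [⋀^Fin 2]→ₗ[ℝ] ℂ) :
    TangentSpace 𝓘(ℝ, EV) x [⋀^Fin 2]→ₗ[ℝ] W.OrbitFib x :=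
  ∑ α : W.Idx × W.Idx, ((LinearMap.toSpanSingleton ℂ _ (W.orbitFrame S i x α)).restrictScalars
    ℝ).compAlternatingMap (Ω α.1 α.2)

theorem orbitTwoForm_repr (S : P.LocalSection) (i : W.Fr) (x : V)
    (Ω : W.Idx → W.Idx → TangentSpace 𝓘(ℝ, EV) x [⋀^Fin 2]→ₗ[ℝ] ℂ)
    (ξ η : TangentSpace 𝓘(ℝ, EV) x) (α β : W.Idx) :
    (W.orbitFrame S i x).repr (W.orbitTwoForm S i x Ω ![ξ, η]) (α, β) = Ω α β ![ξ, η] := by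
  have : W.orbitTwoForm S i x Ω ![ξ, η]
      = ∑ α : W.Idx × W.Idx, Ω α.1 α.2 ![ξ, η] • W.orbitFrame S i x α := by
    rw [orbitTwoForm, AlternatingMap.finsetSum_apply]
    rfl
  rw [this, Basis.repr_sum_self]

/-- Locally over `V`, the curvature of a locally flat connection plus a pulled back connection
matrix descends to a smooth `2`-form with values in `End(W)/G`. -/
theorem exists_local_descent (D : Connection W.toSmoothBundle)
    (hD : W.IsLocallyFlatAddPullback D) (x₀ : V) :
    ∃ (U : Set V) (S : P.LocalSection) (i : W.Fr)
      (r : ∀ x, TangentSpace 𝓘(ℝ, EV) x [⋀^Fin 2]→ₗ[ℝ] W.OrbitFib x),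
      IsOpen U ∧ x₀ ∈ U ∧ U ⊆ S.U ∩ S.s ⁻¹' (W.base i) ∧
      (∀ (X Y : VField 𝓘(ℝ, EV) V) α, ContMDiffOn 𝓘(ℝ, EV) 𝓘(ℝ, ℂ) ∞
        (fun x => (W.orbitFrame S i x).repr (r x ![X.1 x, Y.1 x]) α) U) ∧
      ∀ (X Y : VField 𝓘(ℝ, EB) B) (φ : W.toSmoothBundle.Sections) (b : B), P.proj b ∈ U →
        D.curvature X Y φ b = W.rep (x := P.proj b) rfl (r (P.proj b)
          ![mfderiv 𝓘(ℝ, EB) 𝓘(ℝ, EV) P.proj b (X.1 b),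
            mfderiv 𝓘(ℝ, EB) 𝓘(ℝ, EV) P.proj b (Y.1 b)]) (φ.1 b) := by
  obtain ⟨S, i, a, hx₀, hi, ha, hD⟩ := hD x₀
  obtain ⟨U, hUS, hU, hxU, A, y, hA, hy, haA⟩ := exists_eq_sum_mul_mvfderiv S.isOpen ha hx₀
  refine ⟨U, S, i, fun x => W.orbitTwoForm S i x (matrixTwoForm a A y x), hU, hxU,
    fun x hx => ⟨hUS hx, hi x (hUS hx)⟩, fun X Y α => ?_, fun X Y φ b hb => ?_⟩
  · refine (contMDiffOn_matrixTwoForm hU (fun α β => (ha α β).mono fun η hη => hUS hη) hA hy X Y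
      α.1 α.2).congr fun x _ => ?_
    exact W.orbitTwoForm_repr S i x _ (X.1 x) (Y.1 x) α.1 α.2
  · obtain ⟨N', κ, hN', hbN', hN'S, sκ, hκ⟩ := PrincipalBundle.exists_smooth_lact_eq c S (hUS hb)
    set N := N' ∩ P.proj ⁻¹' U with hNdef
    have hN : IsOpen N := hN'.inter (hU.preimage P.proj_smooth.continuous)
    have sκ' : ContMDiffOn 𝓘(ℝ, EB) IK ∞ κ N := sκ.mono Set.inter_subset_left
    have hNS : N ⊆ P.proj ⁻¹' S.U := fun z hz => hN'S hz.1
    have sp : ContMDiffOn 𝓘(ℝ, EB) 𝓘(ℝ, EV) ∞ P.proj N := P.proj_smooth.contMDiffOn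
    have dp : ∀ z, MDifferentiableAt 𝓘(ℝ, EB) 𝓘(ℝ, EV) P.proj z := fun z =>
      P.proj_smooth.mdifferentiable (by simp) z
    have pull : ∀ {f : V → ℂ}, ContMDiffOn 𝓘(ℝ, EV) 𝓘(ℝ, ℂ) ∞ f U → ∀ z ∈ N,
        ∀ v : TangentSpace 𝓘(ℝ, EB) z, mvfderiv 𝓘(ℝ, EB) (fun z => f (P.proj z)) z v
          = mvfderiv 𝓘(ℝ, EV) f (P.proj z) (mfderiv 𝓘(ℝ, EB) 𝓘(ℝ, EV) P.proj z v) :=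
      fun hf z hz v => mvfderiv_complex_comp_apply
        ((hf.contMDiffAt (hU.mem_nhds hz.2)).mdifferentiableAt (by simp)) (dp z) v
    have hC : ∀ (φ : W.toSmoothBundle.Sections) α, ContMDiffOn 𝓘(ℝ, EB) 𝓘(ℝ, ℂ) ∞
        (fun b => W.coeffAt S i hκ b (φ.1 b) α) N := fun φ α z hz => by
      have h1 := ContMDiffAt.comp z (f := fun b => (P.proj b, κ b))
        (W.contMDiffAt_pullCoord S i φ α (hNS hz) (hi _ (hNS hz)) (κ z))
        ((P.proj_smooth z).prodMk (sκ'.contMDiffAt (hN.mem_nhds hz)))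
      refine ContMDiffAt.contMDiffWithinAt (h1.congr_of_eventuallyEq
        (Filter.Eventually.of_forall fun b => ?_))
      exact W.coeffAt_eq_pullCoord S i hκ φ b α
    -- Near `b` the connection matrix is the pullback of `a`, that is `∑ μ, (A μ ∘ p) d(y μ ∘ p)`.
    have hmain := D.curvature_coeff hN (fun b => (W.coeffAt S i hκ b).toLinearMap) hC
      (A := fun μ α β z => A μ α β (P.proj z)) (y := fun μ z => y μ (P.proj z))
      (fun μ α β => (hA μ α β).comp sp fun z hz => hz.2) (fun μ => (hy μ).comp sp fun z hz => hz.2)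
      (fun φ z hz v α => by
        refine (W.coeffAt_toFun D S i a hi hD hN hNS sκ' hκ φ hz v α).trans ?_
        congr 1
        refine Finset.sum_congr rfl fun β _ => ?_
        rw [haA _ hz.2]
        congr 1
        exact Finset.sum_congr rfl fun μ _ => by rw [pull (hy μ) z hz])
      X Y φ (b := b) ⟨hbN', hb⟩
    -- Both endomorphisms are compared by their matrices in the invariant frame; the derivatives of
    -- the pulled back functions factor through `dp`.
    refine (W.coeffAt S i hκ b).injective (funext fun α => (hmain α).trans ?_)
    rw [W.coeffAt_rep]
    refine Finset.sum_congr rfl fun β _ => ?_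
    rw [W.orbitTwoForm_repr, matrixTwoForm_apply]
    have hbN : b ∈ N := ⟨hbN', hb⟩
    simp only [haA _ hb, pull (hA _ _ _) b hbN, pull (hy _) b hbN]
    rfl

end EqBundle

end Descent

/-! ### The 2-form `R₁ ⊗ o₂ + o₁ ⊗ R₂` -/

section TensorForms

universe u w u' w' u'' w''

variable {E : Type*} [NormedAddCommGroup E] [NormedSpace ℝ E] {H : Type*} [TopologicalSpace H]
  {I : ModelWithCorners ℝ E H} {M : Type*} [TopologicalSpace M] [ChartedSpace H M]
  [IsManifold I 1 M] {W₁ : SmoothBundle.{u, w} I M}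
  {W₂ : SmoothBundle.{u', w'} I M} {W₃ : SmoothBundle.{u'', w''} I M}

/-- The `2`-form `R₁ ⊗ o₂ + o₁ ⊗ R₂` with values in a bundle identified with `W₁ ⊗ W₂`. -/
def TwoForm.tensorSum {κ : ∀ x, (W₁.tensor W₂).Fib x ≃ₗ[ℂ] W₃.Fib x}
    (hκ : SmoothBundle.IsBundleIso _ _ κ) (o₁ : W₁.Sections) (o₂ : W₂.Sections)
    (R₁ : TwoForm W₁) (R₂ : TwoForm W₂) : TwoForm W₃ where
  toFun x :=
    (((κ x).toLinearMap ∘ₗ ((TensorProduct.mk ℂ (W₁.Fib x) (W₂.Fib x)).flip (o₂.1 x) :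
      W₁.Fib x →ₗ[ℂ] (W₁.tensor W₂).Fib x)).restrictScalars ℝ).compAlternatingMap (R₁.toFun x)
    + (((κ x).toLinearMap ∘ₗ ((TensorProduct.mk ℂ (W₁.Fib x) (W₂.Fib x)) (o₁.1 x) :
      W₂.Fib x →ₗ[ℂ] (W₁.tensor W₂).Fib x)).restrictScalars ℝ).compAlternatingMap (R₂.toFun x)
  smooth X Y := (hκ.isSmoothSection (W₁.tmulSection W₂ ⟨_, R₁.smooth X Y⟩ o₂).2).add
    (hκ.isSmoothSection (W₁.tmulSection W₂ o₁ ⟨_, R₂.smooth X Y⟩).2)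

theorem TwoForm.tensorSum_apply {κ : ∀ x, (W₁.tensor W₂).Fib x ≃ₗ[ℂ] W₃.Fib x}
    (hκ : SmoothBundle.IsBundleIso _ _ κ) (o₁ : W₁.Sections) (o₂ : W₂.Sections)
    (R₁ : TwoForm W₁) (R₂ : TwoForm W₂) (x : M) (X Y : TangentSpace I x) :
    (TwoForm.tensorSum hκ o₁ o₂ R₁ R₂).toFun x ![X, Y]
      = κ x (R₁.toFun x ![X, Y] ⊗ₜ[ℂ] o₂.1 x + o₁.1 x ⊗ₜ[ℂ] R₂.toFun x ![X, Y] :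
        W₁.Fib x ⊗[ℂ] W₂.Fib x) := ((κ x).map_add _ _).symm

end TensorForms

/-! ### Uniqueness, gluing, and the tensor product formula -/

section GlobalDescent

universe u w u' w'

variable {EK HK EG HG EB EV : Type*}
  [NormedAddCommGroup EK] [NormedSpace ℝ EK] [TopologicalSpace HK]
  [NormedAddCommGroup EG] [NormedSpace ℝ EG] [TopologicalSpace HG]
  [NormedAddCommGroup EB] [NormedSpace ℝ EB] [FiniteDimensional ℝ EB]
  [NormedAddCommGroup EV] [NormedSpace ℝ EV] [FiniteDimensional ℝ EV]
  {IK : ModelWithCorners ℝ EK HK} {IG : ModelWithCorners ℝ EG HG}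
  {K G B V : Type*} [Group K] [TopologicalSpace K] [ChartedSpace HK K]
  [Group G] [TopologicalSpace G] [ChartedSpace HG G] [LieGroup IK ∞ K] [LieGroup IG ∞ G]
  [TopologicalSpace B] [T2Space B] [ChartedSpace EB B] [IsManifold 𝓘(ℝ, EB) ∞ B]
  [TopologicalSpace V] [ChartedSpace EV V] [IsManifold 𝓘(ℝ, EV) ∞ V]
  {P : PrincipalBundle IG 𝓘(ℝ, EB) 𝓘(ℝ, EV) G B V} {c : LieCover IK IG K G}

namespace EqBundle

variable (W : EqBundle.{u, w} P c)

/-- A function with values in `End(W)/G` is determined by its representatives on projected vector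
fields and sections. -/
theorem eq_of_rep_eq {r r' : ∀ x, TangentSpace 𝓘(ℝ, EV) x → TangentSpace 𝓘(ℝ, EV) x → W.OrbitFib x}
    {x : V} (h : ∀ (X Y : VField 𝓘(ℝ, EB) B) (φ : W.toSmoothBundle.Sections) (b : B),
      P.proj b = x →
      W.rep (x := P.proj b) rfl (r (P.proj b) (mfderiv 𝓘(ℝ, EB) 𝓘(ℝ, EV) P.proj b (X.1 b))
          (mfderiv 𝓘(ℝ, EB) 𝓘(ℝ, EV) P.proj b (Y.1 b))) (φ.1 b)
        = W.rep (x := P.proj b) rfl (r' (P.proj b) (mfderiv 𝓘(ℝ, EB) 𝓘(ℝ, EV) P.proj b (X.1 b))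
          (mfderiv 𝓘(ℝ, EB) 𝓘(ℝ, EV) P.proj b (Y.1 b))) (φ.1 b))
    (ξ η : TangentSpace 𝓘(ℝ, EV) x) : r x ξ η = r' x ξ η := by
  obtain ⟨b, rfl⟩ := P.exists_proj_eq x
  obtain ⟨v, rfl⟩ := PrincipalBundle.mfderiv_proj_surjective c b ξ
  obtain ⟨v', rfl⟩ := PrincipalBundle.mfderiv_proj_surjective c b η
  obtain ⟨X, rfl⟩ := exists_vField_apply_eq b v
  obtain ⟨Y, rfl⟩ := exists_vField_apply_eq b v'
  refine (W.rep rfl).injective (LinearMap.ext fun w => ?_)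
  obtain ⟨φ, rfl⟩ := SmoothBundle.exists_section_apply_eq (W := W.toSmoothBundle) b w
  exact h X Y φ b rfl

/-- Two families representing the same curvature agree by `eq_of_rep_eq`. No smoothness or
bilinearity is asked of `r`, so the same statement gives the uniqueness of `R` and the formula for
tensor products. -/
theorem CurvatureDescendsTo.val_eq {n : ℕ} {𝒩 : NConnection n 𝓘(ℝ, EV) V}
    {W : EqBundle.{u, w} P c} {D : Connection W.toSmoothBundle} {R : DTwoForm 𝒩 W.orbitBundle}
    (hR : W.CurvatureDescendsTo D R)
    {r : ∀ x, TangentSpace 𝓘(ℝ, EV) x → TangentSpace 𝓘(ℝ, EV) x → W.OrbitFib x}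
    (hr : ∀ (X Y : VField 𝓘(ℝ, EB) B) (φ : W.toSmoothBundle.Sections) (b : B),
      D.curvature X Y φ b
        = W.rep (x := P.proj b) rfl (r (P.proj b) (mfderiv 𝓘(ℝ, EB) 𝓘(ℝ, EV) P.proj b (X.1 b))
          (mfderiv 𝓘(ℝ, EB) 𝓘(ℝ, EV) P.proj b (Y.1 b))) (φ.1 b))
    (x : V) (ξ η : TangentSpace 𝓘(ℝ, EV) x) : R.val x ξ η = r x ξ η :=
  W.eq_of_rep_eq (r := R.val) (fun X Y φ b _ => (hR X Y φ b).symm.trans (hr X Y φ b)) ξ η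

theorem CurvatureDescendsTo.unique {n : ℕ} {𝒩 : NConnection n 𝓘(ℝ, EV) V}
    {W : EqBundle.{u, w} P c} {D : Connection W.toSmoothBundle} {R R' : DTwoForm 𝒩 W.orbitBundle}
    (hR : W.CurvatureDescendsTo D R) (hR' : W.CurvatureDescendsTo D R') : R = R' :=
  DTwoForm.ext_val (hR.val_eq (r := R'.val) hR')

theorem curvatureDescendsTo_ofTwoForm {n : ℕ} {𝒩 : NConnection n 𝓘(ℝ, EV) V}
    {W : EqBundle.{u, w} P c} {D : Connection W.toSmoothBundle} {R : TwoForm W.orbitBundle}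
    (hR : ∀ (X Y : VField 𝓘(ℝ, EB) B) (φ : W.toSmoothBundle.Sections) (b : B),
      D.curvature X Y φ b = W.rep (x := P.proj b) rfl (R.toFun (P.proj b)
        ![mfderiv 𝓘(ℝ, EB) 𝓘(ℝ, EV) P.proj b (X.1 b),
          mfderiv 𝓘(ℝ, EB) 𝓘(ℝ, EV) P.proj b (Y.1 b)]) (φ.1 b)) :
    W.CurvatureDescendsTo D (DTwoForm.ofTwoForm 𝒩 R) := fun X Y φ b =>
  (hR X Y φ b).trans (congrArg (fun q => W.rep (x := P.proj b) rfl q (φ.1 b))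
    (DTwoForm.ofTwoForm_val 𝒩 R (P.proj b) _ _).symm)

/-- The curvature of a locally flat connection plus a pulled back connection matrix descends to
a `2`-form on the base. -/
theorem exists_curvatureDescendsTo {n : ℕ} (𝒩 : NConnection n 𝓘(ℝ, EV) V)
    (D : Connection W.toSmoothBundle) (hD : W.IsLocallyFlatAddPullback D) :
    ∃ R : DTwoForm 𝒩 W.orbitBundle, W.CurvatureDescendsTo D R := by
  choose U S i r hU hxU hUS hsm hr using W.exists_local_descent D hD
  -- The local form around `x₀` and the one chosen for `x` represent the same curvature over `x`, so
  -- they coincide there; the pointwise choice `r x x` is therefore locally one smooth form.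
  have hrr : ∀ x₀, ∀ x ∈ U x₀, ∀ ξ η, r x₀ x ![ξ, η] = r x x ![ξ, η] := fun x₀ x hx =>
    W.eq_of_rep_eq (r := fun y ξ η => r x₀ y ![ξ, η]) (r' := fun y ξ η => r x y ![ξ, η])
      fun X Y φ b hb => by
        subst hb
        exact (hr x₀ X Y φ b hx).symm.trans (hr _ X Y φ b (hxU _))
  let R : TwoForm W.orbitBundle :=
    { toFun := fun x => r x x
      smooth := fun X Y => SmoothBundle.isSmoothSection_of_frames fun x₀ =>
        ⟨(S x₀, i x₀), hUS x₀ (hxU x₀), fun α => by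
          refine ((hsm x₀ X Y α).contMDiffAt ((hU x₀).mem_nhds (hxU x₀))).congr_of_eventuallyEq ?_
          filter_upwards [(hU x₀).mem_nhds (hxU x₀)] with x hx
          exact congrArg (fun q => (W.orbitFrame (S x₀) (i x₀) x).repr q α)
            (hrr x₀ x hx (X.1 x) (Y.1 x)).symm⟩ }
  exact ⟨_, curvatureDescendsTo_ofTwoForm (R := R) fun X Y φ b => hr (P.proj b) X Y φ b (hxU _)⟩

variable {W} {W' : EqBundle.{u', w'} P c}

/-- The curvature of a tensor product connection. -/
theorem curvature_tensor {n : ℕ} {𝒩 : NConnection n 𝓘(ℝ, EV) V}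
    {D : Connection W.toSmoothBundle} {D' : Connection W'.toSmoothBundle}
    {Dt : Connection (W.tensor W').toSmoothBundle} (h : D.IsTensor D' Dt)
    {R : DTwoForm 𝒩 W.orbitBundle} {R' : DTwoForm 𝒩 W'.orbitBundle}
    (hR : W.CurvatureDescendsTo D R) (hR' : W'.CurvatureDescendsTo D' R')
    (X Y : VField 𝓘(ℝ, EB) B) (σ : (W.tensor W').toSmoothBundle.Sections) (b : B) :
    Dt.curvature X Y σ b = (W.tensor W').rep (x := P.proj b) rfl
      (W.orbitTensorEquiv W' (P.proj b) (W.tensorSumVal W' R R' (P.proj b)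
        (mfderiv 𝓘(ℝ, EB) 𝓘(ℝ, EV) P.proj b (X.1 b))
        (mfderiv 𝓘(ℝ, EB) 𝓘(ℝ, EV) P.proj b (Y.1 b)))) (σ.1 b) := by
  set F := (W.tensor W').rep (x := P.proj b) rfl
      (W.orbitTensorEquiv W' (P.proj b) (W.tensorSumVal W' R R' (P.proj b)
        (mfderiv 𝓘(ℝ, EB) 𝓘(ℝ, EV) P.proj b (X.1 b))
        (mfderiv 𝓘(ℝ, EB) 𝓘(ℝ, EV) P.proj b (Y.1 b)))) with hF
  -- An endomorphism of the fibre is a derivation along the zero vector, as curvature is, so it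
  -- suffices to compare the two on products `φ ⊗ ψ`.
  have hFd : (W.toSmoothBundle.tensor W'.toSmoothBundle).IsDerivationAt b 0
      fun σ => F (σ.1 b) := by
    refine ⟨fun φ ψ => F.map_add _ _, fun f hf φ => ?_⟩
    rw [map_zero, zero_smul, zero_add]
    exact F.map_smul _ _
  refine (Dt.curvature_isDerivationAt X Y b).eq_of_tmul hFd (fun φ ψ => ?_) σ
  refine (h.curvature_tmul X Y φ ψ b).trans ?_
  -- At `b`, the class of `R ⊗ 1 + 1 ⊗ R'` is represented by the corresponding sum of tensor
  -- products of endomorphisms, the identity class being the identity at every point.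
  have hFe : F = (TensorProduct.map (W.rep (x := P.proj b) rfl (R.val (P.proj b)
        (mfderiv 𝓘(ℝ, EB) 𝓘(ℝ, EV) P.proj b (X.1 b))
        (mfderiv 𝓘(ℝ, EB) 𝓘(ℝ, EV) P.proj b (Y.1 b)))) 1
      + TensorProduct.map 1 (W'.rep (x := P.proj b) rfl (R'.val (P.proj b)
        (mfderiv 𝓘(ℝ, EB) 𝓘(ℝ, EV) P.proj b (X.1 b))
        (mfderiv 𝓘(ℝ, EB) 𝓘(ℝ, EV) P.proj b (Y.1 b)))) :
        W.Fib b ⊗[ℂ] W'.Fib b →ₗ[ℂ] W.Fib b ⊗[ℂ] W'.Fib b) := by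
    refine (congrArg ((W.tensor W').rep (x := P.proj b) rfl)
      ((W.orbitTensorEquiv W' (P.proj b)).map_add _ _)).trans ?_
    refine (((W.tensor W').rep (x := P.proj b) rfl).map_add _ _).trans ?_
    refine congrArg₂ (· + ·) ((W.rep_orbitTensorEquiv W' rfl _ _).trans ?_)
      ((W.rep_orbitTensorEquiv W' rfl _ _).trans ?_)
    · exact congrArg (TensorProduct.map _) (W'.rep_orbitMk_one _ _)
    · exact congrArg (fun T => TensorProduct.map T _) (W.rep_orbitMk_one _ _)
  rw [hR X Y φ b, hR' X Y ψ b]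
  exact (congrArg (fun L : W.Fib b ⊗[ℂ] W'.Fib b →ₗ[ℂ] W.Fib b ⊗[ℂ] W'.Fib b =>
    L (φ.1 b ⊗ₜ[ℂ] ψ.1 b)) hFe).symm

/-- The curvature of a tensor product connection descends to `R ⊗ 1 + 1 ⊗ R'`. -/
theorem exists_curvatureDescendsTo_tensor {n : ℕ} {𝒩 : NConnection n 𝓘(ℝ, EV) V}
    {D : Connection W.toSmoothBundle} {D' : Connection W'.toSmoothBundle}
    {Dt : Connection (W.tensor W').toSmoothBundle} (h : D.IsTensor D' Dt)
    {R : DTwoForm 𝒩 W.orbitBundle} {R' : DTwoForm 𝒩 W'.orbitBundle}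
    (hR : W.CurvatureDescendsTo D R) (hR' : W'.CurvatureDescendsTo D' R') :
    ∃ RB : DTwoForm 𝒩 (W.tensor W').orbitBundle, (W.tensor W').CurvatureDescendsTo Dt RB := by
  have hκ : SmoothBundle.IsBundleIso (W.orbitBundle.tensor W'.orbitBundle)
    (W.tensor W').orbitBundle fun x => W.orbitTensorEquiv W' x :=
    (isCanonicalIso_orbitTensorEquiv W W').1
  set RT : TwoForm (W.tensor W').orbitBundle := TwoForm.tensorSum hκ
    ⟨_, isSmoothSection_oneSection W⟩ ⟨_, isSmoothSection_oneSection W'⟩ R.total R'.total with hRT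
  have hval : ∀ x ξ η, RT.toFun x ![ξ, η]
      = W.orbitTensorEquiv W' x (W.tensorSumVal W' R R' x ξ η) := fun x ξ η =>
    TwoForm.tensorSum_apply hκ _ _ R.total R'.total x ξ η
  -- From here on only the values `hval` of the form matter.
  clear_value RT
  exact ⟨_, curvatureDescendsTo_ofTwoForm (R := RT) fun X Y σ b =>
    (curvature_tensor h hR hR' X Y σ b).trans
    (congrArg (fun q => (W.tensor W').rep (x := P.proj b) rfl q (σ.1 b)) (hval _ _ _).symm)⟩

end EqBundle

end GlobalDescent

end

/-! ### The theorem -/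

theorem mainTheorem9 {n m k : ℕ} [NeZero k] {Eh Ev EB : Type*}
    [NormedAddCommGroup Eh] [NormedSpace ℝ Eh] [FiniteDimensional ℝ Eh]
    [NormedAddCommGroup Ev] [NormedSpace ℝ Ev] [FiniteDimensional ℝ Ev]
    [NormedAddCommGroup EB] [NormedSpace ℝ EB] [FiniteDimensional ℝ EB]
    -- the Lie d-group `(Gh, Gv)` and its central extension `(Kh, Kv)` by `ℤ/k`
    {Gh Gv Kh Kv : Type*}
    [Group Gh] [TopologicalSpace Gh] [ChartedSpace Eh Gh] [LieGroup 𝓘(ℝ, Eh) ∞ Gh]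
    [Group Gv] [TopologicalSpace Gv] [ChartedSpace Ev Gv] [LieGroup 𝓘(ℝ, Ev) ∞ Gv]
    [Group Kh] [TopologicalSpace Kh] [ChartedSpace Eh Kh] [LieGroup 𝓘(ℝ, Eh) ∞ Kh]
    [Group Kv] [TopologicalSpace Kv] [ChartedSpace Ev Kv] [LieGroup 𝓘(ℝ, Ev) ∞ Kv]
    (ch : CentralExtension k 𝓘(ℝ, Eh) 𝓘(ℝ, Eh) Kh Gh)
    (cv : CentralExtension k 𝓘(ℝ, Ev) 𝓘(ℝ, Ev) Kv Gv)
    -- the N-anholonomic manifold `V` and the principal bundle `B → V`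
    {V : Type*} [TopologicalSpace V] [T2Space V] [SigmaCompactSpace V]
    [ChartedSpace (EuclideanSpace ℝ (Fin (n + m))) V]
    [IsManifold 𝓘(ℝ, EuclideanSpace ℝ (Fin (n + m))) ∞ V]
    (𝒩 : NConnection n 𝓘(ℝ, EuclideanSpace ℝ (Fin (n + m))) V)
    {B : Type*} [TopologicalSpace B] [T2Space B] [SigmaCompactSpace B]
    [ChartedSpace EB B] [IsManifold 𝓘(ℝ, EB) ∞ B]
    (P : PrincipalBundle (𝓘(ℝ, Eh).prod 𝓘(ℝ, Ev)) 𝓘(ℝ, EB)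
      𝓘(ℝ, EuclideanSpace ℝ (Fin (n + m))) (Gh × Gv) B V)
    -- a module `W` with a module d-connection `D`
    {q : ℤ} (W : PsiModule P ch cv q) (D : W.DConnection) (hD : W.IsModuleDConnection D) :
    -- the curvature of `D` descends to a unique `R ∈ ω²(V, E(W))`, `E(W) = End(W)/G`
    (∃! R : ∀ p, DTwoForm 𝒩 (W.comp p).orbitBundle,
      ∀ p, (W.comp p).CurvatureDescendsTo (D p) (R p)) ∧
    -- tensor products with a second module `W'` with a module d-connection `D'`
    ∀ {q' : ℤ} (W' : PsiModule P ch cv q') (D' : W'.DConnection), W'.IsModuleDConnection D' →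
      ∀ p p' : HVPart,
        -- the tensor product connection exists and is unique
        (∃! Dt : Connection ((W.comp p).tensor (W'.comp p')).toSmoothBundle,
          (D p).IsTensor (D' p') Dt) ∧
        -- its curvature descends to a unique `RB ∈ ω²(V, E(W ⊗ W'))`
        (∀ Dt : Connection ((W.comp p).tensor (W'.comp p')).toSmoothBundle,
          (D p).IsTensor (D' p') Dt →
          ∃! RB : DTwoForm 𝒩 ((W.comp p).tensor (W'.comp p')).orbitBundle,
            ((W.comp p).tensor (W'.comp p')).CurvatureDescendsTo Dt RB) ∧
        -- `E(W) ⊗ E(W') = E(W ⊗ W')`, and under this identification `RB = R ⊗ 1 + 1 ⊗ R'`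
        ∃ κ : ∀ x, ((W.comp p).orbitBundle.tensor (W'.comp p').orbitBundle).Fib x ≃ₗ[ℂ]
            ((W.comp p).tensor (W'.comp p')).orbitBundle.Fib x,
          EqBundle.IsCanonicalIso (W.comp p) (W'.comp p') κ ∧
          ∀ (Dt : Connection ((W.comp p).tensor (W'.comp p')).toSmoothBundle)
            (R : DTwoForm 𝒩 (W.comp p).orbitBundle) (R' : DTwoForm 𝒩 (W'.comp p').orbitBundle)
            (RB : DTwoForm 𝒩 ((W.comp p).tensor (W'.comp p')).orbitBundle),
            (D p).IsTensor (D' p') Dt →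
            (W.comp p).CurvatureDescendsTo (D p) R →
            (W'.comp p').CurvatureDescendsTo (D' p') R' →
            ((W.comp p).tensor (W'.comp p')).CurvatureDescendsTo Dt RB →
            ∀ (x : V) (X Y : TangentSpace 𝓘(ℝ, EuclideanSpace ℝ (Fin (n + m))) x),
              RB.val x X Y = κ x (EqBundle.tensorSumVal (W.comp p) (W'.comp p') R R' x X Y) := by
  have hex : ∀ p, ∃ R : DTwoForm 𝒩 (W.comp p).orbitBundle, (W.comp p).CurvatureDescendsTo (D p) R :=
    fun p => (W.comp p).exists_curvatureDescendsTo 𝒩 (D p) (hD.locally_flat_add_pullback p)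
  refine ⟨?_, fun {q'} W' D' hD' p p' => ⟨?_, fun Dt hDt => ?_, ?_⟩⟩
  · choose R hR using hex
    exact ⟨R, hR, fun R' hR' => funext fun p => (hR' p).unique (hR p)⟩
  · obtain ⟨Dt, hDt⟩ := Connection.exists_isTensor (D p) (D' p')
    exact ⟨Dt, hDt, fun Dt' hDt' => Connection.IsTensor.unique hDt' hDt⟩
  · obtain ⟨R, hR⟩ := hex p
    obtain ⟨R', hR'⟩ := (W'.comp p').exists_curvatureDescendsTo 𝒩 (D' p')
      (hD'.locally_flat_add_pullback p')
    obtain ⟨RB, hRB⟩ := EqBundle.exists_curvatureDescendsTo_tensor hDt hR hR'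
    exact ⟨RB, hRB, fun RB' hRB' => hRB'.unique hRB⟩
  · refine ⟨fun x => (W.comp p).orbitTensorEquiv (W'.comp p') x,
      EqBundle.isCanonicalIso_orbitTensorEquiv _ _, fun Dt R R' RB hDt hR hR' hRB x X Y => ?_⟩
    -- `RB` and the image of `R ⊗ 1 + 1 ⊗ R'` both represent the curvature of `Dt`.
    exact hRB.val_eq (r := fun x X Y => (W.comp p).orbitTensorEquiv (W'.comp p') x
      (EqBundle.tensorSumVal (W.comp p) (W'.comp p') R R' x X Y))
      (fun X Y σ b => EqBundle.curvature_tensor hDt hR hR' X Y σ b) x X Y
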